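/- Let $n\ge 2$, $\sigma=\frac{n-1}{2}$, $\alpha\ge 0$ and $\lambda=\sigma^2+\alpha^2$. Let $[x,y]=x_0y_0-x_1y_1-\dots-x_ny_n$ on $\mathbb R^{n+1}$, let $\mathbb H^n=\{x:\ [x,x]=1,\ x_0>0\}$ be hyperbolic space with distance $d(x,y)=\cosh^{-1}[x,y]$, and let $\Delta_{\mathbb H^n}$ be its Laplace–Beltrami operator, i.e. $\Delta_{\mathbb H^n}f=\square\, f(x/\sqrt{[x,x]})\big|_{\mathbb H^n}$ with $\square=-\partial_{x_0}^2+\partial_{x_1}^2+\dots+\partial_{x_n}^2$. A generalized $\lambda$-eigenfunction is a smooth function $f$ on $\mathbb H^n$ with $\Delta_{\mathbb H^n}f+\lambda f=0$ and $f\notin L^2(\mathbb H^n)$. Let $\omega_k$ be the surface measure of the unit sphere $S^k$ (so $\omega_0=2$), let $\bar\varsigma_{n-1}$ be the uniform probability measure on $S^{n-1}$, and put $$F_{n,\lambda}(r)=\frac{\omega_{n-2}}{\omega_{n-1}}\int_0^\pi(\cosh r-\sinh r\cos\theta)^{-\sigma+i\alpha}(\sin\theta)^{n-2}\,d\theta,\qquad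 e_n(x,\alpha,\vartheta)=[x,(1,\vartheta)]^{-\sigma+i\alpha}\quad(x\in\mathbb H^n,\ \vartheta\in S^{n-1}).$$ $N_{\mathbb C}(0,1)$ is the law of $X+iY$ with $X,Y$ independent $N(0,\frac12)$ variables. A real white noise on a finite measure space $(X,\mu)$ is a centred real Gaussian family $U=\{U(f):f\in L^2(\mu;\mathbb R)\}$ with $\mathbb E[U(f)U(g)]=\int fg\,d\mu$, extended by $U(f)=U(\mathrm{Re} f)+iU(\mathrm{Im} f)$; a complex white noise on $(X,\mu)$ is a family $\{W(f):f\in L^2(\mu;\mathbb C)\}$ with the law of $(U+iV)/\sqrt2$, where $U,V$ are independent real white noises (so that $\mathbb E[W(f)\overline{W(g)}]=\int f\bar g\,d\mu$ and $\mathbb E[W(f)W(g)]=0$); one writes $\int f\,dW=W(f)$. A complex field is called Gaussian if it is jointly Gaussian as a field with values in $\mathbb R^2$. **(1)** There exists a Gaussian random field $u_\lambda:\mathbb H^n\to\mathbb R$, unique in law, such that (i) $u_\lambda(x)\sim N(0,1)$ for all $x\in\mathbb H^n$; (ii) the law of $u_\lambda$ is invariant under the isometries of $\mathbb H^n$; (iii)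 almost all samples of $u_\lambda$ are generalized $\lambda$-eigenfunctions of $\Delta_{\mathbb H^n}$, of class $C^\infty(\mathbb H^n)$. The same holds for Gaussian random fields $u_\lambda^{\mathbb C}:\mathbb H^n\to\mathbb C$ when (i) is replaced by $u_\lambda^{\mathbb C}(x)\sim N_{\mathbb C}(0,1)$. In both cases uniqueness already holds when in (iii) one only asks that almost all samples be smooth solutions of $\Delta_{\mathbb H^n}f+\lambda f=0$. **(2)** Among Gaussian fields, the law of $u_\lambda$ is equivalently characterized by $$\mathbb E[u_\lambda(x)]=0,\qquad \mathbb E[u_\lambda(x)u_\lambda(y)]=F_{n,\lambda}(d(x,y)),\qquad x,y\in\mathbb H^n.$$ Moreover $\sqrt2\,\mathrm{Re}\,u_\lambda^{\mathbb C}$ and $\sqrt2\,\mathrm{Im}\,u_\lambda^{\mathbb C}$ are two independent Gaussian random fields, each with the same law as $u_\lambda$. **(3)** If $W$ is a complex white noise on $(S^{n-1},\bar\varsigma_{n-1})$, then $u_\lambda^{\mathbb C}$ has the same law as the field $$x\longmapsto\int_{S^{n-1}}e_n(x,\alpha,\vartheta)\,W(d\vartheta).$$ -/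

import Mathlib

open MeasureTheory ProbabilityTheory

universe a b

noncomputable section

/-! ### Hyperbolic space: the hyperboloid model -/

/-- The ambient space `ℝ^{1+n}`; a point is `(x₀, x')` with `x' = (x₁, …, xₙ)`. Its norm is only
used through the topology and the smooth structure. -/
abbrev MinkowskiSpace (n : ℕ) : Type := ℝ × EuclideanSpace ℝ (Fin n)

/-- The Minkowski form `[x, y] = x₀ y₀ - x₁ y₁ - ⋯ - xₙ yₙ`. -/
def minkowski {n : ℕ} (x y : MinkowskiSpace n) : ℝ := x.1 * y.1 - inner ℝ x.2 y.2

/-- The upper sheet `x₀ > 0` of the hyperboloid `[x, x] = 1`. -/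
def HyperbolicSpace (n : ℕ) : Type := {x : MinkowskiSpace n // 0 < x.1 ∧ minkowski x x = 1}

instance (n : ℕ) : MeasurableSpace (HyperbolicSpace n) :=
  inferInstanceAs (MeasurableSpace {x : MinkowskiSpace n // 0 < x.1 ∧ minkowski x x = 1})

/-- The hyperbolic distance `d(x, y) = cosh⁻¹ [x, y]`. -/
def hypDist {n : ℕ} (x y : HyperbolicSpace n) : ℝ := Real.arcosh (minkowski x.1 y.1)

/-- Isometries of hyperbolic space: distance preserving bijections. -/
def IsHypIsometry {n : ℕ} (g : HyperbolicSpace n ≃ HyperbolicSpace n) : Prop :=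
  ∀ x y, hypDist (g x) (g y) = hypDist x y

/-- The point of the hyperboloid above `v ∈ ℝⁿ` (a global chart). -/
def hypPoint {n : ℕ} (v : EuclideanSpace ℝ (Fin n)) : HyperbolicSpace n :=
  ⟨(√(1 + ‖v‖ ^ 2), v), by
    have h : 0 < 1 + ‖v‖ ^ 2 := by positivity
    refine ⟨Real.sqrt_pos.2 h, ?_⟩
    simp only [minkowski, real_inner_self_eq_norm_sq]
    rw [Real.mul_self_sqrt h.le]
    ring⟩

/-- The Riemannian volume: in the global chart it is `dv / √(1 + |v|²)`. -/
def hypVolume (n : ℕ) : Measure (HyperbolicSpace n) :=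
  ((volume : Measure (EuclideanSpace ℝ (Fin n))).withDensity
    (fun v => ENNReal.ofReal (1 / √(1 + ‖v‖ ^ 2)))).map hypPoint

/-- The open future cone `{x₀ > 0, [x, x] > 0}`, diffeomorphic to `ℍⁿ × (0, ∞)`. -/
def futureCone (n : ℕ) : Set (MinkowskiSpace n) := {x | 0 < x.1 ∧ 0 < minkowski x x}

/-- The radial projection `x ↦ x / √[x, x]` of the future cone onto the hyperboloid. -/
def radialProj {n : ℕ} (x : MinkowskiSpace n) (hx : x ∈ futureCone n) : HyperbolicSpace n :=
  ⟨(√(minkowski x x))⁻¹ • x, by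
    have h : 0 < √(minkowski x x) := Real.sqrt_pos.2 hx.2
    refine ⟨?_, ?_⟩
    · simpa using mul_pos (inv_pos.2 h) hx.1
    · have e : minkowski ((√(minkowski x x))⁻¹ • x) ((√(minkowski x x))⁻¹ • x)
          = (√(minkowski x x))⁻¹ * (√(minkowski x x))⁻¹ * minkowski x x := by
        simp only [minkowski, Prod.smul_fst, Prod.smul_snd, smul_eq_mul, real_inner_smul_left,
          real_inner_smul_right]
        ring
      rw [e, ← mul_inv, Real.mul_self_sqrt hx.2.le, inv_mul_cancel₀ hx.2.ne']⟩

open Classical in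
/-- The extension `x ↦ f (x / √[x, x])` of a function on the hyperboloid to the future cone
(and by `0`, irrelevantly, outside the open cone). -/
def radialExt {n : ℕ} {F : Type*} [Zero F] (f : HyperbolicSpace n → F) (x : MinkowskiSpace n) : F :=
  if hx : x ∈ futureCone n then f (radialProj x hx) else 0

/-- `f` is of class `C^∞` on hyperbolic space. -/
def HypSmooth {n : ℕ} {F : Type*} [NormedAddCommGroup F] [NormedSpace ℝ F]
    (f : HyperbolicSpace n → F) : Prop :=
  ContDiffOn ℝ ((⊤ : ℕ∞) : WithTop ℕ∞) (radialExt f) (futureCone n)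

/-- The d'Alembert operator `□ = -∂²/∂x₀² + ∂²/∂x₁² + ⋯ + ∂²/∂xₙ²`. -/
def dAlembert {n : ℕ} {F : Type*} [NormedAddCommGroup F] [NormedSpace ℝ F]
    (h : MinkowskiSpace n → F) (x : MinkowskiSpace n) : F :=
  -iteratedFDeriv ℝ 2 h x (fun _ => ((1 : ℝ), 0)) +
    ∑ i : Fin n, iteratedFDeriv ℝ 2 h x (fun _ => ((0 : ℝ), EuclideanSpace.single i (1 : ℝ)))

/-- The Laplace–Beltrami operator (a negative operator with this sign), as the d'Alembert operator
applied to the extension `x ↦ f (x / √[x, x])`, on the hyperboloid. -/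
def hypLaplacian {n : ℕ} {F : Type*} [NormedAddCommGroup F] [NormedSpace ℝ F]
    (f : HyperbolicSpace n → F) (x : HyperbolicSpace n) : F :=
  dAlembert (radialExt f) x.1

/-- Smooth solutions of `Δ f + lam f = 0`. -/
structure IsHypEigenfunction {n : ℕ} {F : Type*} [NormedAddCommGroup F] [NormedSpace ℝ F]
    (lam : ℝ) (f : HyperbolicSpace n → F) : Prop where
  smooth : HypSmooth f
  eigen : ∀ x, hypLaplacian f x + lam • f x = 0

/-! ### Spherical functions and plane waves -/

/-- The bottom parameter `σ = (n - 1) / 2`. -/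
def hypSigma (n : ℕ) : ℝ := ((n : ℝ) - 1) / 2

/-- The surface measure of the unit sphere `S^{m-1}` of `ℝᵐ`. -/
def sphereMeasure (m : ℕ) : Measure (Metric.sphere (0 : EuclideanSpace ℝ (Fin m)) 1) :=
  (volume : Measure (EuclideanSpace ℝ (Fin m))).toSphere

/-- `ω_{m-1}`, the total surface measure of the unit sphere `S^{m-1}` of `ℝᵐ`. -/
def sphereArea (m : ℕ) : ℝ := (sphereMeasure m).real Set.univ

/-- The normalised (uniform) surface measure of `S^{n-1}`. -/
def uniformSphere (n : ℕ) : Measure (Metric.sphere (0 : EuclideanSpace ℝ (Fin n)) 1) :=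
  (sphereMeasure n Set.univ)⁻¹ • sphereMeasure n

/-- The spherical function `F_{n,λ}(r)`, `λ = σ² + α²`:
`ω_{n-2} / ω_{n-1} ∫_0^π (cosh r - sinh r cos θ)^{-σ + iα} (sin θ)^{n-2} dθ`. -/
def sphericalFunction (n : ℕ) (α r : ℝ) : ℂ :=
  ((sphereArea (n - 1) / sphereArea n : ℝ) : ℂ) *
    ∫ θ in (0 : ℝ)..Real.pi,
      ((Real.cosh r - Real.sinh r * Real.cos θ : ℝ) : ℂ) ^
          (-(hypSigma n : ℂ) + Complex.I * (α : ℂ)) *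
        ((Real.sin θ ^ (n - 2) : ℝ) : ℂ)

/-- The hyperbolic plane wave `e_n(x, α, u) = [x, (1, u)]^{-σ + iα}`. -/
def planeWave {n : ℕ} (x : HyperbolicSpace n) (α : ℝ)
    (u : Metric.sphere (0 : EuclideanSpace ℝ (Fin n)) 1) : ℂ :=
  ((minkowski x.1 (1, (u : EuclideanSpace ℝ (Fin n))) : ℝ) : ℂ) ^
    (-(hypSigma n : ℂ) + Complex.I * (α : ℂ))

instance (n : ℕ) : IsFiniteMeasure (uniformSphere n) where
  measure_univ_lt_top := by
    simp only [uniformSphere, Measure.smul_apply, smul_eq_mul]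
    exact lt_of_le_of_lt (ENNReal.inv_mul_le_one _) ENNReal.one_lt_top

theorem minkowski_lightlike_pos {n : ℕ} (x : HyperbolicSpace n)
    (u : Metric.sphere (0 : EuclideanSpace ℝ (Fin n)) 1) :
    0 < minkowski x.1 (1, (u : EuclideanSpace ℝ (Fin n))) := by
  obtain ⟨⟨a, v⟩, h0, h1⟩ := x
  have hu : ‖(u : EuclideanSpace ℝ (Fin n))‖ = 1 := by simp
  have hi := real_inner_le_norm v (u : EuclideanSpace ℝ (Fin n))
  simp only [minkowski, real_inner_self_eq_norm_sq] at h0 h1 ⊢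
  rw [hu, mul_one] at hi
  have : ‖v‖ < a := by nlinarith [norm_nonneg v]
  linarith

theorem continuous_planeWave {n : ℕ} (x : HyperbolicSpace n) (α : ℝ) :
    Continuous (planeWave x α) := by
  unfold planeWave
  refine Continuous.cpow ?_ continuous_const ?_
  · unfold minkowski
    fun_prop
  · intro u
    exact Or.inl (by simpa using minkowski_lightlike_pos x u)

theorem memLp_planeWave {n : ℕ} (x : HyperbolicSpace n) (α : ℝ) :
    MemLp (planeWave x α) 2 (uniformSphere n) :=
  (continuous_planeWave x α).memLp_of_hasCompactSupport (HasCompactSupport.of_compactSpace _)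

/-- The plane wave `e_n(x, α, ·)` as an element of `L²(S^{n-1}; ℂ)`. -/
def planeWaveLp {n : ℕ} (x : HyperbolicSpace n) (α : ℝ) : Lp ℂ 2 (uniformSphere n) :=
  (memLp_planeWave x α).toLp _

/-! ### Random fields -/

/-- Two random fields have the same law (as random elements of the product space `E^T`). -/
def SameLaw {T E Ω Ω' : Type*} [MeasurableSpace E] [MeasurableSpace Ω] [MeasurableSpace Ω']
    (P : Measure Ω) (u : T → Ω → E) (P' : Measure Ω') (v : T → Ω' → E) : Prop :=
  IdentDistrib (fun ω x => u x ω) (fun ω x => v x ω) P P'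

/-- The standard complex Gaussian law `N_ℂ(0, 1)`: independent real and imaginary parts, each
`N(0, 1/2)`. -/
def stdComplexGaussian : Measure ℂ :=
  ((gaussianReal 0 (1 / 2)).prod (gaussianReal 0 (1 / 2))).map (fun p : ℝ × ℝ => (⟨p.1, p.2⟩ : ℂ))

/-- An isometry-invariant Gaussian field on `ℍⁿ` with values in `E` (`ℝ`, or `ℂ` seen as a real
plane), with one-point marginal `ν`, almost all of whose samples are smooth solutions of
`Δ f + lam f = 0`. -/
structure IsHypGaussianWave {E : Type*} [NormedAddCommGroup E] [NormedSpace ℝ E]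
    [MeasurableSpace E] (ν : Measure E) (n : ℕ) (lam : ℝ) {Ω : Type*} [MeasurableSpace Ω]
    (P : Measure Ω) (u : HyperbolicSpace n → Ω → E) : Prop where
  measurable : ∀ x, Measurable (u x)
  gaussian : IsGaussianProcess u P
  marginal : ∀ x, P.map (u x) = ν
  invariant : ∀ g : HyperbolicSpace n ≃ HyperbolicSpace n, IsHypIsometry g →
    SameLaw P (fun x => u (g x)) P u
  eigen : ∀ᵐ ω ∂P, IsHypEigenfunction lam (fun x => u x ω)

/-- The real hyperbolic random wave `u_λ`. -/
abbrev IsRealWave (n : ℕ) (lam : ℝ) {Ω : Type*} [MeasurableSpace Ω] (P : Measure Ω)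
    (u : HyperbolicSpace n → Ω → ℝ) : Prop :=
  IsHypGaussianWave (gaussianReal 0 1) n lam P u

/-- The complex hyperbolic random wave `u_λ^ℂ`. -/
abbrev IsComplexWave (n : ℕ) (lam : ℝ) {Ω : Type*} [MeasurableSpace Ω] (P : Measure Ω)
    (u : HyperbolicSpace n → Ω → ℂ) : Prop :=
  IsHypGaussianWave stdComplexGaussian n lam P u

/-- A real white noise with intensity `μ`: a centred Gaussian family indexed by `L²(μ; ℝ)` with
`E[U(f) U(g)] = ∫ f g dμ`. -/
structure IsRealWhiteNoise {X Ω : Type*} [MeasurableSpace X] [MeasurableSpace Ω] (μ : Measure X)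
    (P : Measure Ω) (U : Lp ℝ 2 μ → Ω → ℝ) : Prop where
  measurable : ∀ f, Measurable (U f)
  gaussian : IsGaussianProcess U P
  mean : ∀ f, ∫ ω, U f ω ∂P = 0
  cov : ∀ f g, ∫ ω, U f ω * U g ω ∂P = ∫ x, f x * g x ∂μ

/-- The complex-linear extension `U(f) = U(Re f) + i U(Im f)` of a family indexed by `L²(μ; ℝ)`. -/
def complexExt {X Ω : Type*} [MeasurableSpace X] {μ : Measure X} (U : Lp ℝ 2 μ → Ω → ℝ)
    (f : Lp ℂ 2 μ) (ω : Ω) : ℂ :=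
  (U (Complex.reCLM.compLp f) ω : ℂ) + Complex.I * (U (Complex.imCLM.compLp f) ω : ℂ)

/-- A complex white noise with intensity `μ`: a family indexed by `L²(μ; ℂ)` with the law of
`(U + i V) / √2`, where `U`, `V` are independent real white noises with intensity `μ`; so
`E[W(f) conj W(g)] = ∫ f conj g dμ` and `E[W(f) W(g)] = 0`. -/
def IsComplexWhiteNoise {X : Type} {Ω : Type*} [MeasurableSpace X] [MeasurableSpace Ω]
    (μ : Measure X) (P : Measure Ω) (W : Lp ℂ 2 μ → Ω → ℂ) : Prop :=
  (∀ f, Measurable (W f)) ∧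
  ∃ (Ω' : Type) (_ : MeasurableSpace Ω') (P' : Measure Ω') (U V : Lp ℝ 2 μ → Ω' → ℝ),
    IsProbabilityMeasure P' ∧ IsRealWhiteNoise μ P' U ∧ IsRealWhiteNoise μ P' V ∧
    IndepFun (fun ω f => U f ω) (fun ω f => V f ω) P' ∧
    SameLaw P W P'
      (fun f ω => ((√2)⁻¹ : ℝ) * (complexExt U f ω + Complex.I * complexExt V f ω))

end

/-!
The law of a Gaussian field is determined by its means and covariances
(`ProbabilityTheory.IsGaussianProcess.sameLaw`), so the uniqueness statements come down to computing
the covariance of an isometry invariant Gaussian field `u` whose samples solve `Δ f + λ f = 0`. By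
invariance only `E[u(o) u(x)]` for the origin `o` is needed, and `x` may be averaged over the
geodesic sphere about `o`. By Fubini this replaces the sample by its spherical mean, a solution of
the radial part of the equation which is regular at the origin (`isRadialSolution_sphericalMean`,
by the divergence theorem on the sphere in the form `integral_fderiv_tangent`). The regular radial
solutions form a line (`IsRadialSolution.mul_eq_mul`), and the spherical function `F` is the
spherical mean of a plane wave; hence the covariance is `F(d(x, y))`
(`IsHypGaussianWave.integral_mul`). Since neither square integrability nor its failure is used here,
uniqueness holds among fields of smooth eigenfunctions. That the samples are not square integrable
follows from invariance, as the one-point law has no atom at `0` and the volume is infinite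
(`IsHypGaussianWave.ae_not_memLp`).

For the existence, take a complex isonormal process on `L²` of the sphere
(`exists_complex_isonormal`) and evaluate it on the plane waves `e(x, ·)`. The kernel
`∫ e(x, ϑ) conj e(y, ϑ) dϑ` is invariant under Lorentz boosts, because its derivative along a boost
is the integral of a divergence over the sphere (`hasDerivAt_integral_boost`). Moving `y` to the
origin shows that the kernel is `F(d(x, y))` (`integral_planeWave_mul_conj`).

The regularity of the samples is obtained without continuity theorems for random fields. A plane
wave is `(x₀ - ⟪x', ϑ⟫) ^ μ` with `μ = -σ + iα`; its binomial series in `⟪x', ϑ⟫` expresses the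
field through the moments of the white noise against the monomials on the sphere. Almost surely these
moments grow at most linearly with the degree (`ae_exists_sampleMoment_bound`), so for almost every
sample the series (`waveSum`) converges in the whole future cone. Its sum is smooth, homogeneous of
degree `μ`, and solves the wave equation: termwise this is the recurrence of the binomial
coefficients together with the relation `∑ ϑ_j ^ 2 = 1` (`dAlembert_waveSum`). The restriction to
the hyperboloid of such a function is an eigenfunction (`isHypEigenfunction_of_homogeneous`).

The complex fields are treated as circularly symmetric ones (`IsCircularField`), given by the
covariances of their real and imaginary parts. For the complex wave the covariance is the real
function `F(d(x, y))`, hence the real and imaginary parts are uncorrelated and so independent; and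
complex white noise on plane waves has the same covariance (`isCircularField_complexWhiteNoise`).
-/

open Set Filter Topology
open scoped RealInnerProductSpace Pointwise

/-! ### Analysis on the unit sphere -/

/-- Differentiation under the integral sign over a compact space. -/
theorem hasDerivAt_integral_of_continuousOn {X F : Type*} [TopologicalSpace X] [CompactSpace X]
    [MeasurableSpace X] [OpensMeasurableSpace X] [SecondCountableTopology X]
    [NormedAddCommGroup F] [NormedSpace ℝ F] {μ : Measure X}
    [IsFiniteMeasure μ] {I : Set ℝ} (hI : IsOpen I) {G G' : ℝ → X → F} {t₀ : ℝ} (ht₀ : t₀ ∈ I)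
    (hG : ∀ t ∈ I, ∀ x, HasDerivAt (fun s => G s x) (G' t x) t)
    (hc : ∀ t ∈ I, Continuous (G t))
    (hc' : ContinuousOn (fun p : ℝ × X => G' p.1 p.2) (I ×ˢ univ)) :
    HasDerivAt (fun t => ∫ x, G t x ∂μ) (∫ x, G' t₀ x ∂μ) t₀ := by
  obtain ⟨ε, hε, hball⟩ := Metric.nhds_basis_closedBall.mem_iff.1 (hI.mem_nhds ht₀)
  have hK : IsCompact (Metric.closedBall t₀ ε ×ˢ (univ : Set X)) :=
    (isCompact_closedBall _ _).prod isCompact_univ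
  obtain ⟨C, hC⟩ := hK.exists_bound_of_continuousOn
    (hc'.mono (prod_mono hball subset_rfl))
  have hGi : ∀ t ∈ I, Integrable (G t) μ := fun t ht =>
    (hc t ht).integrable_of_hasCompactSupport (HasCompactSupport.of_compactSpace _)
  have hG'c : Continuous (G' t₀) := by
    have : ContinuousOn (fun x : X => G' t₀ x) univ :=
      hc'.comp (f := fun x : X => (t₀, x)) (by fun_prop) (fun x _ => ⟨ht₀, mem_univ _⟩)
    exact continuousOn_univ.1 this
  refine (hasDerivAt_integral_of_dominated_loc_of_deriv_le (bound := fun _ => C)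
    (F := G) (F' := G') (Metric.closedBall_mem_nhds t₀ hε) ?_ (hGi t₀ ht₀)
    (hG'c.integrable_of_hasCompactSupport
      (HasCompactSupport.of_compactSpace _)).aestronglyMeasurable ?_ (integrable_const _) ?_).2
  · filter_upwards [hI.mem_nhds ht₀] with t ht using (hGi t ht).aestronglyMeasurable
  · exact Eventually.of_forall fun x t ht => hC (t, x) ⟨ht, mem_univ _⟩
  · exact Eventually.of_forall fun x t ht => hG t (hball ht) x

/-- The action of a linear isometry on the unit sphere. -/
noncomputable def sphereMap {n : ℕ} (R : EuclideanSpace ℝ (Fin n) ≃ₗᵢ[ℝ] EuclideanSpace ℝ (Fin n))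
    (u : Metric.sphere (0 : EuclideanSpace ℝ (Fin n)) 1) :
    Metric.sphere (0 : EuclideanSpace ℝ (Fin n)) 1 :=
  ⟨R u, by simp⟩

theorem continuous_sphereMap {n : ℕ}
    (R : EuclideanSpace ℝ (Fin n) ≃ₗᵢ[ℝ] EuclideanSpace ℝ (Fin n)) :
    Continuous (sphereMap R) := by
  unfold sphereMap
  fun_prop

theorem measurePreserving_sphereMap_sphereMeasure {n : ℕ}
    (R : EuclideanSpace ℝ (Fin n) ≃ₗᵢ[ℝ] EuclideanSpace ℝ (Fin n)) :
    MeasurePreserving (sphereMap R) (sphereMeasure n) (sphereMeasure n) := by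
  refine ⟨(continuous_sphereMap R).measurable, ?_⟩
  ext s hs
  rw [Measure.map_apply (continuous_sphereMap R).measurable hs, sphereMeasure,
    Measure.toSphere_apply' _ ((continuous_sphereMap R).measurable hs),
    Measure.toSphere_apply' _ hs]
  have h : Ioo (0 : ℝ) 1 • ((↑) '' (sphereMap R ⁻¹' s) : Set (EuclideanSpace ℝ (Fin n)))
      = R ⁻¹' (Ioo (0 : ℝ) 1 • ((↑) '' s)) := by
    ext v
    simp only [Set.mem_smul, mem_image, mem_preimage]
    constructor
    · rintro ⟨r, hr, _, ⟨u, hu, rfl⟩, rfl⟩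
      exact ⟨r, hr, _, ⟨_, hu, rfl⟩, by simp [sphereMap]⟩
    · rintro ⟨r, hr, _, ⟨u, hu, rfl⟩, hv⟩
      refine ⟨r, hr, _, ⟨sphereMap R.symm u, ?_, rfl⟩, ?_⟩
      · have : sphereMap R (sphereMap R.symm u) = u := by
          apply Subtype.ext; simp [sphereMap]
        exact this.symm ▸ hu
      · apply R.injective
        rw [← hv]; simp [sphereMap]
  rw [h, (R.measurePreserving).measure_preimage_emb
    (R.toHomeomorph.measurableEmbedding)]

theorem measurePreserving_sphereMap {n : ℕ}
    (R : EuclideanSpace ℝ (Fin n) ≃ₗᵢ[ℝ] EuclideanSpace ℝ (Fin n)) :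
    MeasurePreserving (sphereMap R) (uniformSphere n) (uniformSphere n) :=
  ⟨(continuous_sphereMap R).measurable, by
    rw [uniformSphere, Measure.map_smul, (measurePreserving_sphereMap_sphereMeasure R).map_eq]⟩

theorem integral_sphereMap {n : ℕ} {F : Type*} [NormedAddCommGroup F] [NormedSpace ℝ F]
    (R : EuclideanSpace ℝ (Fin n) ≃ₗᵢ[ℝ] EuclideanSpace ℝ (Fin n))
    (f : Metric.sphere (0 : EuclideanSpace ℝ (Fin n)) 1 → F) :
    ∫ u, f (sphereMap R u) ∂uniformSphere n = ∫ u, f u ∂uniformSphere n := by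
  have hinj : Function.Injective (sphereMap R) := fun u v h => by
    apply Subtype.ext
    exact R.injective (congrArg Subtype.val h)
  exact (measurePreserving_sphereMap R).integral_comp
    ((continuous_sphereMap R).measurableEmbedding hinj) f

theorem isProbabilityMeasure_uniformSphere {n : ℕ} (hn : 1 ≤ n) :
    IsProbabilityMeasure (uniformSphere n) := by
  have : Nontrivial (EuclideanSpace ℝ (Fin n)) := by
    have : Nonempty (Fin n) := ⟨⟨0, hn⟩⟩
    infer_instance
  constructor
  rw [uniformSphere, Measure.smul_apply, smul_eq_mul, ENNReal.inv_mul_cancel]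
  · rw [Ne, Measure.measure_univ_eq_zero]
    exact Measure.toSphere_ne_zero _
  · unfold sphereMeasure; finiteness

theorem integrable_uniformSphere {n : ℕ} {F : Type*} [NormedAddCommGroup F]
    {f : Metric.sphere (0 : EuclideanSpace ℝ (Fin n)) 1 → F} (hf : Continuous f) :
    Integrable f (uniformSphere n) :=
  hf.integrable_of_hasCompactSupport (HasCompactSupport.of_compactSpace _)

/-- The exponential of a skew-symmetric operator, as a linear isometry. -/
theorem exists_linearIsometryEquiv_exp {n : ℕ}
    (J : EuclideanSpace ℝ (Fin n) →L[ℝ] EuclideanSpace ℝ (Fin n))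
    (hJ : ∀ x y, ⟪J x, y⟫ = -⟪x, J y⟫) (t : ℝ) :
    ∃ R : EuclideanSpace ℝ (Fin n) ≃ₗᵢ[ℝ] EuclideanSpace ℝ (Fin n),
      ∀ v, R v = NormedSpace.exp (t • J) v := by
  have hmem : t • J ∈ skewAdjoint (EuclideanSpace ℝ (Fin n) →L[ℝ] EuclideanSpace ℝ (Fin n)) := by
    rw [skewAdjoint.mem_iff, ContinuousLinearMap.star_eq_adjoint]
    symm
    rw [ContinuousLinearMap.eq_adjoint_iff]
    intro x y
    simp [inner_smul_left, inner_smul_right, hJ]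
  let _ : NormedAlgebra ℚ (EuclideanSpace ℝ (Fin n) →L[ℝ] EuclideanSpace ℝ (Fin n)) :=
    NormedAlgebra.restrictScalars ℚ ℝ _
  have hu := NormedSpace.exp_mem_unitary_of_mem_skewAdjoint hmem
  exact ⟨Unitary.linearIsometryEquiv ⟨_, hu⟩, fun v => rfl⟩

/-- The rotation fields integrate to zero over the sphere: this is the rotation invariance of the
surface measure, differentiated along the flow `exp (tJ)`. -/
theorem integral_fderiv_skew_eq_zero {n : ℕ} {F : Type*} [NormedAddCommGroup F] [NormedSpace ℝ F]
    {f : EuclideanSpace ℝ (Fin n) → F} {U : Set (EuclideanSpace ℝ (Fin n))} (hU : IsOpen U)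
    (hS : Metric.sphere 0 1 ⊆ U) (hf : ContDiffOn ℝ 1 f U)
    (J : EuclideanSpace ℝ (Fin n) →L[ℝ] EuclideanSpace ℝ (Fin n))
    (hJ : ∀ x y, ⟪J x, y⟫ = -⟪x, J y⟫) :
    ∫ u, fderiv ℝ f u.1 (J u.1) ∂uniformSphere n = 0 := by
  let _ : NormedAlgebra ℚ (EuclideanSpace ℝ (Fin n) →L[ℝ] EuclideanSpace ℝ (Fin n)) :=
    NormedAlgebra.restrictScalars ℚ ℝ _
  choose R hR using exists_linearIsometryEquiv_exp J hJ
  have hRS : ∀ t (u : Metric.sphere (0 : EuclideanSpace ℝ (Fin n)) 1), R t u.1 ∈ U := fun t u =>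
    hS (sphereMap (R t) u).2
  have hRc : Continuous fun p : ℝ × Metric.sphere (0 : EuclideanSpace ℝ (Fin n)) 1 =>
      R p.1 p.2.1 := by
    simp only [hR]
    have h1 : Continuous fun t : ℝ => NormedSpace.exp (t • J) :=
      (NormedSpace.exp_continuous).comp (by fun_prop)
    exact (h1.comp continuous_fst).clm_apply (by fun_prop)
  have hder : ∀ t (u : Metric.sphere (0 : EuclideanSpace ℝ (Fin n)) 1),
      HasDerivAt (fun s => f (R s u.1)) (fderiv ℝ f (R t u.1) (J (R t u.1))) t := by
    intro t u
    have h1 : HasDerivAt (fun s => R s u.1) (J (R t u.1)) t := by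
      simp only [hR]
      have h2 := (hasDerivAt_exp_smul_const' (𝕂 := ℝ) J t)
      simpa using h2.clm_apply (hasDerivAt_const t u.1)
    exact ((hf.contDiffAt (hU.mem_nhds (hRS t u))).differentiableAt
      (by norm_num)).hasFDerivAt.comp_hasDerivAt t h1
  have hd := hasDerivAt_integral_of_continuousOn (μ := uniformSphere n) isOpen_univ (mem_univ 0)
    (G := fun t u => f (R t u.1)) (fun t _ u => hder t u)
    (fun t _ => hf.continuousOn.comp_continuous (by fun_prop) (hRS t))
    (by
      have hf' : ContinuousOn (fun v => fderiv ℝ f v) U :=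
        hf.continuousOn_fderiv_of_isOpen hU le_rfl
      exact ((hf'.comp_continuous hRc fun p => hRS p.1 p.2).clm_apply
        (J.continuous.comp hRc)).continuousOn)
  have hconst : (fun t => ∫ u : Metric.sphere (0 : EuclideanSpace ℝ (Fin n)) 1,
      f (R t u.1) ∂uniformSphere n) = fun _ => ∫ u : Metric.sphere (0 : EuclideanSpace ℝ (Fin n)) 1,
      f u.1 ∂uniformSphere n := by
    ext t
    exact integral_sphereMap (R t) (fun u => f u.1)
  rw [hconst] at hd
  have h0 := hd.unique (hasDerivAt_const _ _)
  have hR0 : ∀ v, R 0 v = v := fun v => by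
    rw [hR]
    have h0 : (0 : ℝ) • J = 0 := zero_smul ℝ J
    refine (congrArg (fun K : EuclideanSpace ℝ (Fin n) →L[ℝ] EuclideanSpace ℝ (Fin n) =>
      (NormedSpace.exp K : EuclideanSpace ℝ (Fin n) →L[ℝ] EuclideanSpace ℝ (Fin n)) v) h0).trans ?_
    rw [NormedSpace.exp_zero]; rfl
  simpa [hR0] using h0

/-- The divergence theorem on the sphere for the conformal fields `a - ⟪a, ϑ⟫ ϑ`, the gradients of
the linear functions. These fields are `∑ j, ϑ_j J_j ϑ` with rotation fields
`J_j ϑ = ϑ_j a - ⟪a, ϑ⟫ e_j`. -/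
theorem integral_fderiv_tangent {n : ℕ} {F : Type*} [NormedAddCommGroup F] [NormedSpace ℝ F]
    [CompleteSpace F]
    {h : EuclideanSpace ℝ (Fin n) → F} {U : Set (EuclideanSpace ℝ (Fin n))} (hU : IsOpen U)
    (hS : Metric.sphere 0 1 ⊆ U) (hh : ContDiffOn ℝ 1 h U) (a : EuclideanSpace ℝ (Fin n)) :
    ∫ u, fderiv ℝ h u.1 (a - ⟪a, u.1⟫ • u.1) ∂uniformSphere n
      = ((n : ℝ) - 1) • ∫ u, ⟪a, u.1⟫ • h u.1 ∂uniformSphere n := by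
  let e : Fin n → EuclideanSpace ℝ (Fin n) := fun j => EuclideanSpace.single j 1
  let J : Fin n → EuclideanSpace ℝ (Fin n) →L[ℝ] EuclideanSpace ℝ (Fin n) := fun j =>
    (innerSL ℝ (e j)).smulRight a - (innerSL ℝ a).smulRight (e j)
  have hJ : ∀ j v, J j v = ⟪e j, v⟫ • a - ⟪a, v⟫ • e j := fun j v => by simp [J]
  have hskew : ∀ j x y, ⟪J j x, y⟫ = -⟪x, J j y⟫ := by
    intro j x y
    rw [hJ, hJ, inner_sub_left, inner_sub_right]
    simp only [real_inner_smul_left, real_inner_smul_right]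
    rw [real_inner_comm x a, real_inner_comm x (e j)]
    ring
  have hej : ∀ j (v : EuclideanSpace ℝ (Fin n)), ⟪e j, v⟫ = v j := fun j v => by
    simp [e, EuclideanSpace.inner_single_left]
  have hsum : ∀ v : EuclideanSpace ℝ (Fin n), ∑ j, v j • e j = v := fun v => by
    have := (EuclideanSpace.basisFun (Fin n) ℝ).sum_repr v
    simpa [e] using this
  have hsq : ∀ v : EuclideanSpace ℝ (Fin n), ‖v‖ = 1 → ∑ j, v j * v j = 1 := fun v hv => by
    have := EuclideanSpace.real_norm_sq_eq v
    rw [hv] at this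
    simp only [one_pow] at this
    rw [this]
    exact Finset.sum_congr rfl fun j _ => by ring
  have hdiff : ∀ v ∈ U, DifferentiableAt ℝ h v := fun v hv =>
    (hh.contDiffAt (hU.mem_nhds hv)).differentiableAt (by norm_num)
  -- invariance under `exp (t J_j)` is applied to the function `⟪e_j, v⟫ h(v)`; summed over `j`, the
  -- derivatives of the linear factors add up to `-(n - 1) ⟪a, v⟫` and those of `h` to the
  -- derivative along `∑ v_j J_j v = a - ⟪a, v⟫ v`
  have key : ∀ j, ∫ u : Metric.sphere (0 : EuclideanSpace ℝ (Fin n)) 1,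
      (⟪e j, J j u.1⟫ • h u.1 + ⟪e j, u.1⟫ • fderiv ℝ h u.1 (J j u.1)) ∂uniformSphere n = 0 := by
    intro j
    have h0 := integral_fderiv_skew_eq_zero hU hS (f := fun v => ⟪e j, v⟫ • h v)
      (ContDiffOn.smul (innerSL ℝ (e j)).contDiff.contDiffOn hh) (J j) (hskew j)
    rw [← h0]
    refine integral_congr_ae (Eventually.of_forall fun u => ?_)
    have hd : HasFDerivAt (fun v => ⟪e j, v⟫ • h v)
        (⟪e j, u.1⟫ • fderiv ℝ h u.1 + (innerSL ℝ (e j)).smulRight (h u.1)) u.1 :=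
      ((innerSL ℝ (e j)).hasFDerivAt).smul (hdiff u.1 (hS u.2)).hasFDerivAt
    simp only [hd.fderiv]
    simp [add_comm]
  have hf' : Continuous fun u : Metric.sphere (0 : EuclideanSpace ℝ (Fin n)) 1 => fderiv ℝ h u.1 :=
    (hh.continuousOn_fderiv_of_isOpen hU le_rfl).comp_continuous continuous_subtype_val
      fun u => hS u.2
  have hhc : Continuous fun u : Metric.sphere (0 : EuclideanSpace ℝ (Fin n)) 1 => h u.1 :=
    hh.continuousOn.comp_continuous continuous_subtype_val fun u => hS u.2
  have hin : ∀ (b : EuclideanSpace ℝ (Fin n))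
      (L : EuclideanSpace ℝ (Fin n) →L[ℝ] EuclideanSpace ℝ (Fin n)),
      Continuous fun u : Metric.sphere (0 : EuclideanSpace ℝ (Fin n)) 1 => ⟪b, L u.1⟫ :=
    fun b L => continuous_const.inner (by fun_prop)
  have hina := hin a (ContinuousLinearMap.id ℝ _)
  simp only [ContinuousLinearMap.id_apply] at hina
  have hs0 : ∫ u : Metric.sphere (0 : EuclideanSpace ℝ (Fin n)) 1,
      ∑ j, (⟪e j, J j u.1⟫ • h u.1 + ⟪e j, u.1⟫ • fderiv ℝ h u.1 (J j u.1))
        ∂uniformSphere n = 0 := by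
    rw [integral_finsetSum]
    · exact Finset.sum_eq_zero fun j _ => key j
    · intro j _
      exact integrable_uniformSphere (((hin (e j) (J j)).smul hhc).add
        ((hin (e j) (ContinuousLinearMap.id ℝ _)).smul (hf'.clm_apply (by fun_prop))))
  have hpt : ∀ u : Metric.sphere (0 : EuclideanSpace ℝ (Fin n)) 1,
      ∑ j, (⟪e j, J j u.1⟫ • h u.1 + ⟪e j, u.1⟫ • fderiv ℝ h u.1 (J j u.1))
      = fderiv ℝ h u.1 (a - ⟪a, u.1⟫ • u.1) - ((n : ℝ) - 1) • (⟪a, u.1⟫ • h u.1) := by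
    intro u
    have hu : ‖u.1‖ = 1 := by simp
    rw [Finset.sum_add_distrib, ← Finset.sum_smul]
    have h1 : ∑ j, ⟪e j, J j u.1⟫ = -(((n : ℝ) - 1) * ⟪a, u.1⟫) := by
      have h3 : ∀ j, ⟪e j, J j u.1⟫ = u.1 j * a j - ⟪a, u.1⟫ := fun j => by
        rw [hJ, inner_sub_right, real_inner_smul_right, real_inner_smul_right, hej, hej]
        simp [e]
      simp only [h3, Finset.sum_sub_distrib, Finset.sum_const, Finset.card_univ, Fintype.card_fin,
        nsmul_eq_mul]
      have : ⟪a, u.1⟫ = ∑ j, u.1 j * a j := by simp [PiLp.inner_apply]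
      rw [← this]; ring
    have h2 : ∑ j, ⟪e j, u.1⟫ • fderiv ℝ h u.1 (J j u.1)
        = fderiv ℝ h u.1 (a - ⟪a, u.1⟫ • u.1) := by
      have : a - ⟪a, u.1⟫ • u.1 = ∑ j, u.1 j • J j u.1 := by
        simp only [hJ, hej, smul_sub, Finset.sum_sub_distrib, smul_smul]
        rw [← Finset.sum_smul, hsq u.1 hu, one_smul]
        congr 1
        conv_lhs => rw [← hsum u.1]
        rw [Finset.smul_sum]
        refine Finset.sum_congr rfl fun j _ => ?_
        rw [hsum, smul_smul, mul_comm]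
      rw [this, map_sum]
      simp only [map_smul, hej]
    rw [h1, h2, neg_smul, mul_smul]
    abel
  simp only [hpt] at hs0
  rw [integral_sub, integral_smul, sub_eq_zero] at hs0
  · exact hs0
  · exact integrable_uniformSphere (hf'.clm_apply
      (continuous_const.sub (hina.smul continuous_subtype_val)))
  · exact integrable_uniformSphere (continuous_const.smul (hina.smul hhc))

/-! ### Zonal integrals -/

theorem sphereArea_eq {m : ℕ} (hm : 1 ≤ m) :
    sphereArea m = m * (√Real.pi ^ m / Real.Gamma (m / 2 + 1)) := by
  have : Nonempty (Fin m) := ⟨⟨0, hm⟩⟩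
  rw [sphereArea, sphereMeasure, Measure.toSphere_real_apply_univ]
  have h : 0 ≤ √Real.pi ^ m / Real.Gamma (m / 2 + 1) :=
    div_nonneg (by positivity) (Real.Gamma_pos_of_pos (by positivity)).le
  simp [measureReal_def, EuclideanSpace.volume_ball, h]

theorem sphereArea_add_two {m : ℕ} (hm : 1 ≤ m) :
    sphereArea (m + 2) = 2 * Real.pi / m * sphereArea m := by
  rw [sphereArea_eq hm, sphereArea_eq (by omega)]
  have hm' : (0 : ℝ) < m := by exact_mod_cast hm
  have h1 : ((m + 2 : ℕ) : ℝ) / 2 + 1 = (m / 2 + 1) + 1 := by push_cast; ring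
  have h2 : (0 : ℝ) < Real.Gamma (m / 2 + 1) := Real.Gamma_pos_of_pos (by positivity)
  rw [h1, Real.Gamma_add_one (by positivity), pow_add, Real.sq_sqrt Real.pi_pos.le]
  push_cast
  field_simp

theorem sphereArea_one : sphereArea 1 = 2 := by
  rw [sphereArea_eq le_rfl]
  have h : Real.Gamma (((1 : ℕ) : ℝ) / 2 + 1) = √Real.pi / 2 := by
    rw [Real.Gamma_add_one (by norm_num)]
    push_cast
    rw [Real.Gamma_one_half_eq]; ring
  rw [h]
  have : 0 < √Real.pi := Real.sqrt_pos.2 Real.pi_pos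
  push_cast
  field_simp

theorem sphereArea_two : sphereArea 2 = 2 * Real.pi := by
  rw [sphereArea_eq (by norm_num)]
  have h : ((2 : ℕ) : ℝ) / 2 + 1 = (1 : ℕ) + 1 := by norm_num
  rw [h, Real.Gamma_nat_eq_factorial, Real.sq_sqrt Real.pi_pos.le]
  simp

/-- The density `ω_{k} / ω_{k+1} sin^k θ` of the polar angle on `S^{k+1}` has mass `1`; note that
`sphereArea m` is `ω_{m-1}`. -/
theorem sphereArea_ratio_mul_integral (k : ℕ) :
    sphereArea (k + 1) / sphereArea (k + 2) * ∫ θ in (0 : ℝ)..Real.pi, Real.sin θ ^ k = 1 := by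
  induction k using Nat.twoStepInduction with
  | zero => simp [sphereArea_one, sphereArea_two]; field_simp
  | one =>
    have h3 : sphereArea 3 = 4 * Real.pi := by
      rw [sphereArea_add_two (m := 1) le_rfl, sphereArea_one]; push_cast; ring
    norm_num [h3, sphereArea_two]; field_simp; norm_num
  | more k ih _ =>
    rw [show k + 2 + 1 = (k + 1) + 2 from rfl, sphereArea_add_two (by omega),
      sphereArea_add_two (by omega : 1 ≤ k + 2), integral_sin_pow]
    have h1 : sphereArea (k + 2) ≠ 0 := by
      intro h; rw [h] at ih; simp at ih
    have h2 := Real.pi_pos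
    refine Eq.trans ?_ ih
    generalize (∫ θ in (0 : ℝ)..Real.pi, Real.sin θ ^ k) = x
    simp only [Real.sin_zero, Real.sin_pi, ne_eq, Nat.add_eq_zero_iff, one_ne_zero, and_false,
      not_false_eq_true, zero_pow, zero_mul, sub_self, zero_div, zero_add]
    push_cast
    field_simp

/-- The integral of a zonal power over the sphere, by the divergence theorem. -/
theorem integral_inner_pow_succ {n : ℕ} {e : EuclideanSpace ℝ (Fin n)} (he : ‖e‖ = 1) (k : ℕ) :
    ((n : ℝ) - 1 + k) * ∫ u, ⟪e, u.1⟫ ^ (k + 1) ∂uniformSphere n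
      = k * ∫ u, ⟪e, u.1⟫ ^ (k - 1) ∂uniformSphere n := by
  have hh : ContDiff ℝ 1 fun v : EuclideanSpace ℝ (Fin n) => ⟪e, v⟫ ^ k :=
    (innerSL ℝ e).contDiff.pow k
  have hV := integral_fderiv_tangent isOpen_univ (subset_univ _) hh.contDiffOn e
  have hc : Continuous fun u : Metric.sphere (0 : EuclideanSpace ℝ (Fin n)) 1 => ⟪e, u.1⟫ :=
    (innerSL ℝ e).continuous.comp continuous_subtype_val
  have h1 : ∀ u : Metric.sphere (0 : EuclideanSpace ℝ (Fin n)) 1,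
      fderiv ℝ (fun v : EuclideanSpace ℝ (Fin n) => ⟪e, v⟫ ^ k) u.1 (e - ⟪e, u.1⟫ • u.1)
        = k * ⟪e, u.1⟫ ^ (k - 1) - k * ⟪e, u.1⟫ ^ (k + 1) := by
    intro u
    have hd : HasFDerivAt (fun v : EuclideanSpace ℝ (Fin n) => ⟪e, v⟫ ^ k)
        ((k * ⟪e, u.1⟫ ^ (k - 1)) • innerSL ℝ e) u.1 := by
      simpa using ((innerSL ℝ e).hasFDerivAt (x := u.1)).pow k
    rw [hd.fderiv]
    simp only [smul_apply, innerSL_apply_apply, inner_sub_right,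
      real_inner_smul_right, real_inner_self_eq_norm_sq, he, smul_eq_mul]
    cases k with
    | zero => simp
    | succ k => simp only [Nat.add_sub_cancel]; ring
  simp only [h1] at hV
  rw [integral_sub, integral_const_mul, integral_const_mul] at hV
  · have h2 : ∀ u : Metric.sphere (0 : EuclideanSpace ℝ (Fin n)) 1,
        ⟪e, u.1⟫ • ⟪e, u.1⟫ ^ k = ⟪e, u.1⟫ ^ (k + 1) := fun u => by
      rw [smul_eq_mul, pow_succ, mul_comm]
    simp only [h2, smul_eq_mul] at hV
    linarith
  · exact integrable_uniformSphere (by fun_prop)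
  · exact integrable_uniformSphere (by fun_prop)

/-- The recursion of `integral_inner_pow_succ` for the moments of the polar angle. -/
theorem integral_cos_pow_succ_mul_sin_pow (m k : ℕ) :
    ((m : ℝ) + 1 + k) * ∫ θ in (0 : ℝ)..Real.pi, Real.cos θ ^ (k + 1) * Real.sin θ ^ m
      = k * ∫ θ in (0 : ℝ)..Real.pi, Real.cos θ ^ (k - 1) * Real.sin θ ^ m := by
  have hd : ∀ θ ∈ uIcc (0 : ℝ) Real.pi,
      HasDerivAt (fun θ => Real.cos θ ^ k * Real.sin θ ^ (m + 1))
        (((m : ℝ) + 1 + k) * (Real.cos θ ^ (k + 1) * Real.sin θ ^ m)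
          - k * (Real.cos θ ^ (k - 1) * Real.sin θ ^ m)) θ := by
    intro θ _
    have h := ((Real.hasDerivAt_cos θ).pow k).mul ((Real.hasDerivAt_sin θ).pow (m + 1))
    refine h.congr_deriv ?_
    have hs : Real.sin θ ^ 2 = 1 - Real.cos θ ^ 2 := by rw [← Real.sin_sq_add_cos_sq θ]; ring
    simp only [Pi.pow_apply, Nat.add_sub_cancel]
    cases k with
    | zero => push_cast; ring
    | succ k =>
      simp only [Nat.add_sub_cancel]
      have : Real.sin θ ^ (m + 1) = Real.sin θ ^ m * Real.sin θ := pow_succ _ _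
      rw [this]
      have e1 : ((k + 1 : ℕ) : ℝ) * Real.cos θ ^ k * -Real.sin θ * (Real.sin θ ^ m * Real.sin θ)
        = -(((k + 1 : ℕ) : ℝ) * Real.cos θ ^ k * Real.sin θ ^ m * Real.sin θ ^ 2) := by ring
      rw [e1, hs]
      push_cast
      ring
  have hi := intervalIntegral.integral_eq_sub_of_hasDerivAt hd
    (Continuous.intervalIntegrable (by fun_prop) _ _)
  rw [intervalIntegral.integral_sub (Continuous.intervalIntegrable (by fun_prop) _ _)
    (Continuous.intervalIntegrable (by fun_prop) _ _), intervalIntegral.integral_const_mul,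
    intervalIntegral.integral_const_mul] at hi
  simp only [Real.sin_pi, Real.sin_zero, ne_eq, Nat.add_eq_zero_iff, one_ne_zero, and_false,
    not_false_eq_true, zero_pow, mul_zero, sub_self] at hi
  linarith

theorem integral_inner_pow {n : ℕ} (hn : 2 ≤ n) {e : EuclideanSpace ℝ (Fin n)} (he : ‖e‖ = 1)
    (k : ℕ) :
    ∫ u, ⟪e, u.1⟫ ^ k ∂uniformSphere n = sphereArea (n - 1) / sphereArea n *
      ∫ θ in (0 : ℝ)..Real.pi, Real.cos θ ^ k * Real.sin θ ^ (n - 2) := by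
  have := isProbabilityMeasure_uniformSphere (n := n) (by omega)
  obtain ⟨m, rfl⟩ : ∃ m, n = m + 2 := ⟨n - 2, by omega⟩
  simp only [Nat.add_sub_cancel, show m + 2 - 1 = m + 1 by omega]
  -- the moments of both measures satisfy the same two-step recursion; for `k = 0` it gives the
  -- first moment, with the junk index `0 - 1 = 0` multiplied by `0`
  have step : ∀ k : ℕ, (∫ u, ⟪e, u.1⟫ ^ (k - 1) ∂uniformSphere (m + 2)
        = sphereArea (m + 1) / sphereArea (m + 2) *
          ∫ θ in (0 : ℝ)..Real.pi, Real.cos θ ^ (k - 1) * Real.sin θ ^ m) →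
      ∫ u, ⟪e, u.1⟫ ^ (k + 1) ∂uniformSphere (m + 2)
        = sphereArea (m + 1) / sphereArea (m + 2) *
          ∫ θ in (0 : ℝ)..Real.pi, Real.cos θ ^ (k + 1) * Real.sin θ ^ m := by
    intro k ih
    have h1 := integral_inner_pow_succ he k
    have h2 := integral_cos_pow_succ_mul_sin_pow m k
    have hpos : ((m : ℝ) + 1 + k) ≠ 0 := by positivity
    rw [ih] at h1
    apply mul_left_cancel₀ hpos
    have h3 : ((m + 2 : ℕ) : ℝ) - 1 + k = m + 1 + k := by push_cast; ring
    rw [h3] at h1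
    rw [h1, mul_left_comm, mul_left_comm ((m : ℝ) + 1 + k), h2]
  have h0 : ∫ u, ⟪e, u.1⟫ ^ 0 ∂uniformSphere (m + 2) = sphereArea (m + 1) / sphereArea (m + 2) *
          ∫ θ in (0 : ℝ)..Real.pi, Real.cos θ ^ 0 * Real.sin θ ^ m := by
    simp only [pow_zero, one_mul, sphereArea_ratio_mul_integral]; simp
  induction k using Nat.twoStepInduction with
  | zero => exact h0
  | one => exact step 0 h0
  | more k ih _ => exact step (k + 1) ih

/-- The real case of `integral_comp_inner`: the moments agree, hence so do the integrals of all
continuous functions by the Weierstrass approximation theorem. -/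
theorem integral_comp_inner_real {n : ℕ} (hn : 2 ≤ n) {e : EuclideanSpace ℝ (Fin n)}
    (he : ‖e‖ = 1) {g : ℝ → ℝ} (hg : ContinuousOn g (Icc (-1) 1)) :
    ∫ u, g ⟪e, u.1⟫ ∂uniformSphere n = sphereArea (n - 1) / sphereArea n *
      ∫ θ in (0 : ℝ)..Real.pi, g (Real.cos θ) * Real.sin θ ^ (n - 2) := by
  have := isProbabilityMeasure_uniformSphere (n := n) (by omega)
  have hc : Continuous fun u : Metric.sphere (0 : EuclideanSpace ℝ (Fin n)) 1 => ⟪e, u.1⟫ :=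
    (innerSL ℝ e).continuous.comp continuous_subtype_val
  have hmem : ∀ u : Metric.sphere (0 : EuclideanSpace ℝ (Fin n)) 1, ⟪e, u.1⟫ ∈ Icc (-1 : ℝ) 1 := by
    intro u
    have := abs_real_inner_le_norm e u.1
    rw [he] at this
    simp only [norm_eq_of_mem_sphere, mul_one] at this
    exact abs_le.1 this
  have hcos : ∀ θ, Real.cos θ ∈ Icc (-1 : ℝ) 1 := fun θ =>
    ⟨Real.neg_one_le_cos θ, Real.cos_le_one θ⟩
  have hgs : Continuous fun u : Metric.sphere (0 : EuclideanSpace ℝ (Fin n)) 1 => g ⟪e, u.1⟫ :=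
    hg.comp_continuous hc hmem
  have hgc : Continuous fun θ => g (Real.cos θ) := hg.comp_continuous Real.continuous_cos hcos
  set c := sphereArea (n - 1) / sphereArea n with hcdef
  have hc0 : 0 ≤ c := div_nonneg measureReal_nonneg measureReal_nonneg
  have hc1 : c * ∫ θ in (0 : ℝ)..Real.pi, Real.sin θ ^ (n - 2) = 1 := by
    have := sphereArea_ratio_mul_integral (n - 2)
    rwa [show n - 2 + 1 = n - 1 by omega, show n - 2 + 2 = n by omega] at this
  have hpoly : ∀ p : Polynomial ℝ, ∫ u, p.eval ⟪e, u.1⟫ ∂uniformSphere n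
      = c * ∫ θ in (0 : ℝ)..Real.pi, p.eval (Real.cos θ) * Real.sin θ ^ (n - 2) := by
    intro p
    simp only [Polynomial.eval_eq_sum_range, Finset.sum_mul]
    rw [integral_finsetSum, intervalIntegral.integral_finsetSum, Finset.mul_sum]
    · refine Finset.sum_congr rfl fun i _ => ?_
      simp only [mul_assoc]
      rw [integral_const_mul, integral_inner_pow hn he, intervalIntegral.integral_const_mul]
      ring
    · intro i _; exact Continuous.intervalIntegrable (by fun_prop) _ _
    · intro i _; exact integrable_uniformSphere (by fun_prop)
  have hgcs : Continuous fun θ => g (Real.cos θ) * Real.sin θ ^ (n - 2) :=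
    hgc.mul (Real.continuous_sin.pow _)
  refine eq_of_forall_dist_le fun ε hε => ?_
  obtain ⟨p, hp⟩ := exists_polynomial_near_of_continuousOn (-1) 1 g hg (ε / 2) (by positivity)
  have hA : |∫ u, g ⟪e, u.1⟫ ∂uniformSphere n - ∫ u, p.eval ⟪e, u.1⟫ ∂uniformSphere n| ≤ ε / 2 := by
    rw [← integral_sub (integrable_uniformSphere hgs)
      (integrable_uniformSphere (by fun_prop)), ← Real.norm_eq_abs]
    refine (norm_integral_le_of_norm_le_const (C := ε / 2)
      (Eventually.of_forall fun u => ?_)).trans (by simp)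
    rw [Real.norm_eq_abs, abs_sub_comm]
    exact (hp _ (hmem u)).le
  have hB : |(∫ θ in (0 : ℝ)..Real.pi, g (Real.cos θ) * Real.sin θ ^ (n - 2)) -
      ∫ θ in (0 : ℝ)..Real.pi, p.eval (Real.cos θ) * Real.sin θ ^ (n - 2)|
      ≤ ε / 2 * ∫ θ in (0 : ℝ)..Real.pi, Real.sin θ ^ (n - 2) := by
    rw [← intervalIntegral.integral_sub (hgcs.intervalIntegrable _ _)
      (Continuous.intervalIntegrable (by fun_prop) _ _), ← intervalIntegral.integral_const_mul,
      ← Real.norm_eq_abs]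
    refine intervalIntegral.norm_integral_le_of_norm_le Real.pi_pos.le
      (Eventually.of_forall fun θ hθ => ?_) (Continuous.intervalIntegrable (by fun_prop) _ _)
    have hs : 0 ≤ Real.sin θ := Real.sin_nonneg_of_mem_Icc ⟨hθ.1.le, hθ.2⟩
    rw [← sub_mul, norm_mul, Real.norm_eq_abs, Real.norm_eq_abs, abs_sub_comm,
      abs_of_nonneg (pow_nonneg hs _)]
    exact mul_le_mul_of_nonneg_right (hp _ (hcos θ)).le (pow_nonneg hs _)
  rw [Real.dist_eq]
  have h3 : c * |(∫ θ in (0 : ℝ)..Real.pi, g (Real.cos θ) * Real.sin θ ^ (n - 2)) -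
      ∫ θ in (0 : ℝ)..Real.pi, p.eval (Real.cos θ) * Real.sin θ ^ (n - 2)| ≤ ε / 2 := by
    refine (mul_le_mul_of_nonneg_left hB hc0).trans ?_
    rw [mul_left_comm, hc1, mul_one]
  have habs : ∀ y : ℝ, c * |y| = |c * y| := fun y => by rw [abs_mul, abs_of_nonneg hc0]
  rw [habs, mul_sub, ← hpoly p] at h3
  have h4 := abs_sub_le (∫ u, g ⟪e, u.1⟫ ∂uniformSphere n) (∫ u, p.eval ⟪e, u.1⟫ ∂uniformSphere n)
    (c * ∫ θ in (0 : ℝ)..Real.pi, g (Real.cos θ) * Real.sin θ ^ (n - 2))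
  rw [abs_sub_comm (∫ u, p.eval ⟪e, u.1⟫ ∂uniformSphere n)] at h4
  linarith

/-- Integration of a zonal function: the image of the uniform measure under `ϑ ↦ ⟪e, ϑ⟫` is, in the
polar angle, `ω_{n-2} / ω_{n-1} sin^{n-2} θ dθ`. Both measures have the same moments. -/
theorem integral_comp_inner {n : ℕ} (hn : 2 ≤ n) {e : EuclideanSpace ℝ (Fin n)}
    (he : ‖e‖ = 1) {g : ℝ → ℂ} (hg : ContinuousOn g (Icc (-1) 1)) :
    ∫ u, g ⟪e, u.1⟫ ∂uniformSphere n = ((sphereArea (n - 1) / sphereArea n : ℝ) : ℂ) *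
      ∫ θ in (0 : ℝ)..Real.pi, g (Real.cos θ) * ((Real.sin θ ^ (n - 2) : ℝ) : ℂ) := by
  have hmem : ∀ u : Metric.sphere (0 : EuclideanSpace ℝ (Fin n)) 1, ⟪e, u.1⟫ ∈ Icc (-1 : ℝ) 1 := by
    intro u
    have := abs_real_inner_le_norm e u.1
    rw [he] at this
    simp only [norm_eq_of_mem_sphere, mul_one] at this
    exact abs_le.1 this
  have hcos : ∀ θ, Real.cos θ ∈ Icc (-1 : ℝ) 1 := fun θ =>
    ⟨Real.neg_one_le_cos θ, Real.cos_le_one θ⟩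
  have hgs : Continuous fun u : Metric.sphere (0 : EuclideanSpace ℝ (Fin n)) 1 => g ⟪e, u.1⟫ :=
    hg.comp_continuous ((innerSL ℝ e).continuous.comp continuous_subtype_val) hmem
  have hgc : Continuous fun θ => g (Real.cos θ) := hg.comp_continuous Real.continuous_cos hcos
  have hint : IntervalIntegrable
      (fun θ => g (Real.cos θ) * ((Real.sin θ ^ (n - 2) : ℝ) : ℂ)) volume 0 Real.pi :=
    Continuous.intervalIntegrable
      (hgc.mul (Complex.continuous_ofReal.comp (Real.continuous_sin.pow _))) _ _
  apply Complex.ext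
  · rw [Complex.re_ofReal_mul]
    have h1 := Complex.reCLM.integral_comp_comm (integrable_uniformSphere hgs)
    have h2 := Complex.reCLM.intervalIntegral_comp_comm hint
    simp only [Complex.reCLM_apply, Complex.re_mul_ofReal] at h1 h2
    rw [← h1, ← h2]
    exact integral_comp_inner_real hn he (Complex.continuous_re.comp_continuousOn hg)
  · rw [Complex.im_ofReal_mul]
    have h1 := Complex.imCLM.integral_comp_comm (integrable_uniformSphere hgs)
    have h2 := Complex.imCLM.intervalIntegral_comp_comm hint
    simp only [Complex.imCLM_apply, Complex.im_mul_ofReal] at h1 h2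
    rw [← h1, ← h2]
    exact integral_comp_inner_real hn he (Complex.continuous_im.comp_continuousOn hg)

/-- The spherical function as a spherical mean of a plane wave. -/
theorem sphericalFunction_eq_integral {n : ℕ} (hn : 2 ≤ n) {e : EuclideanSpace ℝ (Fin n)}
    (he : ‖e‖ = 1) (α r : ℝ) :
    sphericalFunction n α r = ∫ u, ((Real.cosh r - Real.sinh r * ⟪e, u.1⟫ : ℝ) : ℂ) ^
          (-(hypSigma n : ℂ) + Complex.I * (α : ℂ)) ∂uniformSphere n := by
  rw [integral_comp_inner hn he (g := fun τ => ((Real.cosh r - Real.sinh r * τ : ℝ) : ℂ) ^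
          (-(hypSigma n : ℂ) + Complex.I * (α : ℂ)))]
  · rfl
  · refine ContinuousOn.cpow (by fun_prop) continuousOn_const fun τ hτ => Or.inl ?_
    rw [Complex.ofReal_re]
    have h1 : |Real.sinh r * τ| ≤ |Real.sinh r| := by
      rw [abs_mul]
      exact mul_le_of_le_one_right (abs_nonneg _) (abs_le.2 hτ)
    have h2 : |Real.sinh r| < Real.cosh r :=
      abs_lt.2 ⟨by nlinarith [Real.exp_pos r, Real.cosh_add_sinh r], Real.sinh_lt_cosh r⟩
    linarith [le_abs_self (Real.sinh r * τ)]

/-! ### Spherical means of eigenfunctions -/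

theorem isOpen_futureCone (n : ℕ) : IsOpen (futureCone n) := by
  unfold futureCone minkowski
  have h : Continuous fun x : MinkowskiSpace n => x.1 * x.1 - ⟪x.2, x.2⟫ :=
    (continuous_fst.mul continuous_fst).sub (continuous_snd.inner continuous_snd)
  exact (isOpen_lt continuous_const continuous_fst).inter (isOpen_lt continuous_const h)

theorem HyperbolicSpace.mem_futureCone {n : ℕ} (x : HyperbolicSpace n) : x.1 ∈ futureCone n :=
  ⟨x.2.1, by rw [x.2.2]; exact one_pos⟩

theorem minkowski_smul_smul {n : ℕ} (s t : ℝ) (x y : MinkowskiSpace n) :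
    minkowski (s • x) (t • y) = s * t * minkowski x y := by
  simp only [minkowski, Prod.smul_fst, Prod.smul_snd, smul_eq_mul, real_inner_smul_left,
    real_inner_smul_right]
  ring

theorem smul_mem_futureCone {n : ℕ} {x : MinkowskiSpace n} (hx : x ∈ futureCone n) {t : ℝ}
    (ht : 0 < t) : t • x ∈ futureCone n := by
  refine ⟨mul_pos ht hx.1, ?_⟩
  rw [minkowski_smul_smul]
  exact mul_pos (mul_pos ht ht) hx.2

theorem radialExt_coe {n : ℕ} {F : Type*} [Zero F] (f : HyperbolicSpace n → F)
    (x : HyperbolicSpace n) : radialExt f x.1 = f x := by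
  rw [radialExt, dif_pos x.mem_futureCone]
  congr 1
  apply Subtype.ext
  simp [radialProj, x.2.2]

theorem radialExt_smul {n : ℕ} {F : Type*} [Zero F] (f : HyperbolicSpace n → F)
    {x : MinkowskiSpace n} (hx : x ∈ futureCone n) {t : ℝ} (ht : 0 < t) :
    radialExt f (t • x) = radialExt f x := by
  rw [radialExt, radialExt, dif_pos hx, dif_pos (smul_mem_futureCone hx ht)]
  congr 1
  apply Subtype.ext
  simp only [radialProj]
  rw [minkowski_smul_smul, Real.sqrt_mul (mul_self_nonneg t), Real.sqrt_mul_self ht.le, smul_smul,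
    mul_inv, mul_assoc, mul_comm _ t, ← mul_assoc, inv_mul_cancel₀ ht.ne', one_mul]

/-- The point at distance `r` from the origin in the direction `u` (geodesic polar coordinates). -/
noncomputable def hypPolar {n : ℕ} (r : ℝ) (u : Metric.sphere (0 : EuclideanSpace ℝ (Fin n)) 1) :
    HyperbolicSpace n :=
  ⟨(Real.cosh r, Real.sinh r • u.1), Real.cosh_pos r, by
    simp only [minkowski, real_inner_self_eq_norm_sq, norm_smul, norm_eq_of_mem_sphere, mul_one,
      Real.norm_eq_abs, sq_abs]
    nlinarith [Real.cosh_sq r]⟩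

/-- The mean of `f` over the geodesic sphere of radius `r` about the origin. -/
noncomputable def sphericalMean {n : ℕ} (f : HyperbolicSpace n → ℝ) (r : ℝ) : ℝ :=
  ∫ u, f (hypPolar r u) ∂uniformSphere n

/-- The radial part of the equation `Δ f + lam f = 0`, for a function which is regular at the
origin. -/
def IsRadialSolution (n : ℕ) (lam : ℝ) (M : ℝ → ℝ) : Prop :=
  ∃ M' M'' : ℝ → ℝ, (∀ r, HasDerivAt M (M' r) r) ∧ (∀ r, HasDerivAt M' (M'' r) r) ∧ M' 0 = 0 ∧
    ∀ r, 0 < r → M'' r + ((n : ℝ) - 1) * (Real.cosh r / Real.sinh r) * M' r + lam * M r = 0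

/-- The regular radial solutions form a line: for a solution `w` that vanishes at the origin the
energy `w' ^ 2 + lam w ^ 2` is nonincreasing. -/
theorem IsRadialSolution.mul_eq_mul {n : ℕ} (hn : 1 ≤ n) {lam : ℝ} (hlam : 0 < lam) {M N : ℝ → ℝ}
    (hM : IsRadialSolution n lam M) (hN : IsRadialSolution n lam N) {r : ℝ} (hr : 0 ≤ r) :
    M r * N 0 = N r * M 0 := by
  obtain ⟨M', M'', hM1, hM2, hM0, hMe⟩ := hM
  obtain ⟨N', N'', hN1, hN2, hN0, hNe⟩ := hN
  let w : ℝ → ℝ := fun r => M r * N 0 - N r * M 0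
  let w' : ℝ → ℝ := fun r => M' r * N 0 - N' r * M 0
  let w'' : ℝ → ℝ := fun r => M'' r * N 0 - N'' r * M 0
  have hw1 : ∀ r, HasDerivAt w (w' r) r := fun r => ((hM1 r).mul_const _).sub ((hN1 r).mul_const _)
  have hw2 : ∀ r, HasDerivAt w' (w'' r) r := fun r =>
    ((hM2 r).mul_const _).sub ((hN2 r).mul_const _)
  have hwe : ∀ r, 0 < r →
      w'' r + ((n : ℝ) - 1) * (Real.cosh r / Real.sinh r) * w' r + lam * w r = 0 := by
    intro r hr
    linear_combination N 0 * hMe r hr - M 0 * hNe r hr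
  let E : ℝ → ℝ := fun r => w' r ^ 2 + lam * w r ^ 2
  have hE : ∀ r, HasDerivAt E (2 * w' r * w'' r + lam * (2 * w r * w' r)) r := fun r => by
    have h := ((hw2 r).fun_pow 2).fun_add (((hw1 r).fun_pow 2).const_mul lam)
    simpa only [Nat.cast_ofNat, Nat.add_one_sub_one, pow_one] using h
  have hanti : AntitoneOn E (Ici 0) := by
    refine antitoneOn_of_deriv_nonpos (convex_Ici 0)
      (fun r _ => (hE r).continuousAt.continuousWithinAt)
      (fun r _ => (hE r).differentiableAt.differentiableWithinAt) fun r hr => ?_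
    rw [interior_Ici] at hr
    rw [(hE r).deriv]
    have h1 : 0 ≤ ((n : ℝ) - 1) * (Real.cosh r / Real.sinh r) := by
      refine mul_nonneg ?_ (div_nonneg (Real.cosh_pos r).le (Real.sinh_pos_iff.2 hr).le)
      have : (1 : ℝ) ≤ n := by exact_mod_cast hn
      linarith
    have h2 := hwe r hr
    have h3 : w'' r = -(((n : ℝ) - 1) * (Real.cosh r / Real.sinh r) * w' r) - lam * w r := by
      linarith
    rw [h3]
    nlinarith [mul_nonneg h1 (sq_nonneg (w' r))]
  have h0 : E 0 = 0 := by simp [E, w, w', hM0, hN0, mul_comm]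
  have h1 : E r ≤ 0 := h0 ▸ hanti self_mem_Ici hr hr
  have h2 : lam * w r ^ 2 ≤ 0 := by
    have : 0 ≤ w' r ^ 2 := sq_nonneg _
    simp only [E] at h1
    linarith
  have h3 : w r = 0 := by
    by_contra h
    have : 0 < w r ^ 2 := by positivity
    nlinarith [mul_pos hlam this]
  simpa [w, sub_eq_zero] using h3

theorem HypSmooth.contDiffAt {n : ℕ} {F : Type*} [NormedAddCommGroup F] [NormedSpace ℝ F]
    {f : HyperbolicSpace n → F} (hf : HypSmooth f) {x : MinkowskiSpace n} (hx : x ∈ futureCone n) :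
    ContDiffAt ℝ ((⊤ : ℕ∞) : WithTop ℕ∞) (radialExt f) x :=
  ContDiffOn.contDiffAt hf ((isOpen_futureCone n).mem_nhds hx)

theorem HypSmooth.contDiffOn_fderiv {n : ℕ} {F : Type*} [NormedAddCommGroup F] [NormedSpace ℝ F]
    {f : HyperbolicSpace n → F} (hf : HypSmooth f) :
    ContDiffOn ℝ ((⊤ : ℕ∞) : WithTop ℕ∞) (fderiv ℝ (radialExt f)) (futureCone n) :=
  ContDiffOn.fderiv_of_isOpen hf (isOpen_futureCone n) (by simp)

/-- Euler's relation for the extension, which is homogeneous of degree `0`. -/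
theorem fderiv_radialExt_self {n : ℕ} {F : Type*} [NormedAddCommGroup F] [NormedSpace ℝ F]
    {f : HyperbolicSpace n → F} (hf : HypSmooth f) {x : MinkowskiSpace n} (hx : x ∈ futureCone n) :
    fderiv ℝ (radialExt f) x x = 0 := by
  have h1 : HasDerivAt (fun t : ℝ => t • x) x 1 := by
    simpa using (hasDerivAt_id (1 : ℝ)).smul_const x
  have h2 : HasFDerivAt (radialExt f) (fderiv ℝ (radialExt f) x) ((1 : ℝ) • x) := by
    rw [one_smul]
    exact ((hf.contDiffAt hx).differentiableAt (by simp)).hasFDerivAt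
  have h3 := h2.comp_hasDerivAt (1 : ℝ) h1
  have h4 : (radialExt f ∘ fun t : ℝ => t • x) =ᶠ[𝓝 1] fun _ => radialExt f x := by
    filter_upwards [lt_mem_nhds (zero_lt_one' ℝ)] with t ht using radialExt_smul f hx ht
  exact h3.unique ((hasDerivAt_const _ _).congr_of_eventuallyEq h4)

/-- Euler's relation, differentiated once more in the radial direction. -/
theorem fderiv_fderiv_radialExt_self {n : ℕ} {F : Type*} [NormedAddCommGroup F] [NormedSpace ℝ F]
    {f : HyperbolicSpace n → F} (hf : HypSmooth f) {x : MinkowskiSpace n} (hx : x ∈ futureCone n) :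
    fderiv ℝ (fderiv ℝ (radialExt f)) x x x = 0 := by
  have h1 : HasFDerivAt (fderiv ℝ (radialExt f)) (fderiv ℝ (fderiv ℝ (radialExt f)) x) x :=
    ((hf.contDiffOn_fderiv.contDiffAt ((isOpen_futureCone n).mem_nhds hx)).differentiableAt
      (by simp)).hasFDerivAt
  have h2 := h1.clm_apply (hasFDerivAt_id x)
  have h3 : (fun y => fderiv ℝ (radialExt f) y (id y)) =ᶠ[𝓝 x] fun _ => 0 := by
    filter_upwards [(isOpen_futureCone n).mem_nhds hx] with y hy using fderiv_radialExt_self hf hy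
  have h4 := h2.unique ((hasFDerivAt_const _ _).congr_of_eventuallyEq h3)
  have h5 := congrArg (fun L => L x) h4
  simpa [fderiv_radialExt_self hf hx] using h5

theorem dAlembert_eq {n : ℕ} {F : Type*} [NormedAddCommGroup F] [NormedSpace ℝ F]
    (h : MinkowskiSpace n → F) (x : MinkowskiSpace n) :
    dAlembert h x = -fderiv ℝ (fderiv ℝ h) x (1, 0) (1, 0) +
      ∑ i, fderiv ℝ (fderiv ℝ h) x (0, EuclideanSpace.single i 1)
        (0, EuclideanSpace.single i 1) := by
  simp only [dAlembert, iteratedFDeriv_two_apply]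

/-- The unit speed geodesic from the origin in the direction `u`, as a curve in the ambient
space. -/
noncomputable def polarPos {n : ℕ} (r : ℝ) (u : Metric.sphere (0 : EuclideanSpace ℝ (Fin n)) 1) :
    MinkowskiSpace n := (Real.cosh r, Real.sinh r • u.1)

/-- The velocity of the geodesic `polarPos`. -/
noncomputable def polarVel {n : ℕ} (r : ℝ) (u : Metric.sphere (0 : EuclideanSpace ℝ (Fin n)) 1) :
    MinkowskiSpace n := (Real.sinh r, Real.cosh r • u.1)

theorem continuous_polarPos (n : ℕ) :
    Continuous fun q : ℝ × Metric.sphere (0 : EuclideanSpace ℝ (Fin n)) 1 => polarPos q.1 q.2 := by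
  unfold polarPos; fun_prop

theorem continuous_polarVel (n : ℕ) :
    Continuous fun q : ℝ × Metric.sphere (0 : EuclideanSpace ℝ (Fin n)) 1 => polarVel q.1 q.2 := by
  unfold polarVel; fun_prop

theorem hasDerivAt_polarPos {n : ℕ} (r : ℝ)
    (u : Metric.sphere (0 : EuclideanSpace ℝ (Fin n)) 1) :
    HasDerivAt (fun r => polarPos r u) (polarVel r u) r :=
  (Real.hasDerivAt_cosh r).prodMk ((Real.hasDerivAt_sinh r).smul_const u.1)

theorem hasDerivAt_polarVel {n : ℕ} (r : ℝ)
    (u : Metric.sphere (0 : EuclideanSpace ℝ (Fin n)) 1) :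
    HasDerivAt (fun r => polarVel r u) (polarPos r u) r :=
  (Real.hasDerivAt_sinh r).prodMk ((Real.hasDerivAt_cosh r).smul_const u.1)

section

variable {n : ℕ} {C : Set (MinkowskiSpace n)} {E : MinkowskiSpace n → ℝ}
  {D : MinkowskiSpace n → MinkowskiSpace n →L[ℝ] ℝ}
  {B : MinkowskiSpace n → MinkowskiSpace n →L[ℝ] MinkowskiSpace n →L[ℝ] ℝ}

theorem hasDerivAt_integral_polarPos
    (hp : ∀ r (u : Metric.sphere (0 : EuclideanSpace ℝ (Fin n)) 1), polarPos r u ∈ C)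
    (hE : ∀ x ∈ C, HasFDerivAt E (D x) x) (hD : ContinuousOn D C) (r : ℝ) :
    HasDerivAt (fun r => ∫ u, E (polarPos r u) ∂uniformSphere n)
      (∫ u, D (polarPos r u) (polarVel r u) ∂uniformSphere n) r := by
  have hEc : ContinuousOn E C := fun x hx => (hE x hx).continuousAt.continuousWithinAt
  refine hasDerivAt_integral_of_continuousOn isOpen_univ (mem_univ r)
    (G := fun r u => E (polarPos r u)) (G' := fun r u => D (polarPos r u) (polarVel r u))
    (fun r _ u => ?_) (fun r _ => ?_) ?_
  · have := (hE _ (hp r u)).comp_hasDerivAt r (hasDerivAt_polarPos r u)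
    exact this
  · exact hEc.comp_continuous
      ((continuous_polarPos n).comp (by fun_prop : Continuous fun u => (r, u))) (hp r)
  · exact ((hD.comp_continuous (continuous_polarPos n) fun q => hp q.1 q.2).clm_apply
      (continuous_polarVel n)).continuousOn

/-- The second radial derivative; the acceleration of the geodesic `polarPos` is its position. -/
theorem hasDerivAt_integral_polarVel
    (hp : ∀ r (u : Metric.sphere (0 : EuclideanSpace ℝ (Fin n)) 1), polarPos r u ∈ C)
    (hD : ∀ x ∈ C, HasFDerivAt D (B x) x) (hB : ContinuousOn B C) (r : ℝ) :
    HasDerivAt (fun r => ∫ u, D (polarPos r u) (polarVel r u) ∂uniformSphere n)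
      (∫ u, (B (polarPos r u) (polarVel r u) (polarVel r u) + D (polarPos r u) (polarPos r u))
        ∂uniformSphere n) r := by
  have hDc : ContinuousOn D C := fun x hx => (hD x hx).continuousAt.continuousWithinAt
  have hDp := hDc.comp_continuous (continuous_polarPos n) fun q => hp q.1 q.2
  have hBp := hB.comp_continuous (continuous_polarPos n) fun q => hp q.1 q.2
  refine hasDerivAt_integral_of_continuousOn isOpen_univ (mem_univ r)
    (G := fun r u => D (polarPos r u) (polarVel r u))
    (G' := fun r u => B (polarPos r u) (polarVel r u) (polarVel r u)
      + D (polarPos r u) (polarPos r u))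
    (fun r _ u => ?_) (fun r _ => ?_) ?_
  · have h1 := (hD _ (hp r u)).comp_hasDerivAt r (hasDerivAt_polarPos r u)
    have h2 := h1.clm_apply (hasDerivAt_polarVel r u)
    exact h2
  · exact (hDp.clm_apply (continuous_polarVel n)).comp (by fun_prop : Continuous fun u => (r, u))
  · exact ((((hBp).clm_apply (continuous_polarVel n)).clm_apply (continuous_polarVel n)).add
      (hDp.clm_apply (continuous_polarPos n))).continuousOn

/-- The divergence theorem on the sphere, summed over the components of the Euclidean gradient. -/
theorem integral_spatial_trace (hC : IsOpen C)
    (hp : ∀ r (u : Metric.sphere (0 : EuclideanSpace ℝ (Fin n)) 1), polarPos r u ∈ C)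
    (hD : ∀ x ∈ C, HasFDerivAt D (B x) x) (hB : ContinuousOn B C) (hDs : ContDiffOn ℝ 1 D C)
    (r : ℝ) :
    ∫ u, Real.sinh r * ((∑ j, B (polarPos r u) (0, EuclideanSpace.single j 1)
        (0, EuclideanSpace.single j 1)) - B (polarPos r u) (0, u.1) (0, u.1)) ∂uniformSphere n
      = ((n : ℝ) - 1) * ∫ u, D (polarPos r u) (0, u.1) ∂uniformSphere n := by
  have hDc : ContinuousOn D C := fun x hx => (hD x hx).continuousAt.continuousWithinAt
  have hpr : Continuous fun u : Metric.sphere (0 : EuclideanSpace ℝ (Fin n)) 1 => polarPos r u :=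
    (continuous_polarPos n).comp (by fun_prop : Continuous fun u => (r, u))
  have hDp : Continuous fun u => D (polarPos r u) := hDc.comp_continuous hpr (hp r)
  have hBp : Continuous fun u => B (polarPos r u) := hB.comp_continuous hpr (hp r)
  let e : Fin n → MinkowskiSpace n := fun j => (0, EuclideanSpace.single j 1)
  -- `ρ u` is the outer normal; the divergence theorem is applied to each component `D (e j)` of the
  -- gradient, with the field that is the gradient of the `j`-th coordinate
  let ρ : Metric.sphere (0 : EuclideanSpace ℝ (Fin n)) 1 → MinkowskiSpace n := fun u => (0, u.1)
  have hρc : Continuous ρ := by fun_prop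
  have hdiv : ∀ j, ∫ u, Real.sinh r * (B (polarPos r u) (e j - u.1 j • ρ u) (e j))
      ∂uniformSphere n = ((n : ℝ) - 1) * ∫ u, u.1 j * D (polarPos r u) (e j) ∂uniformSphere n := by
    intro j
    let q : EuclideanSpace ℝ (Fin n) → MinkowskiSpace n := fun v => (Real.cosh r, Real.sinh r • v)
    let U : Set (EuclideanSpace ℝ (Fin n)) := q ⁻¹' C
    have hq : ContDiff ℝ 1 q := by fun_prop
    have hU : IsOpen U := hC.preimage hq.continuous
    have hSU : Metric.sphere (0 : EuclideanSpace ℝ (Fin n)) 1 ⊆ U := fun v hv => hp r ⟨v, hv⟩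
    have hh : ContDiffOn ℝ 1 (fun v => D (q v) (e j)) U :=
      (hDs.comp hq.contDiffOn (fun v hv => hv)).clm_apply contDiffOn_const
    have h1 := integral_fderiv_tangent hU hSU hh (EuclideanSpace.single j 1)
    have h2 : ∀ u : Metric.sphere (0 : EuclideanSpace ℝ (Fin n)) 1,
        ⟪EuclideanSpace.single j (1 : ℝ), u.1⟫ = u.1 j := fun u => by
      simp [EuclideanSpace.inner_single_left]
    simp only [h2, smul_eq_mul] at h1
    refine Eq.trans ?_ h1
    refine integral_congr_ae (Eventually.of_forall fun u => ?_)
    let L : EuclideanSpace ℝ (Fin n) →L[ℝ] MinkowskiSpace n :=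
      Real.sinh r • ContinuousLinearMap.inr ℝ ℝ (EuclideanSpace ℝ (Fin n))
    have hq1 : HasFDerivAt q L u.1 := by
      have h := (L.hasFDerivAt (x := u.1)).const_add ((Real.cosh r, 0) : MinkowskiSpace n)
      have hqL : q = fun v => ((Real.cosh r, 0) : MinkowskiSpace n) + L v := by
        ext v <;> simp [q, L]
      rw [hqL]; exact h
    have h3 := ((hD (q u.1) (hp r u)).comp u.1 hq1).clm_apply (hasFDerivAt_const (e j) u.1)
    have h4 : fderiv ℝ (fun v => D (q v) (e j)) u.1 = _ := h3.fderiv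
    have h5 : L (EuclideanSpace.single j 1 - u.1 j • u.1) = Real.sinh r • (e j - u.1 j • ρ u) := by
      simp [L, e, ρ]
    simp only [h4]
    have h6 : Real.sinh r * (B (polarPos r u) (e j - u.1 j • ρ u) (e j))
        = B (polarPos r u) (Real.sinh r • (e j - u.1 j • ρ u)) (e j) := by
      rw [map_smul]; rfl
    rw [h6, ← h5]
    simp [q, polarPos]
  have hsumρ : ∀ u : Metric.sphere (0 : EuclideanSpace ℝ (Fin n)) 1, ∑ j, u.1 j • e j = ρ u := by
    intro u
    have := (EuclideanSpace.basisFun (Fin n) ℝ).sum_repr u.1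
    simp only [EuclideanSpace.basisFun_repr, EuclideanSpace.basisFun_apply] at this
    ext1
    · simp [e, ρ, Prod.fst_sum]
    · simp only [e, ρ, Prod.snd_sum, Prod.smul_snd]; exact this
  have h1 : ∀ u, Real.sinh r * ((∑ j, B (polarPos r u) (e j) (e j)) - B (polarPos r u) (ρ u) (ρ u))
      = ∑ j, Real.sinh r * (B (polarPos r u) (e j - u.1 j • ρ u) (e j)) := by
    intro u
    rw [← Finset.mul_sum]
    congr 1
    generalize B (polarPos r u) = L
    have h2 : ∀ j, L (e j - u.1 j • ρ u) (e j) = L (e j) (e j) - u.1 j * L (ρ u) (e j) := by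
      intro j
      rw [map_sub, map_smul]; rfl
    simp only [h2, Finset.sum_sub_distrib]
    congr 1
    conv_lhs => enter [2]; rw [← hsumρ u]
    rw [map_sum]
    simp
  have h2 : ∀ u, D (polarPos r u) (ρ u) = ∑ j, u.1 j * D (polarPos r u) (e j) := by
    intro u
    conv_lhs => rw [← hsumρ u]
    rw [map_sum]
    simp
  change ∫ u, Real.sinh r * ((∑ j, B (polarPos r u) (e j) (e j)) - B (polarPos r u) (ρ u) (ρ u))
      ∂uniformSphere n = ((n : ℝ) - 1) * ∫ u, D (polarPos r u) (ρ u) ∂uniformSphere n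
  have hcj : ∀ j, Continuous fun u : Metric.sphere (0 : EuclideanSpace ℝ (Fin n)) 1 => u.1 j :=
    fun j => by fun_prop
  simp only [h1, h2]
  rw [integral_finsetSum, integral_finsetSum, Finset.mul_sum]
  · exact Finset.sum_congr rfl fun j _ => hdiv j
  · intro j _
    exact integrable_uniformSphere ((hcj j).mul (hDp.clm_apply continuous_const))
  · intro j _
    exact integrable_uniformSphere (continuous_const.mul
      ((hBp.clm_apply (continuous_const.sub ((hcj j).smul hρc))).clm_apply continuous_const))

end

theorem sphericalMean_eq {n : ℕ} (f : HyperbolicSpace n → ℝ) :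
    sphericalMean f = fun r => ∫ u, radialExt f (polarPos r u) ∂uniformSphere n := by
  ext r
  refine integral_congr_ae (Eventually.of_forall fun u => ?_)
  exact (radialExt_coe f (hypPolar r u)).symm

/-- The spherical mean is an even function of the radius. -/
theorem sphericalMean_neg {n : ℕ} (f : HyperbolicSpace n → ℝ) (r : ℝ) :
    sphericalMean f (-r) = sphericalMean f r := by
  unfold sphericalMean
  rw [← integral_sphereMap (LinearIsometryEquiv.neg ℝ) (fun u => f (hypPolar (-r) u))]
  refine integral_congr_ae (Eventually.of_forall fun u => ?_)
  simp [hypPolar, sphereMap]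

/-- Spherical means of eigenfunctions solve the radial equation. In the plane spanned by the
position `p` and the radial velocity `T`, homogeneity of degree `0` gives the second radial
derivative; the divergence theorem on the sphere accounts for the remaining directions. -/
theorem isRadialSolution_sphericalMean {n : ℕ} {lam : ℝ} {f : HyperbolicSpace n → ℝ}
    (hf : IsHypEigenfunction lam f) : IsRadialSolution n lam (sphericalMean f) := by
  have hs := hf.smooth
  have hopen := isOpen_futureCone n
  have hp : ∀ r (u : Metric.sphere (0 : EuclideanSpace ℝ (Fin n)) 1), polarPos r u ∈ futureCone n :=
    fun r u => (hypPolar r u).mem_futureCone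
  have hDc := hs.contDiffOn_fderiv
  have hE1 : ∀ x ∈ futureCone n, HasFDerivAt (radialExt f) (fderiv ℝ (radialExt f) x) x :=
    fun x hx => ((hs.contDiffAt hx).differentiableAt (by simp)).hasFDerivAt
  have hD1 : ∀ x ∈ futureCone n, HasFDerivAt (fderiv ℝ (radialExt f))
      (fderiv ℝ (fderiv ℝ (radialExt f)) x) x := fun x hx =>
    ((hDc.contDiffAt (hopen.mem_nhds hx)).differentiableAt (by simp)).hasFDerivAt
  have hBco : ContinuousOn (fderiv ℝ (fderiv ℝ (radialExt f))) (futureCone n) :=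
    hDc.continuousOn_fderiv_of_isOpen hopen (by simp)
  have hDx : ∀ x ∈ futureCone n, fderiv ℝ (radialExt f) x x = 0 := fun x hx =>
    fderiv_radialExt_self hs hx
  have hBx : ∀ x ∈ futureCone n, fderiv ℝ (fderiv ℝ (radialExt f)) x x x = 0 := fun x hx =>
    fderiv_fderiv_radialExt_self hs hx
  have heig : ∀ r (u : Metric.sphere (0 : EuclideanSpace ℝ (Fin n)) 1),
      -fderiv ℝ (fderiv ℝ (radialExt f)) (polarPos r u) (1, 0) (1, 0) +
        ∑ j, fderiv ℝ (fderiv ℝ (radialExt f)) (polarPos r u) (0, EuclideanSpace.single j 1)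
          (0, EuclideanSpace.single j 1) = -(lam * radialExt f (polarPos r u)) := by
    intro r u
    have h1 := hf.eigen (hypPolar r u)
    rw [hypLaplacian, dAlembert_eq, smul_eq_mul, ← radialExt_coe f] at h1
    exact eq_neg_of_add_eq_zero_left h1
  have hEco : ContinuousOn (radialExt f) (futureCone n) := hs.continuousOn
  have hDco := hDc.continuousOn
  have hDs := hDc.of_le (show (1 : WithTop ℕ∞) ≤ ((⊤ : ℕ∞) : WithTop ℕ∞) by simp)
  rw [sphericalMean_eq]
  have heven : (fun r => ∫ u, radialExt f (polarPos (-r) u) ∂uniformSphere n)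
      = fun r => ∫ u, radialExt f (polarPos r u) ∂uniformSphere n := by
    rw [← sphericalMean_eq]
    ext r
    exact (congrFun (sphericalMean_eq f) (-r)).symm.trans (sphericalMean_neg f r)
  generalize radialExt f = E at *
  generalize fderiv ℝ E = D at *
  generalize fderiv ℝ D = B at *
  clear hs hDc
  have hder1 := hasDerivAt_integral_polarPos hp hE1 hDco
  have hder2 := hasDerivAt_integral_polarVel hp hD1 hBco
  refine ⟨_, _, hder1, hder2, ?_, fun r hr => ?_⟩
  · have h0 := hder1 0
    -- an even function has derivative `0` at the origin
    have h1 := (show HasDerivAt (fun r => ∫ u, E (polarPos r u) ∂uniformSphere n) _ (-0) by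
      rw [neg_zero]; exact h0).scomp (0 : ℝ) (hasDerivAt_neg (0 : ℝ))
    have h2 := h1.unique (heven ▸ h0)
    simp only [smul_eq_mul] at h2
    linarith
  · have hsh : 0 < Real.sinh r := Real.sinh_pos_iff.2 hr
    have hcs : Real.cosh r ^ 2 - Real.sinh r ^ 2 = 1 := Real.cosh_sq_sub_sinh_sq r
    have hpr : Continuous fun u : Metric.sphere (0 : EuclideanSpace ℝ (Fin n)) 1 => polarPos r u :=
      (continuous_polarPos n).comp (by fun_prop : Continuous fun u => (r, u))
    have hEp : Continuous fun u => E (polarPos r u) := hEco.comp_continuous hpr (hp r)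
    have hBp : Continuous fun u => B (polarPos r u) := hBco.comp_continuous hpr (hp r)
    have hdiv := integral_spatial_trace hopen hp hD1 hBco hDs r
    have hpd : ∀ u : Metric.sphere (0 : EuclideanSpace ℝ (Fin n)) 1, polarPos r u
        = Real.cosh r • ((1, 0) : MinkowskiSpace n)
          + Real.sinh r • ((0, u.1) : MinkowskiSpace n) := by
      intro u; simp [polarPos]
    have hTd : ∀ u : Metric.sphere (0 : EuclideanSpace ℝ (Fin n)) 1, polarVel r u
        = Real.sinh r • ((1, 0) : MinkowskiSpace n)
          + Real.cosh r • ((0, u.1) : MinkowskiSpace n) := by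
      intro u; simp [polarVel]
    -- `D p = 0` by homogeneity, for the position `p = cosh r o + sinh r u`; modulo `p`, `cosh r T`
    -- is the spatial vector `(0, u)`
    have hDT : ∀ u : Metric.sphere (0 : EuclideanSpace ℝ (Fin n)) 1,
        Real.cosh r * D (polarPos r u) (polarVel r u) = D (polarPos r u) (0, u.1) := by
      intro u
      have h1 := hDx _ (hp r u)
      generalize D (polarPos r u) = L at h1 ⊢
      rw [hpd] at h1
      rw [hTd]
      simp only [map_add, map_smul, smul_eq_mul] at h1 ⊢
      linear_combination (-Real.sinh r) * h1 + L (0, u.1) * hcs + 2 * Real.sinh r * h1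
    -- `B(p, p) = 0` likewise, so that `B(T, T) = B(T, T) - B(p, p)`
    have hBT : ∀ u : Metric.sphere (0 : EuclideanSpace ℝ (Fin n)) 1,
        B (polarPos r u) (polarVel r u) (polarVel r u)
          = -B (polarPos r u) (1, 0) (1, 0) + B (polarPos r u) (0, u.1) (0, u.1) := by
      intro u
      have h1 := hBx _ (hp r u)
      generalize B (polarPos r u) = L at h1 ⊢
      rw [hpd] at h1
      rw [hTd]
      simp only [map_add, map_smul, add_apply, smul_apply, smul_eq_mul] at h1 ⊢
      linear_combination h1 + (L (0, u.1) (0, u.1) - L (1, 0) (1, 0)) * hcs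
    have hM2 : ∫ u, (B (polarPos r u) (polarVel r u) (polarVel r u)
          + D (polarPos r u) (polarPos r u)) ∂uniformSphere n
        = -(lam * ∫ u, E (polarPos r u) ∂uniformSphere n) - ((n : ℝ) - 1) / Real.sinh r *
          ∫ u, D (polarPos r u) (0, u.1) ∂uniformSphere n := by
      have h1 : ∀ u, B (polarPos r u) (polarVel r u) (polarVel r u)
          + D (polarPos r u) (polarPos r u) = -lam * E (polarPos r u) - (Real.sinh r)⁻¹ *
            (Real.sinh r * ((∑ j, B (polarPos r u) (0, EuclideanSpace.single j 1)
              (0, EuclideanSpace.single j 1)) - B (polarPos r u) (0, u.1) (0, u.1))) := by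
        intro u
        rw [hDx _ (hp r u), hBT, inv_mul_cancel_left₀ hsh.ne']
        linear_combination heig r u
      have hBu : Continuous fun u : Metric.sphere (0 : EuclideanSpace ℝ (Fin n)) 1 =>
          B (polarPos r u) (0, u.1) (0, u.1) :=
        (hBp.clm_apply (by fun_prop)).clm_apply (by fun_prop)
      have hBs : Continuous fun u : Metric.sphere (0 : EuclideanSpace ℝ (Fin n)) 1 =>
          ∑ j, B (polarPos r u) (0, EuclideanSpace.single j 1) (0, EuclideanSpace.single j 1) :=
        continuous_finsetSum _ fun j _ =>
          (hBp.clm_apply continuous_const).clm_apply continuous_const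
      simp only [h1]
      rw [integral_sub, integral_const_mul, integral_const_mul, hdiv]
      · ring
      · exact integrable_uniformSphere (continuous_const.mul hEp)
      · exact integrable_uniformSphere
          (continuous_const.mul (continuous_const.mul (hBs.sub hBu)))
    have hM1 : Real.cosh r * ∫ u, D (polarPos r u) (polarVel r u) ∂uniformSphere n
        = ∫ u, D (polarPos r u) (0, u.1) ∂uniformSphere n := by
      rw [← integral_const_mul]
      simp only [hDT]
    rw [hM2, ← hM1]
    ring

/-! ### Superpositions of plane waves as power series -/

/-- The coefficients of the binomial series `(1 - z) ^ μ = ∑ b_m z ^ m`. -/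
noncomputable def waveCoeff (μ : ℂ) (m : ℕ) : ℂ := (-1) ^ m * Ring.choose μ m

/-- The recurrence of the binomial coefficients. -/
theorem succ_mul_waveCoeff_succ (μ : ℂ) (m : ℕ) :
    ((m : ℂ) + 1) * waveCoeff μ (m + 1) = -(μ - m) * waveCoeff μ m := by
  have h1 := Ring.descPochhammer_eq_factorial_smul_choose μ m
  have h2 := Ring.descPochhammer_eq_factorial_smul_choose μ (m + 1)
  rw [descPochhammer_succ_right, Polynomial.smeval_mul, h1, Nat.factorial_succ] at h2
  simp only [Polynomial.smeval_sub, Polynomial.smeval_X, Polynomial.smeval_natCast, nsmul_eq_mul,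
    pow_one, pow_zero, mul_one] at h2
  have h3 : (m.factorial : ℂ) ≠ 0 := by exact_mod_cast m.factorial_ne_zero
  have h4 : ((m : ℂ) + 1) * Ring.choose μ (m + 1) = (μ - m) * Ring.choose μ m := by
    apply mul_left_cancel₀ h3
    push_cast at h2
    linear_combination -h2
  simp only [waveCoeff, pow_succ]
  linear_combination (-1) ^ m * (-1) * h4

theorem hasSum_waveCoeff (μ : ℂ) {z : ℂ} (hz : ‖z‖ < 1) :
    HasSum (fun m => waveCoeff μ m * z ^ m) ((1 - z) ^ μ) := by
  have h := (Complex.one_add_cpow_hasFPowerSeriesOnBall_zero (a := μ)).hasSum (y := -z)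
    (by rw [Metric.mem_eball]; simpa [edist_zero_right, ← ofReal_norm] using
          (ENNReal.ofReal_lt_one.2 hz))
  simp only [binomialSeries_apply, zero_add] at h
  rw [← sub_eq_add_neg] at h
  refine h.congr_fun fun m => ?_
  simp only [List.ofFn_const, List.prod_replicate, smul_eq_mul, waveCoeff]
  rw [neg_pow z m]; ring

/-- Coefficient sequences whose power series converges absolutely in the unit disc, with any
polynomial weight. -/
def IsUnitDiscSeq (c : ℕ → ℂ) : Prop :=
  ∀ (K : ℕ) (ρ : ℝ), 0 ≤ ρ → ρ < 1 → Summable fun m : ℕ => ‖c m‖ * ((m : ℝ) + 1) ^ K * ρ ^ m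

theorem isUnitDiscSeq_waveCoeff (μ : ℂ) : IsUnitDiscSeq (waveCoeff μ) := by
  intro K ρ hρ0 hρ1
  obtain ⟨s, hs1, hs2⟩ := exists_between hρ1
  have hs0 : 0 < s := lt_of_le_of_lt hρ0 hs1
  -- compare with the absolutely convergent series at a radius `s` with `ρ < s < 1`
  have hsum : Summable fun m : ℕ => ‖waveCoeff μ m‖ * s ^ m := by
    obtain ⟨s', hs1', hs2'⟩ := exists_between hs2
    have h := (hasSum_waveCoeff μ (z := (s' : ℂ))
      (by simpa [abs_of_pos (hs0.trans hs1')] using hs2')).summable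
    obtain ⟨C, hC⟩ := h.tendsto_atTop_zero.norm.bddAbove_range
    have hs0' := hs0.trans hs1'
    refine Summable.of_nonneg_of_le (fun m => by positivity) (fun m => ?_)
      ((summable_geometric_of_lt_one (by positivity) ((div_lt_one hs0').2 hs1')).mul_left C)
    have hm : ‖waveCoeff μ m‖ * s' ^ m ≤ C := by
      have := hC (mem_range_self m)
      simpa [abs_of_pos hs0'] using this
    calc ‖waveCoeff μ m‖ * s ^ m = ‖waveCoeff μ m‖ * s' ^ m * (s / s') ^ m := by
          rw [div_pow]; field_simp
      _ ≤ C * (s / s') ^ m := mul_le_mul_of_nonneg_right hm (by positivity)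
  have hgeo : Tendsto (fun m : ℕ => ((m : ℝ) + 1) ^ K * (ρ / s) ^ m) atTop (𝓝 0) := by
    rcases hρ0.eq_or_lt with h | h
    · refine (tendsto_congr' ?_).2 tendsto_const_nhds
      filter_upwards [eventually_gt_atTop 0] with m hm
      rw [← h, zero_div, zero_pow hm.ne', mul_zero]
    · have h1 := (tendsto_pow_const_mul_const_pow_of_abs_lt_one K (r := ρ / s)
        (by rw [abs_of_pos (by positivity)]; exact (div_lt_one hs0).2 hs1)).comp
          (tendsto_add_atTop_nat 1)
      have h2 := h1.mul_const (ρ / s)⁻¹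
      rw [zero_mul] at h2
      refine h2.congr fun m => ?_
      have : ρ / s ≠ 0 := by positivity
      simp only [Function.comp, pow_succ]
      push_cast
      field_simp
  obtain ⟨C, hC⟩ := hgeo.bddAbove_range
  refine Summable.of_nonneg_of_le (fun m => by positivity) (fun m => ?_) (hsum.mul_left C)
  have hm : ((m : ℝ) + 1) ^ K * (ρ / s) ^ m ≤ C := hC (mem_range_self m)
  calc ‖waveCoeff μ m‖ * ((m : ℝ) + 1) ^ K * ρ ^ m
      = ((m : ℝ) + 1) ^ K * (ρ / s) ^ m * (‖waveCoeff μ m‖ * s ^ m) := by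
        rw [div_pow]; field_simp
    _ ≤ C * (‖waveCoeff μ m‖ * s ^ m) := mul_le_mul_of_nonneg_right hm (by positivity)

theorem IsUnitDiscSeq.mul_linear {c : ℕ → ℂ} (hc : IsUnitDiscSeq c) (z : ℂ) :
    IsUnitDiscSeq fun m => (z - m) * c m := by
  intro K ρ hρ0 hρ1
  refine Summable.of_nonneg_of_le (fun m => by positivity) (fun m => ?_)
    ((hc (K + 1) ρ hρ0 hρ1).mul_left (‖z‖ + 1))
  have h : ‖z - m‖ ≤ (‖z‖ + 1) * ((m : ℝ) + 1) := by
    refine (norm_sub_le _ _).trans ?_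
    rw [Complex.norm_natCast]
    nlinarith [norm_nonneg z, (Nat.cast_nonneg m : (0 : ℝ) ≤ m)]
  rw [norm_mul]
  calc ‖z - m‖ * ‖c m‖ * ((m : ℝ) + 1) ^ K * ρ ^ m
      ≤ (‖z‖ + 1) * ((m : ℝ) + 1) * ‖c m‖ * ((m : ℝ) + 1) ^ K * ρ ^ m := by gcongr
    _ = (‖z‖ + 1) * (‖c m‖ * ((m : ℝ) + 1) ^ (K + 1) * ρ ^ m) := by ring

theorem IsUnitDiscSeq.succ {c : ℕ → ℂ} (hc : IsUnitDiscSeq c) :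
    IsUnitDiscSeq fun m => ((m : ℂ) + 1) * c (m + 1) := by
  intro K ρ hρ0 hρ1
  obtain ⟨s, hs1, hs2⟩ := exists_between hρ1
  have hs0 : 0 < s := lt_of_le_of_lt hρ0 hs1
  have h := ((summable_nat_add_iff 1).2 (hc (K + 1) s hs0.le hs2)).mul_left s⁻¹
  refine Summable.of_nonneg_of_le (fun m => by positivity) (fun m => ?_) h
  have h1 : ‖((m : ℂ) + 1)‖ = (m : ℝ) + 1 := by
    rw [← Nat.cast_succ, Complex.norm_natCast, Nat.cast_succ]
  rw [norm_mul, h1]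
  push_cast
  calc ((m : ℝ) + 1) * ‖c (m + 1)‖ * ((m : ℝ) + 1) ^ K * ρ ^ m
      = ‖c (m + 1)‖ * ((m : ℝ) + 1) ^ (K + 1) * ρ ^ m := by ring
    _ ≤ ‖c (m + 1)‖ * ((m : ℝ) + 1 + 1) ^ (K + 1) * s ^ m := by gcongr; linarith
    _ = s⁻¹ * (‖c (m + 1)‖ * ((m : ℝ) + 1 + 1) ^ (K + 1) * s ^ (m + 1)) := by
        rw [pow_succ s]; field_simp

/-- The linear form `⟪v, ·⟫` as a polynomial. -/
noncomputable def linForm {n : ℕ} (v : EuclideanSpace ℝ (Fin n)) : MvPolynomial (Fin n) ℂ :=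
  ∑ j, (v j : ℂ) • MvPolynomial.X j

theorem linForm_add {n : ℕ} (v w : EuclideanSpace ℝ (Fin n)) :
    linForm (v + w) = linForm v + linForm w := by
  simp [linForm, add_smul, Finset.sum_add_distrib]

theorem linForm_smul {n : ℕ} (t : ℝ) (v : EuclideanSpace ℝ (Fin n)) :
    linForm (t • v) = (t : ℂ) • linForm v := by
  simp only [linForm, PiLp.smul_apply, smul_eq_mul, Complex.ofReal_mul, Finset.smul_sum, smul_smul]

theorem linForm_single {n : ℕ} (j : Fin n) :
    linForm (EuclideanSpace.single j (1 : ℝ)) = MvPolynomial.X j := by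
  classical
  rw [linForm, Finset.sum_eq_single j]
  · simp
  · intro i _ hij; simp [hij]
  · simp

/-- A moment functional of a (generalized) density on the unit sphere: a linear functional on
polynomials that does not see the relation `∑ X_j ^ 2 = 1`, and whose moments of degree `m` grow at
most linearly with `m` in the Hilbert-Schmidt norm of tensors. -/
structure IsSphericalMoment {n : ℕ} (ℓ : MvPolynomial (Fin n) ℂ →ₗ[ℂ] ℂ) (C : ℝ) : Prop where
  trace : ∀ p, ℓ (p * ∑ j, MvPolynomial.X j * MvPolynomial.X j) = ℓ p
  bound : ∀ m : ℕ, ∑ i : Fin m → Fin n, ‖ℓ (∏ k, MvPolynomial.X (i k))‖ ^ 2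
    ≤ (C * ((m : ℝ) + 1)) ^ 2
  nonneg : 0 ≤ C

/-- The moments of products of linear forms, by the Cauchy-Schwarz inequality over the coordinates
of the tensor `v 0 ⊗ ⋯ ⊗ v (m - 1)`. The bound has the norms of the `v k` with constant `1`, which
is what makes the series converge in the whole cone `‖v‖ < x₀`. -/
theorem IsSphericalMoment.norm_prod_le {n : ℕ} {ℓ : MvPolynomial (Fin n) ℂ →ₗ[ℂ] ℂ} {C : ℝ}
    (hℓ : IsSphericalMoment ℓ C) {m : ℕ} (v : Fin m → EuclideanSpace ℝ (Fin n)) :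
    ‖ℓ (∏ k, linForm (v k))‖ ≤ C * ((m : ℝ) + 1) * ∏ k, ‖v k‖ := by
  classical
  have hexp : ∏ k, linForm (v k)
      = ∑ i : Fin m → Fin n, (∏ k, (v k (i k) : ℂ)) • ∏ k, MvPolynomial.X (i k) := by
    simp only [linForm]
    rw [Finset.prod_univ_sum, Fintype.piFinset_univ]
    refine Finset.sum_congr rfl fun i _ => ?_
    simp only [MvPolynomial.smul_eq_C_mul, Finset.prod_mul_distrib, map_prod]
  have hnorm : ∑ i : Fin m → Fin n, ‖(∏ k, (v k (i k) : ℂ))‖ ^ 2 = (∏ k, ‖v k‖) ^ 2 := by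
    rw [← Finset.prod_pow]
    simp only [EuclideanSpace.norm_sq_eq]
    rw [Finset.prod_univ_sum, Fintype.piFinset_univ]
    refine Finset.sum_congr rfl fun i _ => ?_
    rw [norm_prod, ← Finset.prod_pow]
    simp
  rw [hexp, map_sum]
  refine abs_le_of_sq_le_sq' ?_ ?_ |>.2
  · calc ‖∑ i : Fin m → Fin n, ℓ ((∏ k, (v k (i k) : ℂ)) • ∏ k, MvPolynomial.X (i k))‖ ^ 2
        ≤ (∑ i : Fin m → Fin n,
            ‖(∏ k, (v k (i k) : ℂ))‖ * ‖ℓ (∏ k, MvPolynomial.X (i k))‖) ^ 2 := by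
          gcongr
          refine (norm_sum_le _ _).trans (le_of_eq ?_)
          refine Finset.sum_congr rfl fun i _ => ?_
          rw [map_smul, norm_smul]
      _ ≤ (∑ i : Fin m → Fin n, ‖(∏ k, (v k (i k) : ℂ))‖ ^ 2) *
            ∑ i : Fin m → Fin n, ‖ℓ (∏ k, MvPolynomial.X (i k))‖ ^ 2 :=
          Finset.sum_mul_sq_le_sq_mul_sq _ _ _
      _ ≤ (∏ k, ‖v k‖) ^ 2 * (C * ((m : ℝ) + 1)) ^ 2 := by
          rw [hnorm]; gcongr; exact hℓ.bound m
      _ = (C * ((m : ℝ) + 1) * ∏ k, ‖v k‖) ^ 2 := by ring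
  · have := hℓ.nonneg
    positivity

/-- A polynomial `Y` such that the moments of `⟪v, ·⟫ ^ m Y` grow at most linearly. -/
def IsTame {n : ℕ} (ℓ : MvPolynomial (Fin n) ℂ →ₗ[ℂ] ℂ) (Y : MvPolynomial (Fin n) ℂ) : Prop :=
  ∃ C : ℝ, 0 ≤ C ∧ ∀ (m : ℕ) (v : EuclideanSpace ℝ (Fin n)),
    ‖ℓ (linForm v ^ m * Y)‖ ≤ C * ((m : ℝ) + 1) * ‖v‖ ^ m

theorem IsSphericalMoment.isTame_prod {n : ℕ} {ℓ : MvPolynomial (Fin n) ℂ →ₗ[ℂ] ℂ} {C : ℝ}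
    (hℓ : IsSphericalMoment ℓ C) {k : ℕ} (w : Fin k → EuclideanSpace ℝ (Fin n)) :
    IsTame ℓ (∏ j, linForm (w j)) := by
  have hC := hℓ.nonneg
  refine ⟨C * ((k : ℝ) + 1) * ∏ j, ‖w j‖, by positivity, fun m v => ?_⟩
  have h := hℓ.norm_prod_le (Fin.append (fun _ : Fin m => v) w)
  rw [Fin.prod_univ_add, Fin.prod_univ_add] at h
  simp only [Fin.append_left, Fin.append_right, Finset.prod_const, Finset.card_univ,
    Fintype.card_fin] at h
  refine h.trans ?_
  have h1 : ((m + k : ℕ) : ℝ) + 1 ≤ ((k : ℝ) + 1) * ((m : ℝ) + 1) := by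
    push_cast
    nlinarith [mul_nonneg (Nat.cast_nonneg m : (0 : ℝ) ≤ m) (Nat.cast_nonneg k : (0 : ℝ) ≤ k)]
  calc C * (((m + k : ℕ) : ℝ) + 1) * (‖v‖ ^ m * ∏ j, ‖w j‖)
      ≤ C * (((k : ℝ) + 1) * ((m : ℝ) + 1)) * (‖v‖ ^ m * ∏ j, ‖w j‖) := by gcongr
    _ = _ := by ring

theorem IsSphericalMoment.isTame_one {n : ℕ} {ℓ : MvPolynomial (Fin n) ℂ →ₗ[ℂ] ℂ} {C : ℝ}
    (hℓ : IsSphericalMoment ℓ C) : IsTame ℓ 1 := by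
  simpa using hℓ.isTame_prod (k := 0) Fin.elim0

theorem IsSphericalMoment.isTame_X {n : ℕ} {ℓ : MvPolynomial (Fin n) ℂ →ₗ[ℂ] ℂ} {C : ℝ}
    (hℓ : IsSphericalMoment ℓ C) (j : Fin n) : IsTame ℓ (MvPolynomial.X j) := by
  simpa [linForm_single] using hℓ.isTame_prod (k := 1) fun _ => EuclideanSpace.single j 1

theorem IsSphericalMoment.isTame_X_mul_X {n : ℕ} {ℓ : MvPolynomial (Fin n) ℂ →ₗ[ℂ] ℂ} {C : ℝ}
    (hℓ : IsSphericalMoment ℓ C) (j : Fin n) :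
    IsTame ℓ (MvPolynomial.X j * MvPolynomial.X j) := by
  simpa [linForm_single, pow_two] using hℓ.isTame_prod (k := 2) fun _ => EuclideanSpace.single j 1

/-- The derivative of `s ↦ ℓ((p + s q) ^ m Y)`, for a linear form without any continuity: only
finitely many values of `ℓ` are involved. -/
theorem hasDerivAt_linear_pow_mul {A : Type*} [CommRing A] [Algebra ℂ A] (ℓ : A →ₗ[ℂ] ℂ) (p q : A)
    (m : ℕ) : ∀ (Y : A) (t : ℝ), HasDerivAt (fun s : ℝ => ℓ ((p + (s : ℂ) • q) ^ m * Y))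
      (m * ℓ ((p + (t : ℂ) • q) ^ (m - 1) * (q * Y))) t := by
  induction m with
  | zero => intro Y t; simpa using hasDerivAt_const t (ℓ Y)
  | succ m ih =>
    intro Y t
    have hs : HasDerivAt (fun s : ℝ => (s : ℂ)) 1 t := Complex.ofRealCLM.hasDerivAt
    have h := (ih (p * Y) t).fun_add (hs.fun_mul (ih (q * Y) t))
    have hfun : (fun s : ℝ => ℓ ((p + (s : ℂ) • q) ^ (m + 1) * Y)) = fun s : ℝ =>
        ℓ ((p + (s : ℂ) • q) ^ m * (p * Y)) + (s : ℂ) * ℓ ((p + (s : ℂ) • q) ^ m * (q * Y)) := by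
      ext s
      rw [← smul_eq_mul (s : ℂ), ← map_smul, ← map_add]
      congr 1
      rw [pow_succ, mul_assoc, add_mul, mul_add, smul_mul_assoc, mul_smul_comm]
    rw [hfun]
    refine h.congr_deriv ?_
    cases m with
    | zero => simp
    | succ m =>
      simp only [Nat.add_sub_cancel]
      have e : (p + (t : ℂ) • q) ^ (m + 1) * (q * Y) = (p + (t : ℂ) • q) ^ m * (q * (p * Y))
          + (t : ℂ) • ((p + (t : ℂ) • q) ^ m * (q * (q * Y))) := by
        rw [pow_succ, mul_assoc, add_mul, mul_add, smul_mul_assoc, mul_smul_comm]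
        congr 2
        · ring
      rw [e, map_add, map_smul, smul_eq_mul]
      push_cast
      ring

/-! ### Derivatives and smoothness of the series -/

/-- The series `∑ c_m x₀ ^ (μ - m - k) ℓ(⟪v, ·⟫ ^ m Y)` at the point `(x₀, v)`. For `c` the
coefficients of the binomial series, `k = 0` and `Y = 1` it is `ℓ((x₀ - ⟪v, ·⟫) ^ μ)`; its partial
derivatives are series of the same kind. -/
noncomputable def waveSum {n : ℕ} (μ : ℂ) (ℓ : MvPolynomial (Fin n) ℂ →ₗ[ℂ] ℂ) (c : ℕ → ℂ) (k : ℕ)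
    (Y : MvPolynomial (Fin n) ℂ) (s : ℝ) (v : EuclideanSpace ℝ (Fin n)) : ℂ :=
  ∑' m : ℕ, c m * (s : ℂ) ^ (μ - m - k) * ℓ (linForm v ^ m * Y)

section

variable {n : ℕ} {μ : ℂ} {ℓ : MvPolynomial (Fin n) ℂ →ₗ[ℂ] ℂ} {Y : MvPolynomial (Fin n) ℂ}

/-- The majorant of the series, uniform in the region `s₀ ≤ s`, `‖v‖ ≤ ρ s`. -/
theorem norm_waveTerm_le (hμ : μ.re ≤ 0) (c : ℕ → ℂ) (k : ℕ) {C : ℝ} (hC : 0 ≤ C)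
    (hY : ∀ (m : ℕ) (v : EuclideanSpace ℝ (Fin n)),
      ‖ℓ (linForm v ^ m * Y)‖ ≤ C * ((m : ℝ) + 1) * ‖v‖ ^ m)
    {s₀ s ρ : ℝ} (hs₀ : 0 < s₀) (hs : s₀ ≤ s) (hρ : 0 ≤ ρ) {v : EuclideanSpace ℝ (Fin n)}
    (hv : ‖v‖ ≤ ρ * s) (m : ℕ) :
    ‖c m * (s : ℂ) ^ (μ - m - k) * ℓ (linForm v ^ m * Y)‖
      ≤ s₀ ^ (μ.re - k) * C * (‖c m‖ * ((m : ℝ) + 1) ^ 1 * ρ ^ m) := by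
  have hs' : 0 < s := hs₀.trans_le hs
  have h1 : ‖(s : ℂ) ^ (μ - m - k)‖ = s ^ (μ.re - m - k) := by
    rw [Complex.norm_cpow_eq_rpow_re_of_pos hs']; simp
  have h2 : s ^ (μ.re - m - k) * (ρ * s) ^ m = s ^ (μ.re - k) * ρ ^ m := by
    rw [mul_pow, show μ.re - m - k = (μ.re - k) - (m : ℝ) by ring, Real.rpow_sub hs',
      Real.rpow_natCast]
    field_simp
  have h3 : s ^ (μ.re - k) ≤ s₀ ^ (μ.re - k) :=
    Real.rpow_le_rpow_of_nonpos hs₀ hs (by linarith [(Nat.cast_nonneg k : (0 : ℝ) ≤ k)])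
  rw [norm_mul, norm_mul, h1]
  calc ‖c m‖ * s ^ (μ.re - m - k) * ‖ℓ (linForm v ^ m * Y)‖
      ≤ ‖c m‖ * s ^ (μ.re - m - k) * (C * ((m : ℝ) + 1) * (ρ * s) ^ m) := by
        gcongr
        refine (hY m v).trans ?_
        gcongr
    _ = (s ^ (μ.re - m - k) * (ρ * s) ^ m) * (C * (‖c m‖ * ((m : ℝ) + 1))) := by ring
    _ = s ^ (μ.re - k) * (C * (‖c m‖ * ((m : ℝ) + 1) ^ 1 * ρ ^ m)) := by rw [h2]; ring
    _ ≤ s₀ ^ (μ.re - k) * (C * (‖c m‖ * ((m : ℝ) + 1) ^ 1 * ρ ^ m)) := by gcongr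
    _ = _ := by ring

theorem summable_waveTerm (hμ : μ.re ≤ 0) {c : ℕ → ℂ} (hc : IsUnitDiscSeq c) (k : ℕ)
    (hY : IsTame ℓ Y) {s : ℝ} {v : EuclideanSpace ℝ (Fin n)} (hv : ‖v‖ < s) :
    Summable fun m : ℕ => c m * (s : ℂ) ^ (μ - m - k) * ℓ (linForm v ^ m * Y) := by
  obtain ⟨C, hC, hY⟩ := hY
  have hs : 0 < s := (norm_nonneg v).trans_lt hv
  refine Summable.of_norm_bounded
    ((hc 1 (‖v‖ / s) (by positivity) ((div_lt_one hs).2 hv)).mul_left (s ^ (μ.re - k) * C))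
    fun m => ?_
  exact norm_waveTerm_le hμ c k hC hY hs le_rfl (by positivity)
    (by rw [div_mul_cancel₀ _ hs.ne']) m

theorem hasDerivAt_ofReal_cpow {s : ℝ} (hs : 0 < s) (z : ℂ) :
    HasDerivAt (fun y : ℝ => (y : ℂ) ^ z) (z * (s : ℂ) ^ (z - 1)) s := by
  have h := ((hasDerivAt_id (s : ℂ)).cpow_const (c := z) (Or.inl (by simpa using hs))).comp_ofReal
  simpa using h

theorem hasDerivAt_waveSum_time (hμ : μ.re ≤ 0) {c : ℕ → ℂ} (hc : IsUnitDiscSeq c) (k : ℕ)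
    (hY : IsTame ℓ Y) {s : ℝ} {v : EuclideanSpace ℝ (Fin n)} (hv : ‖v‖ < s) :
    HasDerivAt (fun y => waveSum μ ℓ c k Y y v)
      (waveSum μ ℓ (fun m => (μ - k - m) * c m) (k + 1) Y s v) s := by
  have hsum := summable_waveTerm hμ hc k hY hv
  have hs : 0 < s := (norm_nonneg v).trans_lt hv
  have hc' : IsUnitDiscSeq fun m => (μ - k - m) * c m := hc.mul_linear (μ - k)
  obtain ⟨C, hC, hY⟩ := hY
  obtain ⟨ρ, hρ1, hρ2⟩ := exists_between ((div_lt_one hs).2 hv)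
  have hρ0 : 0 < ρ := lt_of_le_of_lt (by positivity) hρ1
  -- on `(s₀, ∞)` the majorant holds for a fixed `ρ < 1`, and this interval contains `s`
  set s₀ := max (‖v‖ / ρ) (s / 2) with hs₀
  have hs₀s : s₀ < s := by
    refine max_lt ?_ (by linarith)
    rw [div_lt_iff₀ hρ0, mul_comm]
    exact (div_lt_iff₀ hs).1 hρ1
  have hs₀0 : 0 < s₀ := lt_max_of_lt_right (by positivity)
  have hmain := hasDerivAt_tsum_of_isPreconnected (𝕜 := ℝ) (t := Ioi s₀)
    ((hc' 1 ρ hρ0.le hρ2).mul_left (s₀ ^ (μ.re - (k + 1 : ℕ)) * C)) isOpen_Ioi isPreconnected_Ioi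
    (g := fun m (y : ℝ) => c m * (y : ℂ) ^ (μ - m - k) * ℓ (linForm v ^ m * Y))
    (g' := fun m (y : ℝ) => (μ - k - m) * c m * (y : ℂ) ^ (μ - m - (k + 1 : ℕ)) *
      ℓ (linForm v ^ m * Y))
    (fun m y hy => ?_) (fun m y hy => ?_) (mem_Ioi.2 hs₀s) hsum (mem_Ioi.2 hs₀s)
  · exact hmain
  · have h := ((hasDerivAt_ofReal_cpow (hs₀0.trans hy) (μ - m - k)).const_mul (c m)).mul_const
      (ℓ (linForm v ^ m * Y))
    refine h.congr_deriv ?_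
    push_cast
    rw [show μ - m - k - 1 = μ - m - (k + 1) by ring]
    ring
  · refine norm_waveTerm_le hμ (fun m => (μ - k - m) * c m) (k + 1) hC hY hs₀0
      (le_of_lt (mem_Ioi.1 hy)) hρ0.le ?_ m
    have : ‖v‖ / ρ ≤ y := (le_max_left _ _).trans (le_of_lt (mem_Ioi.1 hy))
    rw [div_le_iff₀ hρ0] at this
    linarith

theorem hasDerivAt_waveSum_space (hμ : μ.re ≤ 0) {c : ℕ → ℂ} (hc : IsUnitDiscSeq c) (k : ℕ)
    (hY : IsTame ℓ Y) {e : EuclideanSpace ℝ (Fin n)} (heY : IsTame ℓ (linForm e * Y)) {s : ℝ}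
    {v : EuclideanSpace ℝ (Fin n)} {t : ℝ} (hv : ‖v + t • e‖ < s) :
    HasDerivAt (fun y : ℝ => waveSum μ ℓ c k Y s (v + y • e))
      (waveSum μ ℓ (fun m => ((m : ℂ) + 1) * c (m + 1)) (k + 1) (linForm e * Y) s
        (v + t • e)) t := by
  have hsum := summable_waveTerm hμ hc k hY hv
  have hs : 0 < s := (norm_nonneg _).trans_lt hv
  have hc' := hc.succ
  have hsum' := summable_waveTerm hμ hc' (k + 1) heY hv
  obtain ⟨C, hC, hYe⟩ := heY
  obtain ⟨ρ, hρ1, hρ2⟩ := exists_between ((div_lt_one hs).2 hv)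
  have hρ0 : 0 < ρ := lt_of_le_of_lt (by positivity) hρ1
  -- for `|y - t| < δ` the point `v + y e` stays in the ball of radius `ρ s`
  set δ := (ρ * s - ‖v + t • e‖) / (‖e‖ + 1) with hδ
  have hδ0 : 0 < δ := by
    refine div_pos ?_ (by positivity)
    rw [div_lt_iff₀ hs] at hρ1; linarith
  have hball : ∀ y ∈ Metric.ball t δ, ‖v + y • e‖ ≤ ρ * s := by
    intro y hy
    have h1 : v + y • e = (v + t • e) + (y - t) • e := by rw [sub_smul]; abel
    have h2 : |y - t| ≤ δ := le_of_lt (by simpa [Real.dist_eq] using hy)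
    have h3 : δ * (‖e‖ + 1) = ρ * s - ‖v + t • e‖ := div_mul_cancel₀ _ (by positivity)
    rw [h1]
    refine (norm_add_le _ _).trans ?_
    rw [norm_smul, Real.norm_eq_abs]
    nlinarith [norm_nonneg e]
  -- the term of index `0` has derivative `0`, and the others are renumbered
  let u : ℕ → ℝ := fun m => Nat.casesOn m 0 fun m =>
    s ^ (μ.re - (k + 1 : ℕ)) * C * (‖((m : ℂ) + 1) * c (m + 1)‖ * ((m : ℝ) + 1) ^ 1 * ρ ^ m)
  have hu : Summable u := (summable_nat_add_iff 1).1
    ((hc' 1 ρ hρ0.le hρ2).mul_left (s ^ (μ.re - (k + 1 : ℕ)) * C))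
  let g' : ℕ → ℝ → ℂ := fun m y => c m * (s : ℂ) ^ (μ - m - k) *
    (m * ℓ (linForm (v + y • e) ^ (m - 1) * (linForm e * Y)))
  have hg'0 : ∀ y, g' 0 y = 0 := fun y => by simp [g']
  have hg's : ∀ m y, g' (m + 1) y = ((m : ℂ) + 1) * c (m + 1) *
      (s : ℂ) ^ (μ - m - (k + 1 : ℕ)) * ℓ (linForm (v + y • e) ^ m * (linForm e * Y)) := by
    intro m y
    simp only [g', Nat.add_sub_cancel]
    push_cast
    rw [show μ - ((m : ℂ) + 1) - k = μ - m - (k + 1) by ring]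
    ring
  have hmain := hasDerivAt_tsum_of_isPreconnected (t := Metric.ball t δ) hu Metric.isOpen_ball
    (convex_ball t δ).isPreconnected
    (g := fun m y => c m * (s : ℂ) ^ (μ - m - k) * ℓ (linForm (v + y • e) ^ m * Y)) (g' := g')
    (fun m y _ => ?_) (fun m y hy => ?_) (Metric.mem_ball_self hδ0) hsum (Metric.mem_ball_self hδ0)
  · refine hmain.congr_deriv ?_
    have hsg : Summable fun m => g' m t := (summable_nat_add_iff 1).1 (by
      simp only [hg's]; exact hsum')
    rw [hsg.tsum_eq_zero_add, hg'0, zero_add]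
    simp only [hg's]
    rfl
  · have h := (hasDerivAt_linear_pow_mul ℓ (linForm v) (linForm e) m Y y).const_mul
      (c m * (s : ℂ) ^ (μ - m - k))
    simp only [← linForm_smul, ← linForm_add] at h
    exact h
  · cases m with
    | zero => rw [hg'0]; simp [u]
    | succ m =>
      rw [hg's]
      exact norm_waveTerm_le hμ (fun m => ((m : ℂ) + 1) * c (m + 1)) (k + 1) hC hYe hs le_rfl
        hρ0.le (hball y hy) m

/-- The series is homogeneous of degree `μ`. -/
theorem waveSum_smul (c : ℕ → ℂ) {s t : ℝ} (hs : 0 ≤ s) (ht : 0 < t)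
    (v : EuclideanSpace ℝ (Fin n)) :
    waveSum μ ℓ c 0 1 (t * s) (t • v) = (t : ℂ) ^ μ * waveSum μ ℓ c 0 1 s v := by
  have ht' : (t : ℂ) ≠ 0 := by exact_mod_cast ht.ne'
  rw [waveSum, waveSum, ← tsum_mul_left]
  refine tsum_congr fun m => ?_
  rw [linForm_smul, smul_pow, smul_mul_assoc, map_smul, smul_eq_mul, Complex.ofReal_mul,
    Complex.mul_cpow_ofReal_nonneg ht.le hs]
  have h : (t : ℂ) ^ (μ - m - (0 : ℕ)) * (t : ℂ) ^ m = (t : ℂ) ^ μ := by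
    rw [Nat.cast_zero, sub_zero, ← Complex.cpow_natCast, ← Complex.cpow_add _ _ ht']
    congr 1; ring
  rw [← h]
  ring

/-- `linForm` as a linear map over the reals. -/
noncomputable def linFormₗ (n : ℕ) : EuclideanSpace ℝ (Fin n) →ₗ[ℝ] MvPolynomial (Fin n) ℂ where
  toFun := linForm
  map_add' := linForm_add
  map_smul' t v := by
    rw [linForm_smul, RingHom.id_apply]
    exact Complex.coe_smul t (linForm v)

/-- The power series in `w = v / x₀` of a superposition of plane waves on the slice `x₀ = 1`. -/
noncomputable def waveSeries (μ : ℂ) (ℓ : MvPolynomial (Fin n) ℂ →ₗ[ℂ] ℂ) {C : ℝ}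
    (hℓ : IsSphericalMoment ℓ C) : FormalMultilinearSeries ℝ (EuclideanSpace ℝ (Fin n)) ℂ :=
  fun m => MultilinearMap.mkContinuous
    (waveCoeff μ m • (ℓ.restrictScalars ℝ).compMultilinearMap
      ((MultilinearMap.mkPiAlgebra ℝ (Fin m) (MvPolynomial (Fin n) ℂ)).compLinearMap
        fun _ => linFormₗ n)) (‖waveCoeff μ m‖ * (C * ((m : ℝ) + 1))) (fun v => by
    have h := hℓ.norm_prod_le v
    have e : (waveCoeff μ m • (ℓ.restrictScalars ℝ).compMultilinearMap
      ((MultilinearMap.mkPiAlgebra ℝ (Fin m) (MvPolynomial (Fin n) ℂ)).compLinearMap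
        fun _ => linFormₗ n)) v = waveCoeff μ m * ℓ (∏ k, linForm (v k)) := rfl
    rw [e, norm_mul, mul_assoc]
    gcongr)

theorem waveSeries_apply (μ : ℂ) {C : ℝ} (hℓ : IsSphericalMoment ℓ C) (m : ℕ)
    (v : Fin m → EuclideanSpace ℝ (Fin n)) :
    waveSeries μ ℓ hℓ m v = waveCoeff μ m * ℓ (∏ k, linForm (v k)) := rfl

theorem one_le_radius_waveSeries (μ : ℂ) {C : ℝ} (hℓ : IsSphericalMoment ℓ C) :
    1 ≤ (waveSeries μ ℓ hℓ).radius := by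
  refine ENNReal.le_of_forall_nnreal_lt fun r hr => ?_
  have hr1 : (r : ℝ) < 1 := by exact_mod_cast hr
  refine FormalMultilinearSeries.le_radius_of_summable_norm _ ?_
  have hC := hℓ.nonneg
  refine Summable.of_nonneg_of_le (fun m => by positivity) (fun m => ?_)
    ((isUnitDiscSeq_waveCoeff μ 1 r r.2 hr1).mul_left C)
  have h : ‖waveSeries μ ℓ hℓ m‖ ≤ ‖waveCoeff μ m‖ * (C * ((m : ℝ) + 1)) :=
    MultilinearMap.mkContinuous_norm_le _ (by positivity) _
  calc ‖waveSeries μ ℓ hℓ m‖ * (r : ℝ) ^ m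
      ≤ ‖waveCoeff μ m‖ * (C * ((m : ℝ) + 1)) * (r : ℝ) ^ m := by gcongr
    _ = _ := by ring

/-- By homogeneity the series is `x₀ ^ μ` times a convergent power series in `v / x₀`, hence smooth
in the open cone `‖v‖ < x₀`. -/
theorem contDiffOn_waveSum {C : ℝ} (hℓ : IsSphericalMoment ℓ C) :
    ContDiffOn ℝ ((⊤ : ℕ∞) : WithTop ℕ∞)
      (fun x : MinkowskiSpace n => waveSum μ ℓ (waveCoeff μ) 0 1 x.1 x.2)
      {x | ‖x.2‖ < x.1} := by
  have hfun : EqOn (fun x : MinkowskiSpace n => waveSum μ ℓ (waveCoeff μ) 0 1 x.1 x.2)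
      (fun x => Complex.exp (Real.log x.1 * μ) * (waveSeries μ ℓ hℓ).sum (x.1⁻¹ • x.2))
      {x | ‖x.2‖ < x.1} := by
    intro x hx
    have hx0 : 0 < x.1 := (norm_nonneg _).trans_lt hx
    have h1 := waveSum_smul (μ := μ) (ℓ := ℓ) (waveCoeff μ) zero_le_one hx0 (x.1⁻¹ • x.2)
    rw [mul_one, smul_smul, mul_inv_cancel₀ hx0.ne', one_smul] at h1
    simp only
    rw [h1, Complex.cpow_def_of_ne_zero (by exact_mod_cast hx0.ne'), Complex.ofReal_log hx0.le]
    congr 1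
    rw [waveSum, FormalMultilinearSeries.sum]
    refine tsum_congr fun m => ?_
    rw [waveSeries_apply]
    simp
  have hser : ContDiffOn ℝ ((⊤ : ℕ∞) : WithTop ℕ∞) (waveSeries μ ℓ hℓ).sum (Metric.ball 0 1) := by
    have h1 := (waveSeries μ ℓ hℓ).hasFPowerSeriesOnBall
      (zero_lt_one.trans_le (one_le_radius_waveSeries μ hℓ))
    have h2 : ContDiffOn ℝ ((⊤ : ℕ∞) : WithTop ℕ∞) (waveSeries μ ℓ hℓ).sum
        (Metric.eball 0 (waveSeries μ ℓ hℓ).radius) := h1.analyticOnNhd.contDiffOn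
        Metric.isOpen_eball.uniqueDiffOn
    refine h2.mono ?_
    have : Metric.ball (0 : EuclideanSpace ℝ (Fin n)) 1 = Metric.eball 0 1 := by
      rw [← Metric.eball_ofReal, ENNReal.ofReal_one]
    rw [this]
    exact Metric.eball_subset_eball (one_le_radius_waveSeries μ hℓ)
  refine ContDiffOn.congr ?_ hfun
  have hpos : ∀ x ∈ {x : MinkowskiSpace n | ‖x.2‖ < x.1}, x.1 ≠ 0 := fun x hx =>
    ((norm_nonneg _).trans_lt hx).ne'
  refine ContDiffOn.mul ?_ ?_
  · refine ContDiffOn.cexp (ContDiffOn.mul ?_ contDiffOn_const)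
    exact Complex.ofRealCLM.contDiff.comp_contDiffOn (contDiff_fst.contDiffOn.log hpos)
  · refine hser.comp ((contDiff_fst.contDiffOn.inv hpos).smul contDiff_snd.contDiffOn)
      fun x hx => ?_
    have hx0 : 0 < x.1 := (norm_nonneg _).trans_lt hx
    rw [mem_ball_zero_iff, norm_smul, norm_inv, Real.norm_eq_abs, abs_of_pos hx0,
      inv_mul_lt_iff₀ hx0, mul_one]
    exact hx

end

/-! ### Homogeneous solutions of the wave equation -/

/-- The second derivative in a direction, computed along the line in that direction. -/
theorem fderiv_fderiv_apply_of_line {E F : Type*} [NormedAddCommGroup E] [NormedSpace ℝ E]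
    [NormedAddCommGroup F] [NormedSpace ℝ F] {h : E → F} {x e : E} (hh : ContDiffAt ℝ 2 h x)
    {φ : ℝ → F} {φ' : F} (h1 : ∀ᶠ t in 𝓝 (0 : ℝ), HasDerivAt (fun s : ℝ => h (x + s • e)) (φ t) t)
    (h2 : HasDerivAt φ φ' 0) : fderiv ℝ (fderiv ℝ h) x e e = φ' := by
  have hline : ∀ t : ℝ, HasDerivAt (fun s : ℝ => x + s • e) e t := fun t => by
    simpa using ((hasDerivAt_id t).smul_const e).const_add x
  have hx : Tendsto (fun s : ℝ => x + s • e) (𝓝 0) (𝓝 x) := by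
    have := (hline 0).continuousAt.tendsto
    simpa using this
  have hd : ∀ᶠ y in 𝓝 x, DifferentiableAt ℝ h y := by
    filter_upwards [hh.eventually (by simp)] with y hy using hy.differentiableAt two_ne_zero
  have h3 : (fun t : ℝ => fderiv ℝ h (x + t • e) e) =ᶠ[𝓝 0] φ := by
    filter_upwards [h1, hx.eventually hd] with t ht1 ht2
    exact (ht2.hasFDerivAt.comp_hasDerivAt t (hline t)).unique ht1
  have h4 : HasFDerivAt (fderiv ℝ h) (fderiv ℝ (fderiv ℝ h) x) (x + (0 : ℝ) • e) := by
    rw [zero_smul, add_zero]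
    exact ((hh.fderiv_right (m := 1) one_add_one_eq_two.le).differentiableAt
      one_ne_zero).hasFDerivAt
  have h5 : HasDerivAt (fun s : ℝ => fderiv ℝ h (x + s • e)) (fderiv ℝ (fderiv ℝ h) x e) 0 :=
    h4.comp_hasDerivAt (0 : ℝ) (hline 0)
  have h6 : HasDerivAt (fun s : ℝ => fderiv ℝ h (x + s • e) e) (fderiv ℝ (fderiv ℝ h) x e e) 0 := by
    simpa using h5.clm_apply (hasDerivAt_const (0 : ℝ) e)
  exact h6.unique (h2.congr_of_eventuallyEq h3)

theorem minkowski_add_smul {n : ℕ} (x e : MinkowskiSpace n) (t : ℝ) :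
    minkowski (x + t • e) (x + t • e)
      = minkowski x x + 2 * t * minkowski x e + t ^ 2 * minkowski e e := by
  simp only [minkowski, Prod.fst_add, Prod.smul_fst, Prod.snd_add, Prod.smul_snd, smul_eq_mul,
    inner_add_left, inner_add_right, real_inner_smul_left, real_inner_smul_right,
    real_inner_comm x.2 e.2]
  ring

theorem hasDerivAt_minkowski_line {n : ℕ} (x e : MinkowskiSpace n) (t : ℝ) :
    HasDerivAt (fun s : ℝ => minkowski (x + s • e) (x + s • e))
      (2 * minkowski x e + 2 * t * minkowski e e) t := by
  simp only [minkowski_add_smul]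
  have h1 := ((((hasDerivAt_id t).const_mul 2).mul_const (minkowski x e)).const_add
    (minkowski x x)).fun_add ((hasDerivAt_pow 2 t).mul_const (minkowski e e))
  simpa using h1

section

variable {n : ℕ} {μ : ℂ} {U : MinkowskiSpace n → ℂ}

theorem contDiff_minkowski_self (n : ℕ) :
    ContDiff ℝ ((⊤ : ℕ∞) : WithTop ℕ∞) fun x : MinkowskiSpace n => minkowski x x := by
  unfold minkowski
  exact (contDiff_fst.mul contDiff_fst).sub (contDiff_snd.inner ℝ contDiff_snd)

/-- The restriction to the hyperboloid of a function homogeneous of degree `μ` extends to the cone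
as the product of the function with a power of the Minkowski form. -/
theorem radialExt_eq_of_homogeneous
    (hhom : ∀ x ∈ futureCone n, ∀ t : ℝ, 0 < t → U (t • x) = (t : ℂ) ^ μ * U x)
    {x : MinkowskiSpace n} (hx : x ∈ futureCone n) :
    radialExt (fun y : HyperbolicSpace n => U y.1) x
      = ((minkowski x x : ℝ) : ℂ) ^ (-μ / 2) * U x := by
  rw [radialExt, dif_pos hx]
  change U ((√(minkowski x x))⁻¹ • x) = _
  have hs : 0 < √(minkowski x x) := Real.sqrt_pos.2 hx.2
  rw [hhom x hx _ (inv_pos.2 hs)]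
  congr 1
  rw [Complex.cpow_def_of_ne_zero (by exact_mod_cast (inv_pos.2 hs).ne'),
    Complex.cpow_def_of_ne_zero (by exact_mod_cast hx.2.ne'),
    ← Complex.ofReal_log (inv_pos.2 hs).le, ← Complex.ofReal_log hx.2.le, Real.log_inv,
    Real.log_sqrt hx.2.le]
  push_cast
  ring_nf

/-- Euler's relation for functions homogeneous of degree `μ`. -/
theorem fderiv_self_of_homogeneous
    (hU : ContDiffOn ℝ ((⊤ : ℕ∞) : WithTop ℕ∞) U (futureCone n))
    (hhom : ∀ x ∈ futureCone n, ∀ t : ℝ, 0 < t → U (t • x) = (t : ℂ) ^ μ * U x)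
    {x : MinkowskiSpace n} (hx : x ∈ futureCone n) : fderiv ℝ U x x = μ * U x := by
  have h1 : HasDerivAt (fun t : ℝ => t • x) x 1 := by
    simpa using (hasDerivAt_id (1 : ℝ)).smul_const x
  have h2 : HasFDerivAt U (fderiv ℝ U x) ((1 : ℝ) • x) := by
    rw [one_smul]
    exact ((hU.contDiffAt ((isOpen_futureCone n).mem_nhds hx)).differentiableAt
      (by simp)).hasFDerivAt
  have h3 := h2.comp_hasDerivAt (1 : ℝ) h1
  have h4 : (U ∘ fun t : ℝ => t • x) =ᶠ[𝓝 1] fun t : ℝ => (t : ℂ) ^ μ * U x := by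
    filter_upwards [lt_mem_nhds (zero_lt_one' ℝ)] with t ht using hhom x hx t ht
  have h5 := ((hasDerivAt_ofReal_cpow one_pos μ).mul_const (U x)).congr_of_eventuallyEq h4
  simpa using h3.unique h5

/-- The second derivative of `[x, x] ^ ν U(x)` at a point of the hyperboloid. -/
theorem fderiv_fderiv_minkowski_cpow_mul (ν : ℂ)
    (hU : ContDiffOn ℝ ((⊤ : ℕ∞) : WithTop ℕ∞) U (futureCone n)) {E : MinkowskiSpace n → ℂ}
    (hE : ∀ y ∈ futureCone n, E y = ((minkowski y y : ℝ) : ℂ) ^ ν * U y)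
    {x : MinkowskiSpace n} (hx : x ∈ futureCone n) (hx1 : minkowski x x = 1)
    (e : MinkowskiSpace n) :
    fderiv ℝ (fderiv ℝ E) x e e
      = (ν * (ν - 1) * (2 * minkowski x e : ℝ) ^ 2 + ν * (2 * minkowski e e : ℝ)) * U x
        + 2 * (ν * (2 * minkowski x e : ℝ)) * fderiv ℝ U x e + fderiv ℝ (fderiv ℝ U) x e e := by
  have hO := isOpen_futureCone n
  have hle : (2 : WithTop ℕ∞) ≤ ((⊤ : ℕ∞) : WithTop ℕ∞) := WithTop.coe_le_coe.2 le_top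
  have hEs : ContDiffOn ℝ ((⊤ : ℕ∞) : WithTop ℕ∞) E (futureCone n) := by
    refine ContDiffOn.congr (f := fun y => Complex.exp (Real.log (minkowski y y) * ν) * U y) ?_ ?_
    · refine ContDiffOn.mul (ContDiffOn.cexp (ContDiffOn.mul ?_ contDiffOn_const)) hU
      exact Complex.ofRealCLM.contDiff.comp_contDiffOn
        ((contDiff_minkowski_self n).contDiffOn.log fun y hy => hy.2.ne')
    · intro y hy
      rw [hE y hy, Complex.cpow_def_of_ne_zero (by exact_mod_cast hy.2.ne'),
        Complex.ofReal_log hy.2.le]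
  have hline : ∀ t : ℝ, HasDerivAt (fun s : ℝ => x + s • e) e t := fun t => by
    simpa using ((hasDerivAt_id t).smul_const e).const_add x
  have hnear : ∀ᶠ t in 𝓝 (0 : ℝ), x + t • e ∈ futureCone n := by
    have := (hline 0).continuousAt.tendsto
    simp only [zero_smul, add_zero] at this
    exact this.eventually (hO.mem_nhds hx)
  let q : ℝ → ℝ := fun t => minkowski (x + t • e) (x + t • e)
  let q' : ℝ → ℝ := fun t => 2 * minkowski x e + 2 * t * minkowski e e
  have hq : ∀ t, HasDerivAt q (q' t) t := hasDerivAt_minkowski_line x e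
  have hq' : ∀ t, HasDerivAt q' (2 * minkowski e e) t := fun t => by
    have h := (((hasDerivAt_id t).const_mul 2).mul_const (minkowski e e)).const_add
      (2 * minkowski x e)
    rw [mul_one] at h
    exact h
  have hqν : ∀ (z : ℂ) t, 0 < q t →
      HasDerivAt (fun s => (q s : ℂ) ^ z) (z * (q t : ℂ) ^ (z - 1) * q' t) t := fun z t ht => by
    have := (hasDerivAt_ofReal_cpow ht z).scomp t (hq t)
    simpa [Function.comp_def, mul_comm] using this
  have hUd : ∀ t, x + t • e ∈ futureCone n →
      HasDerivAt (fun s : ℝ => U (x + s • e)) (fderiv ℝ U (x + t • e) e) t := fun t ht =>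
    ((hU.contDiffAt (hO.mem_nhds ht)).differentiableAt (by simp)).hasFDerivAt.comp_hasDerivAt t
      (hline t)
  have hUdd : HasDerivAt (fun t : ℝ => fderiv ℝ U (x + t • e) e)
      (fderiv ℝ (fderiv ℝ U) x e e) 0 := by
    have h4 : HasFDerivAt (fderiv ℝ U) (fderiv ℝ (fderiv ℝ U) x) (x + (0 : ℝ) • e) := by
      rw [zero_smul, add_zero]
      exact ((((hU.contDiffAt (hO.mem_nhds hx)).of_le hle).fderiv_right (m := 1)
        one_add_one_eq_two.le).differentiableAt one_ne_zero).hasFDerivAt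
    have h5 : HasDerivAt (fun s : ℝ => fderiv ℝ U (x + s • e)) (fderiv ℝ (fderiv ℝ U) x e) 0 :=
      h4.comp_hasDerivAt (0 : ℝ) (hline 0)
    simpa using h5.clm_apply (hasDerivAt_const (0 : ℝ) e)
  have hq0 : q 0 = 1 := by simp [q, hx1]
  have hx0 : x + (0 : ℝ) • e = x := by simp
  refine fderiv_fderiv_apply_of_line (φ := fun t =>
      ν * (q t : ℂ) ^ (ν - 1) * q' t * U (x + t • e) + (q t : ℂ) ^ ν * fderiv ℝ U (x + t • e) e)
    ((hEs.contDiffAt (hO.mem_nhds hx)).of_le hle) ?_ ?_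
  · filter_upwards [hnear.eventually_nhds] with t ht
    have ht' := ht.self_of_nhds
    refine ((hqν ν t ht'.2).fun_mul (hUd t ht')).congr_of_eventuallyEq ?_
    filter_upwards [ht] with s hs using hE _ hs
  · clear hEs hE
    have hpos : 0 < q 0 := by rw [hq0]; exact one_pos
    have h0 : x + (0 : ℝ) • e ∈ futureCone n := by rwa [hx0]
    have h1 := (((hqν (ν - 1) 0 hpos).const_mul ν).fun_mul (hq' 0).ofReal_comp).fun_mul (hUd 0 h0)
    have h2 := h1.fun_add ((hqν ν 0 hpos).fun_mul hUdd)
    refine h2.congr_deriv ?_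
    rw [hq0, hx0]
    simp [q']
    ring

theorem minkowski_eq_sum (x y : MinkowskiSpace n) :
    minkowski x y = x.1 * y.1 - ∑ j, x.2 j * y.2 j := by
  simp [minkowski, PiLp.inner_apply, mul_comm]

theorem MinkowskiSpace.eq_sum (x : MinkowskiSpace n) :
    x = x.1 • ((1 : ℝ), (0 : EuclideanSpace ℝ (Fin n)))
      + ∑ j, x.2 j • ((0 : ℝ), EuclideanSpace.single j (1 : ℝ)) := by
  have := (EuclideanSpace.basisFun (Fin n) ℝ).sum_repr x.2
  simp only [EuclideanSpace.basisFun_repr, EuclideanSpace.basisFun_apply] at this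
  ext1
  · simp [Prod.fst_sum]
  · simp only [Prod.snd_add, Prod.smul_snd, smul_zero, zero_add, Prod.snd_sum]
    exact this.symm

/-- A solution of the wave equation in the future cone that is homogeneous of degree `μ` restricts
to an eigenfunction on the hyperboloid: the Laplacian is the wave operator applied to
`[x, x] ^ (-μ / 2) U(x)`, and Euler's relation evaluates the first order terms. -/
theorem isHypEigenfunction_of_homogeneous {lam : ℝ}
    (hU : ContDiffOn ℝ ((⊤ : ℕ∞) : WithTop ℕ∞) U (futureCone n))
    (hhom : ∀ x ∈ futureCone n, ∀ t : ℝ, 0 < t → U (t • x) = (t : ℂ) ^ μ * U x)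
    (hbox : ∀ x : HyperbolicSpace n, dAlembert U x.1 = 0)
    (hμ : μ * (μ + 2 * hypSigma n) = -lam) :
    IsHypEigenfunction lam fun x : HyperbolicSpace n => U x.1 := by
  have hext := fun x (hx : x ∈ futureCone n) => radialExt_eq_of_homogeneous hhom hx
  refine ⟨?_, fun x => ?_⟩
  · refine ContDiffOn.congr (f := fun y => Complex.exp (Real.log (minkowski y y) * (-μ / 2)) * U y)
      ?_ ?_
    · refine ContDiffOn.mul (ContDiffOn.cexp (ContDiffOn.mul ?_ contDiffOn_const)) hU
      exact Complex.ofRealCLM.contDiff.comp_contDiffOn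
        ((contDiff_minkowski_self n).contDiffOn.log fun y hy => hy.2.ne')
    · intro y hy
      rw [hext y hy, Complex.cpow_def_of_ne_zero (by exact_mod_cast hy.2.ne'),
        Complex.ofReal_log hy.2.le]
  · have hx := x.mem_futureCone
    have hx1 : minkowski x.1 x.1 = 1 := x.2.2
    have hb := hbox x
    have hEuler := fderiv_self_of_homogeneous hU hhom hx
    rw [hypLaplacian]
    rw [dAlembert_eq] at hb ⊢
    simp only [fderiv_fderiv_minkowski_cpow_mul (-μ / 2) hU hext hx hx1]
    have hq : x.1.1 * x.1.1 - ∑ j, x.1.2 j * x.1.2 j = 1 := by rw [← minkowski_eq_sum, hx1]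
    have hE2 : (x.1.1 : ℂ) * fderiv ℝ U x.1 (1, 0)
        + ∑ j, (x.1.2 j : ℂ) * fderiv ℝ U x.1 (0, EuclideanSpace.single j 1) = μ * U x.1 := by
      rw [← hEuler]
      conv_rhs => enter [2]; rw [MinkowskiSpace.eq_sum x.1]
      simp only [map_add, map_smul, map_sum, Complex.real_smul]
    have m1 : minkowski x.1 ((1 : ℝ), (0 : EuclideanSpace ℝ (Fin n))) = x.1.1 := by
      simp [minkowski]
    have m2 : minkowski ((1 : ℝ), (0 : EuclideanSpace ℝ (Fin n))) (1, 0) = 1 := by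
      simp [minkowski]
    have m3 : ∀ j, minkowski x.1 ((0 : ℝ), EuclideanSpace.single j (1 : ℝ)) = -x.1.2 j :=
        fun j => by
      simp [minkowski, EuclideanSpace.inner_single_right]
    have m4 : ∀ j : Fin n, minkowski ((0 : ℝ), EuclideanSpace.single j (1 : ℝ))
        ((0 : ℝ), EuclideanSpace.single j (1 : ℝ)) = -1 := fun j => by
      simp [minkowski]
    simp only [m1, m2, m3, m4, Finset.sum_add_distrib, ← Finset.sum_mul]
    have hqC : (x.1.1 : ℂ) * x.1.1 - ∑ j, (x.1.2 j : ℂ) * x.1.2 j = 1 := by exact_mod_cast hq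
    have s1 : ∑ j, -μ / 2 * (-μ / 2 - 1) * ((2 * -x.1.2 j : ℝ) : ℂ) ^ 2
        = μ * (μ + 2) * ∑ j, (x.1.2 j : ℂ) * x.1.2 j := by
      rw [Finset.mul_sum]
      refine Finset.sum_congr rfl fun j _ => ?_
      push_cast; ring
    have s2 : ∑ j, 2 * (-μ / 2 * ((2 * -x.1.2 j : ℝ) : ℂ)) *
          fderiv ℝ U x.1 (0, EuclideanSpace.single j 1)
        = 2 * μ * ∑ j, (x.1.2 j : ℂ) * fderiv ℝ U x.1 (0, EuclideanSpace.single j 1) := by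
      rw [Finset.mul_sum]
      refine Finset.sum_congr rfl fun j _ => ?_
      push_cast; ring
    rw [s1, s2]
    have hlam : (lam : ℂ) = -(μ * (μ + 2 * hypSigma n)) := by rw [hμ]; ring
    have hσ : (hypSigma n : ℂ) = ((n : ℂ) - 1) / 2 := by simp [hypSigma]
    rw [hσ] at hlam
    simp only [Finset.sum_const, Finset.card_univ, Fintype.card_fin, Complex.real_smul, hlam,
      nsmul_eq_mul]
    push_cast
    linear_combination hb - μ * (μ + 2) * U x.1 * hqC + 2 * μ * hE2

end

section

variable {n : ℕ} {μ : ℂ} {ℓ : MvPolynomial (Fin n) ℂ →ₗ[ℂ] ℂ} {C : ℝ}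

theorem futureCone_subset (n : ℕ) :
    futureCone n ⊆ {x : MinkowskiSpace n | ‖x.2‖ < x.1} := by
  rintro x ⟨h0, h1⟩
  simp only [minkowski, real_inner_self_eq_norm_sq] at h1
  have : ‖x.2‖ ^ 2 < x.1 ^ 2 := by nlinarith
  exact lt_of_pow_lt_pow_left₀ 2 h0.le this

/-- The series solves the wave equation: by the recurrence of the binomial coefficients and the
relation `∑ X_j ^ 2 = 1`, the two second order parts agree term by term. -/
theorem dAlembert_waveSum (hℓ : IsSphericalMoment ℓ C) (hμ : μ.re ≤ 0) {x : MinkowskiSpace n}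
    (hx : ‖x.2‖ < x.1) :
    dAlembert (fun x : MinkowskiSpace n => waveSum μ ℓ (waveCoeff μ) 0 1 x.1 x.2) x = 0 := by
  have hb := isUnitDiscSeq_waveCoeff μ
  have hO : IsOpen {x : MinkowskiSpace n | ‖x.2‖ < x.1} :=
    isOpen_lt continuous_snd.norm continuous_fst
  have hs : ContDiffAt ℝ 2 (fun x : MinkowskiSpace n => waveSum μ ℓ (waveCoeff μ) 0 1 x.1 x.2) x :=
    ((contDiffOn_waveSum (μ := μ) hℓ).contDiffAt (hO.mem_nhds hx)).of_le
      (WithTop.coe_le_coe.2 le_top)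
  rw [dAlembert_eq]
  have ht : fderiv ℝ (fderiv ℝ fun x : MinkowskiSpace n => waveSum μ ℓ (waveCoeff μ) 0 1 x.1 x.2) x
      (1, 0) (1, 0) = waveSum μ ℓ (fun m => (μ - (1 : ℕ) - m) * ((μ - (0 : ℕ) - m) * waveCoeff μ m))
        2 1 x.1 x.2 := by
    refine fderiv_fderiv_apply_of_line (φ := fun t =>
      waveSum μ ℓ (fun m => (μ - (0 : ℕ) - m) * waveCoeff μ m) 1 1 (x.1 + t) x.2) hs ?_ ?_
    · have h0 : ∀ᶠ t in 𝓝 (0 : ℝ), ‖x.2‖ < x.1 + t :=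
        (continuousAt_const.eventually_lt (by fun_prop) (by simpa using hx))
      filter_upwards [h0] with t ht
      have h := (hasDerivAt_waveSum_time hμ hb 0 hℓ.isTame_one ht).comp_const_add x.1 t
      simpa using h
    · have h := (hasDerivAt_waveSum_time hμ (hb.mul_linear (μ - (0 : ℕ))) 1 hℓ.isTame_one
        (s := x.1 + 0) (by simpa using hx)).comp_const_add x.1 0
      simpa using h
  have hsp : ∀ j, fderiv ℝ (fderiv ℝ fun x : MinkowskiSpace n =>
      waveSum μ ℓ (waveCoeff μ) 0 1 x.1 x.2) x (0, EuclideanSpace.single j 1)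
        (0, EuclideanSpace.single j 1)
      = waveSum μ ℓ (fun m => ((m : ℂ) + 1) * (((m + 1 : ℕ) + 1) * waveCoeff μ (m + 1 + 1))) 2
        (MvPolynomial.X j * MvPolynomial.X j) x.1 x.2 := by
    intro j
    have e1 : IsTame ℓ (linForm (EuclideanSpace.single j (1 : ℝ)) * 1) := by
      rw [linForm_single, mul_one]; exact hℓ.isTame_X j
    have e2 : IsTame ℓ (linForm (EuclideanSpace.single j (1 : ℝ)) *
        (linForm (EuclideanSpace.single j (1 : ℝ)) * 1)) := by
      rw [linForm_single, mul_one]; exact hℓ.isTame_X_mul_X j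
    refine fderiv_fderiv_apply_of_line (φ := fun t =>
      waveSum μ ℓ (fun m => ((m : ℂ) + 1) * waveCoeff μ (m + 1)) 1
        (linForm (EuclideanSpace.single j (1 : ℝ)) * 1) x.1
        (x.2 + t • EuclideanSpace.single j (1 : ℝ))) hs ?_ ?_
    · have h0 : ∀ᶠ t in 𝓝 (0 : ℝ), ‖x.2 + t • EuclideanSpace.single j (1 : ℝ)‖ < x.1 :=
        (ContinuousAt.eventually_lt (by fun_prop) continuousAt_const (by simpa using hx))
      filter_upwards [h0] with t ht
      have h := hasDerivAt_waveSum_space hμ hb 0 hℓ.isTame_one e1 ht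
      simpa using h
    · have h := hasDerivAt_waveSum_space hμ hb.succ 1 e1 e2 (t := 0) (s := x.1) (v := x.2)
        (by simpa using hx)
      simp only [zero_smul, add_zero] at h
      have e3 : linForm (EuclideanSpace.single j (1 : ℝ)) *
          (linForm (EuclideanSpace.single j (1 : ℝ)) * 1)
          = MvPolynomial.X j * MvPolynomial.X j := by rw [mul_one, linForm_single]
      rw [← e3]
      exact h
  rw [ht]
  simp only [hsp]
  -- the coefficients of the second derivatives in time and in space agree
  have hco : ∀ m : ℕ, ((m : ℂ) + 1) * (((m + 1 : ℕ) + 1) * waveCoeff μ (m + 1 + 1))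
      = (μ - (1 : ℕ) - m) * ((μ - (0 : ℕ) - m) * waveCoeff μ m) := by
    intro m
    have r1 := succ_mul_waveCoeff_succ μ m
    have r2 := succ_mul_waveCoeff_succ μ (m + 1)
    rw [r2]
    push_cast
    linear_combination (-(μ - ((m : ℂ) + 1))) * r1
  have hc2 : IsUnitDiscSeq fun m => (μ - (1 : ℕ) - m) * ((μ - (0 : ℕ) - m) * waveCoeff μ m) :=
    (hb.mul_linear (μ - (0 : ℕ))).mul_linear (μ - (1 : ℕ))
  simp only [hco]
  simp only [waveSum]
  rw [← Summable.tsum_finsetSum (fun j _ => summable_waveTerm hμ hc2 2 (hℓ.isTame_X_mul_X j) hx),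
    neg_add_eq_zero]
  refine tsum_congr fun m => ?_
  -- the sum over the space directions brings in the factor `∑ X_j ^ 2`, which `ℓ` does not see
  rw [← Finset.mul_sum, ← map_sum, ← Finset.mul_sum, hℓ.trace, mul_one]

/-- Superpositions of plane waves are eigenfunctions. -/
theorem isHypEigenfunction_waveSum (hℓ : IsSphericalMoment ℓ C) (hμ : μ.re ≤ 0) {lam : ℝ}
    (hlam : μ * (μ + 2 * hypSigma n) = -lam) :
    IsHypEigenfunction lam fun x : HyperbolicSpace n =>
      waveSum μ ℓ (waveCoeff μ) 0 1 x.1.1 x.1.2 := by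
  refine isHypEigenfunction_of_homogeneous (μ := μ)
    (U := fun x : MinkowskiSpace n => waveSum μ ℓ (waveCoeff μ) 0 1 x.1 x.2)
    ((contDiffOn_waveSum hℓ).mono (futureCone_subset n)) (fun x hx t ht => ?_)
    (fun x => dAlembert_waveSum hℓ hμ (futureCone_subset n x.mem_futureCone)) hlam
  simpa using waveSum_smul (μ := μ) (ℓ := ℓ) (waveCoeff μ) hx.1.le ht x.2

end

/-! ### Plane waves and the mean value property -/

/-- For the exponent `μ = -σ + iα`, the relation `μ (μ + 2σ) = -(σ² + α²)` between exponent and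
eigenvalue. -/
theorem waveExponent_mul (n : ℕ) (α : ℝ) :
    (-(hypSigma n : ℂ) + Complex.I * (α : ℂ)) *
      ((-(hypSigma n : ℂ) + Complex.I * (α : ℂ)) + 2 * hypSigma n)
      = -((hypSigma n ^ 2 + α ^ 2 : ℝ) : ℂ) := by
  push_cast
  linear_combination (α : ℂ) ^ 2 * Complex.I_sq

theorem waveExponent_re (n : ℕ) (α : ℝ) :
    (-(hypSigma n : ℂ) + Complex.I * (α : ℂ)).re = -hypSigma n := by
  simp

theorem hypSigma_pos {n : ℕ} (hn : 2 ≤ n) : 0 < hypSigma n := by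
  have : (2 : ℝ) ≤ n := by exact_mod_cast hn
  rw [hypSigma]; linarith

/-- Evaluation of polynomials at a point of the sphere. -/
noncomputable def evalSphere {n : ℕ} (u : Metric.sphere (0 : EuclideanSpace ℝ (Fin n)) 1) :
    MvPolynomial (Fin n) ℂ →ₐ[ℂ] ℂ :=
  MvPolynomial.aeval fun j => (u.1 j : ℂ)

theorem sum_sq_sphere {n : ℕ} (u : Metric.sphere (0 : EuclideanSpace ℝ (Fin n)) 1) :
    ∑ j, u.1 j * u.1 j = 1 := by
  have h := EuclideanSpace.norm_sq_eq u.1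
  rw [norm_eq_of_mem_sphere] at h
  simpa [pow_two] using h.symm

theorem evalSphere_linForm {n : ℕ} (u : Metric.sphere (0 : EuclideanSpace ℝ (Fin n)) 1)
    (v : EuclideanSpace ℝ (Fin n)) : evalSphere u (linForm v) = (⟪v, u.1⟫ : ℝ) := by
  simp only [evalSphere, linForm, map_sum, map_smul, MvPolynomial.aeval_X, smul_eq_mul,
    PiLp.inner_apply]
  push_cast
  exact Finset.sum_congr rfl fun j _ => by simp [mul_comm]

theorem evalSphere_trace {n : ℕ} (u : Metric.sphere (0 : EuclideanSpace ℝ (Fin n)) 1)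
    (p : MvPolynomial (Fin n) ℂ) :
    evalSphere u (p * ∑ j, MvPolynomial.X j * MvPolynomial.X j) = evalSphere u p := by
  have h : evalSphere u (∑ j, MvPolynomial.X j * MvPolynomial.X j) = 1 := by
    simp only [evalSphere, map_sum, map_mul, MvPolynomial.aeval_X]
    exact_mod_cast sum_sq_sphere u
  rw [map_mul, h, mul_one]

/-- The tensor `u ⊗ ⋯ ⊗ u` has norm `1`. -/
theorem sum_norm_sq_evalSphere_prod_X {n : ℕ}
    (u : Metric.sphere (0 : EuclideanSpace ℝ (Fin n)) 1) (m : ℕ) :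
    ∑ i : Fin m → Fin n, ‖evalSphere u (∏ k, MvPolynomial.X (i k))‖ ^ 2 = 1 := by
  classical
  have h : ∀ i : Fin m → Fin n, ‖evalSphere u (∏ k, MvPolynomial.X (i k))‖ ^ 2
      = ∏ k, (u.1 (i k) * u.1 (i k)) := by
    intro i
    simp only [evalSphere, map_prod, MvPolynomial.aeval_X, norm_prod, ← Finset.prod_pow]
    refine Finset.prod_congr rfl fun k _ => ?_
    rw [Complex.norm_real, Real.norm_eq_abs, sq_abs, pow_two]
  simp only [h]
  have := Finset.prod_univ_sum (fun _ : Fin m => (Finset.univ : Finset (Fin n)))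
    fun _ j => u.1 j * u.1 j
  rw [Fintype.piFinset_univ] at this
  rw [← this]
  simp [sum_sq_sphere]

theorem isSphericalMoment_evalSphere {n : ℕ}
    (u : Metric.sphere (0 : EuclideanSpace ℝ (Fin n)) 1) :
    IsSphericalMoment (evalSphere u).toLinearMap 1 where
  trace p := evalSphere_trace u p
  bound m := by
    simp only [AlgHom.toLinearMap_apply]
    rw [sum_norm_sq_evalSphere_prod_X, one_mul]
    have : (0 : ℝ) ≤ m := Nat.cast_nonneg m
    nlinarith
  nonneg := zero_le_one

theorem HyperbolicSpace.norm_lt {n : ℕ} (x : HyperbolicSpace n) : ‖x.1.2‖ < x.1.1 :=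
  futureCone_subset n x.mem_futureCone

/-- The expansion of plane waves into powers of `⟪x', u⟫`. -/
theorem hasSum_planeWave {n : ℕ} (x : HyperbolicSpace n) (α : ℝ)
    (u : Metric.sphere (0 : EuclideanSpace ℝ (Fin n)) 1) {μ : ℂ}
    (hμ : μ = -(hypSigma n : ℂ) + Complex.I * (α : ℂ)) :
    HasSum (fun m : ℕ => waveCoeff μ m * (x.1.1 : ℂ) ^ (μ - m - (0 : ℕ)) *
      evalSphere u (linForm x.1.2 ^ m * 1)) (planeWave x α u) := by
  have h0 : 0 < x.1.1 := x.2.1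
  have h0' : (x.1.1 : ℂ) ≠ 0 := by exact_mod_cast h0.ne'
  have hin : |⟪x.1.2, u.1⟫| < x.1.1 := by
    refine (abs_real_inner_le_norm _ _).trans_lt ?_
    rw [norm_eq_of_mem_sphere, mul_one]
    exact x.norm_lt
  have hz : ‖((⟪x.1.2, u.1⟫ / x.1.1 : ℝ) : ℂ)‖ < 1 := by
    rw [Complex.norm_real, Real.norm_eq_abs, abs_div, abs_of_pos h0]
    exact (div_lt_one h0).2 hin
  have h := (hasSum_waveCoeff μ hz).mul_left ((x.1.1 : ℂ) ^ μ)
  have e1 : (x.1.1 : ℂ) ^ μ * (1 - ((⟪x.1.2, u.1⟫ / x.1.1 : ℝ) : ℂ)) ^ μ = planeWave x α u := by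
    have h1 : (1 : ℂ) - ((⟪x.1.2, u.1⟫ / x.1.1 : ℝ) : ℂ)
        = ((1 - ⟪x.1.2, u.1⟫ / x.1.1 : ℝ) : ℂ) := by push_cast; ring
    have h2 : 0 ≤ 1 - ⟪x.1.2, u.1⟫ / x.1.1 := by
      rw [sub_nonneg, div_le_one h0]
      exact (le_abs_self _).trans hin.le
    rw [h1, ← Complex.mul_cpow_ofReal_nonneg h0.le h2, planeWave, minkowski, ← hμ,
      ← Complex.ofReal_mul]
    congr 2
    field_simp
  rw [e1] at h
  refine h.congr_fun fun m => ?_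
  rw [mul_one, map_pow, evalSphere_linForm, Nat.cast_zero, sub_zero, Complex.cpow_sub _ _ h0',
    Complex.cpow_natCast]
  push_cast
  rw [div_pow]
  field_simp

theorem waveSum_evalSphere {n : ℕ} (x : HyperbolicSpace n) (α : ℝ)
    (u : Metric.sphere (0 : EuclideanSpace ℝ (Fin n)) 1) {μ : ℂ}
    (hμ : μ = -(hypSigma n : ℂ) + Complex.I * (α : ℂ)) :
    waveSum μ (evalSphere u).toLinearMap (waveCoeff μ) 0 1 x.1.1 x.1.2 = planeWave x α u :=
  (hasSum_planeWave x α u hμ).tsum_eq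

theorem isHypEigenfunction_planeWave {n : ℕ} (hn : 2 ≤ n) (α : ℝ)
    (u : Metric.sphere (0 : EuclideanSpace ℝ (Fin n)) 1) :
    IsHypEigenfunction (hypSigma n ^ 2 + α ^ 2) fun x => planeWave x α u := by
  have h := isHypEigenfunction_waveSum (isSphericalMoment_evalSphere u)
    (μ := -(hypSigma n : ℂ) + Complex.I * (α : ℂ))
    (by rw [waveExponent_re]; linarith [hypSigma_pos hn]) (waveExponent_mul n α)
  simpa only [waveSum_evalSphere _ α u rfl] using h

theorem radialExt_clm_comp {n : ℕ} {F G : Type*} [NormedAddCommGroup F] [NormedSpace ℝ F]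
    [NormedAddCommGroup G] [NormedSpace ℝ G] (L : F →L[ℝ] G) (f : HyperbolicSpace n → F) :
    radialExt (fun x => L (f x)) = L ∘ radialExt f := by
  ext x
  by_cases hx : x ∈ futureCone n <;> simp [radialExt, hx]

theorem IsHypEigenfunction.clm_comp {n : ℕ} {F G : Type*} [NormedAddCommGroup F] [NormedSpace ℝ F]
    [NormedAddCommGroup G] [NormedSpace ℝ G] {lam : ℝ} {f : HyperbolicSpace n → F}
    (hf : IsHypEigenfunction lam f) (L : F →L[ℝ] G) :
    IsHypEigenfunction lam fun x => L (f x) := by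
  refine ⟨?_, fun x => ?_⟩
  · rw [HypSmooth, radialExt_clm_comp]
    exact L.contDiff.comp_contDiffOn hf.smooth
  · have h := congrArg L (hf.eigen x)
    rw [map_add, map_smul, map_zero] at h
    rw [← h]
    congr 1
    have hd : ContDiffAt ℝ ((⊤ : ℕ∞) : WithTop ℕ∞) (radialExt f) x.1 :=
      hf.smooth.contDiffAt x.mem_futureCone
    simp only [hypLaplacian, dAlembert, radialExt_clm_comp]
    have h2 : iteratedFDeriv ℝ 2 (L ∘ radialExt f) x.1
        = L.compContinuousMultilinearMap (iteratedFDeriv ℝ 2 (radialExt f) x.1) :=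
      L.iteratedFDeriv_comp_left hd (WithTop.coe_le_coe.2 le_top)
    rw [h2]
    simp

/-- The base point of hyperbolic space. -/
noncomputable def hypOrigin (n : ℕ) : HyperbolicSpace n := hypPoint 0

theorem hypOrigin_val (n : ℕ) : (hypOrigin n).1 = (1, 0) := by
  simp [hypOrigin, hypPoint]

theorem hypPolar_zero {n : ℕ} (u : Metric.sphere (0 : EuclideanSpace ℝ (Fin n)) 1) :
    hypPolar 0 u = hypOrigin n := by
  apply Subtype.ext
  rw [hypOrigin_val]
  simp [hypPolar]

theorem minkowski_hypOrigin {n : ℕ} (x : MinkowskiSpace n) : minkowski (hypOrigin n).1 x = x.1 := by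
  rw [hypOrigin_val]; simp [minkowski]

theorem planeWave_hypOrigin {n : ℕ} (α : ℝ)
    (u : Metric.sphere (0 : EuclideanSpace ℝ (Fin n)) 1) : planeWave (hypOrigin n) α u = 1 := by
  rw [planeWave, minkowski_hypOrigin]; simp

theorem sphericalMean_zero {n : ℕ} (hn : 1 ≤ n) (f : HyperbolicSpace n → ℝ) :
    sphericalMean f 0 = f (hypOrigin n) := by
  have := isProbabilityMeasure_uniformSphere hn
  simp [sphericalMean, hypPolar_zero]

theorem sphericalFunction_eq_integral_planeWave {n : ℕ} (hn : 2 ≤ n) (α r : ℝ)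
    (u : Metric.sphere (0 : EuclideanSpace ℝ (Fin n)) 1) :
    sphericalFunction n α r = ∫ v, planeWave (hypPolar r v) α u ∂uniformSphere n := by
  rw [sphericalFunction_eq_integral hn (norm_eq_of_mem_sphere u)]
  refine integral_congr_ae (Eventually.of_forall fun v => ?_)
  simp only [planeWave, minkowski, hypPolar, mul_one, real_inner_smul_left, real_inner_comm u.1 v.1]

theorem exists_mem_sphere {n : ℕ} (hn : 1 ≤ n) :
    Nonempty (Metric.sphere (0 : EuclideanSpace ℝ (Fin n)) 1) :=
  ⟨⟨EuclideanSpace.single ⟨0, hn⟩ 1, by simp⟩⟩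

theorem continuous_planeWave_hypPolar {n : ℕ} (α r : ℝ)
    (u : Metric.sphere (0 : EuclideanSpace ℝ (Fin n)) 1) :
    Continuous fun v => planeWave (hypPolar r v) α u := by
  refine Continuous.cpow ?_ continuous_const fun v =>
    Or.inl (by simpa using minkowski_lightlike_pos (hypPolar r v) u)
  unfold minkowski hypPolar
  fun_prop

section

variable {n : ℕ} {α lam : ℝ}

theorem eigenvalue_pos (hn : 2 ≤ n) (hlam : lam = hypSigma n ^ 2 + α ^ 2) : 0 < lam := by
  have := hypSigma_pos hn
  rw [hlam]; positivity

/-- The mean value property: the spherical means of an eigenfunction are multiples of those of a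
plane wave, as both solve the radial equation. -/
theorem sphericalMean_eq_mul (hn : 2 ≤ n) (hlam : lam = hypSigma n ^ 2 + α ^ 2)
    {f : HyperbolicSpace n → ℝ} (hf : IsHypEigenfunction lam f) {r : ℝ} (hr : 0 ≤ r) :
    sphericalMean f r = f (hypOrigin n) * (sphericalFunction n α r).re := by
  have hn1 : 1 ≤ n := by omega
  obtain ⟨u⟩ := exists_mem_sphere hn1
  have he := (isHypEigenfunction_planeWave hn α u).clm_comp Complex.reCLM
  rw [← hlam] at he
  have h := (isRadialSolution_sphericalMean hf).mul_eq_mul hn1 (eigenvalue_pos hn hlam)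
    (isRadialSolution_sphericalMean he) hr
  rw [sphericalMean_zero hn1, sphericalMean_zero hn1, planeWave_hypOrigin] at h
  have h2 : sphericalMean (fun x => Complex.reCLM (planeWave x α u)) r
      = (sphericalFunction n α r).re := by
    rw [sphericalFunction_eq_integral_planeWave hn α r u, sphericalMean]
    exact Complex.reCLM.integral_comp_comm
      (integrable_uniformSphere (continuous_planeWave_hypPolar α r u))
  rw [h2] at h
  simpa [mul_comm] using h

/-- The imaginary part of a plane wave is an eigenfunction that vanishes at the origin, so its
spherical means vanish. -/
theorem sphericalFunction_im (hn : 2 ≤ n) {r : ℝ} (hr : 0 ≤ r) :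
    (sphericalFunction n α r).im = 0 := by
  have hn1 : 1 ≤ n := by omega
  obtain ⟨u⟩ := exists_mem_sphere hn1
  have he := (isHypEigenfunction_planeWave hn α u).clm_comp Complex.imCLM
  have h := sphericalMean_eq_mul hn rfl he hr
  rw [planeWave_hypOrigin] at h
  rw [sphericalFunction_eq_integral_planeWave hn α r u]
  have h2 := Complex.imCLM.integral_comp_comm
    (integrable_uniformSphere (continuous_planeWave_hypPolar α r u))
  refine Eq.trans h2.symm (h.trans ?_)
  simp

theorem sphericalFunction_zero (hn : 2 ≤ n) : sphericalFunction n α 0 = 1 := by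
  have := isProbabilityMeasure_uniformSphere (n := n) (by omega)
  obtain ⟨u⟩ := exists_mem_sphere (n := n) (by omega)
  rw [sphericalFunction_eq_integral_planeWave hn α 0 u]
  simp [hypPolar_zero, planeWave_hypOrigin]

end

/-! ### Isometries of hyperbolic space -/

section

variable {n : ℕ}

theorem minkowski_comm (x y : MinkowskiSpace n) : minkowski x y = minkowski y x := by
  simp only [minkowski, real_inner_comm x.2 y.2, mul_comm]

theorem minkowski_pos (x y : HyperbolicSpace n) : 0 < minkowski x.1 y.1 := by
  have h := real_inner_le_norm x.1.2 y.1.2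
  have hx := x.norm_lt
  have hy := y.norm_lt
  have : ‖x.1.2‖ * ‖y.1.2‖ < x.1.1 * y.1.1 := by
    nlinarith [norm_nonneg x.1.2, norm_nonneg y.1.2]
  rw [minkowski]; linarith

theorem hypDist_hypOrigin_hypPolar {r : ℝ} (hr : 0 ≤ r)
    (u : Metric.sphere (0 : EuclideanSpace ℝ (Fin n)) 1) :
    hypDist (hypOrigin n) (hypPolar r u) = r := by
  rw [hypDist, minkowski_hypOrigin]
  exact Real.arcosh_cosh hr

theorem hypDist_comm (x y : HyperbolicSpace n) : hypDist x y = hypDist y x := by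
  rw [hypDist, minkowski_comm, hypDist]

theorem exists_hypPolar_eq (hn : 1 ≤ n) (x : HyperbolicSpace n) :
    ∃ r : ℝ, 0 ≤ r ∧ ∃ u, hypPolar r u = x := by
  have hsq : x.1.1 ^ 2 = 1 + ‖x.1.2‖ ^ 2 := by
    have := x.2.2
    rw [minkowski, real_inner_self_eq_norm_sq] at this
    linarith
  have hsh : Real.sinh (Real.arsinh ‖x.1.2‖) = ‖x.1.2‖ := Real.sinh_arsinh _
  have hch : Real.cosh (Real.arsinh ‖x.1.2‖) = x.1.1 := by
    refine (sq_eq_sq₀ (Real.cosh_pos _).le x.2.1.le).1 ?_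
    rw [Real.cosh_sq, hsh, hsq]; ring
  refine ⟨Real.arsinh ‖x.1.2‖, Real.arsinh_nonneg_iff.2 (norm_nonneg _), ?_⟩
  by_cases h0 : x.1.2 = 0
  · obtain ⟨u⟩ := exists_mem_sphere hn
    refine ⟨u, Subtype.ext (Prod.ext hch ?_)⟩
    simp only [hypPolar]
    rw [hsh, h0]; simp
  · refine ⟨⟨‖x.1.2‖⁻¹ • x.1.2, by simp [norm_smul, h0]⟩, Subtype.ext (Prod.ext hch ?_)⟩
    simp only [hypPolar]
    rw [hsh, smul_smul, mul_inv_cancel₀ (norm_ne_zero_iff.2 h0), one_smul]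

theorem isHypIsometry_of_minkowski {g : HyperbolicSpace n ≃ HyperbolicSpace n}
    (hg : ∀ x y, minkowski (g x).1 (g y).1 = minkowski x.1 y.1) : IsHypIsometry g := fun x y => by
  rw [hypDist, hg, hypDist]

/-- The rotation of hyperbolic space about the origin induced by a linear isometry. -/
noncomputable def hypRotation (R : EuclideanSpace ℝ (Fin n) ≃ₗᵢ[ℝ] EuclideanSpace ℝ (Fin n)) :
    HyperbolicSpace n ≃ HyperbolicSpace n where
  toFun x := ⟨(x.1.1, R x.1.2), x.2.1, by
    have := x.2.2
    simp only [minkowski, R.inner_map_map] at this ⊢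
    exact this⟩
  invFun x := ⟨(x.1.1, R.symm x.1.2), x.2.1, by
    have := x.2.2
    simp only [minkowski, R.symm.inner_map_map] at this ⊢
    exact this⟩
  left_inv x := Subtype.ext (by simp)
  right_inv x := Subtype.ext (by simp)

theorem isHypIsometry_hypRotation
    (R : EuclideanSpace ℝ (Fin n) ≃ₗᵢ[ℝ] EuclideanSpace ℝ (Fin n)) :
    IsHypIsometry (hypRotation R) :=
  isHypIsometry_of_minkowski fun x y => by
    change x.1.1 * y.1.1 - ⟪R x.1.2, R y.1.2⟫ = x.1.1 * y.1.1 - ⟪x.1.2, y.1.2⟫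
    rw [R.inner_map_map]

theorem hypRotation_hypOrigin (R : EuclideanSpace ℝ (Fin n) ≃ₗᵢ[ℝ] EuclideanSpace ℝ (Fin n)) :
    hypRotation R (hypOrigin n) = hypOrigin n := by
  apply Subtype.ext
  change ((hypOrigin n).1.1, R (hypOrigin n).1.2) = _
  rw [hypOrigin_val, map_zero]

/-- Rotations act transitively on the geodesic spheres about the origin; the reflection that
exchanges two directions will do. -/
theorem exists_hypRotation_hypPolar (u v : Metric.sphere (0 : EuclideanSpace ℝ (Fin n)) 1) :
    ∃ R : EuclideanSpace ℝ (Fin n) ≃ₗᵢ[ℝ] EuclideanSpace ℝ (Fin n),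
      ∀ r, hypRotation R (hypPolar r u) = hypPolar r v := by
  refine ⟨(ℝ ∙ (u.1 - v.1))ᗮ.reflection, fun r => Subtype.ext (Prod.ext rfl ?_)⟩
  change (ℝ ∙ (u.1 - v.1))ᗮ.reflection (Real.sinh r • u.1) = Real.sinh r • v.1
  rw [map_smul, Submodule.reflection_sub (by simp)]

theorem minkowski_add_left (x y z : MinkowskiSpace n) :
    minkowski (x + y) z = minkowski x z + minkowski y z := by
  simp only [minkowski, Prod.fst_add, Prod.snd_add, inner_add_left]; ring

theorem minkowski_smul_left (t : ℝ) (x y : MinkowskiSpace n) :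
    minkowski (t • x) y = t * minkowski x y := by
  have := minkowski_smul_smul t 1 x y
  simpa using this

/-- The reflection `y ↦ 2 [y, w] / [w, w] w - y` with `w = p + o`, which exchanges `p` with the
origin `o`, on the ambient space. -/
noncomputable def swapLin (p : HyperbolicSpace n) (y : MinkowskiSpace n) : MinkowskiSpace n :=
  (minkowski y (p.1 + (hypOrigin n).1) / (1 + p.1.1)) • (p.1 + (hypOrigin n).1) + (-1 : ℝ) • y

theorem minkowski_add_hypOrigin (p : HyperbolicSpace n) :
    minkowski (p.1 + (hypOrigin n).1) (p.1 + (hypOrigin n).1) = 2 * (1 + p.1.1) := by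
  have e1 : minkowski p.1 (hypOrigin n).1 = p.1.1 := by
    rw [minkowski_comm, minkowski_hypOrigin]
  have e2 : minkowski (hypOrigin n).1 (hypOrigin n).1 = 1 := (hypOrigin n).2.2
  rw [minkowski_add_left, minkowski_comm p.1, minkowski_comm (hypOrigin n).1 (p.1 + _),
    minkowski_add_left, minkowski_add_left, p.2.2, e1, e2, minkowski_hypOrigin]
  ring

theorem minkowski_swapLin (p : HyperbolicSpace n) (y z : MinkowskiSpace n) :
    minkowski (swapLin p y) (swapLin p z) = minkowski y z := by
  have hp : 1 + p.1.1 ≠ 0 := by have := p.2.1; positivity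
  have hww := minkowski_add_hypOrigin p
  rw [swapLin, swapLin]
  generalize p.1 + (hypOrigin n).1 = w at hww ⊢
  have hexp : ∀ s t : ℝ, minkowski (s • w + (-1 : ℝ) • y) (t • w + (-1 : ℝ) • z)
      = s * t * minkowski w w - s * minkowski z w - t * minkowski y w + minkowski y z := by
    intro s t
    simp only [minkowski, Prod.fst_add, Prod.smul_fst, Prod.snd_add, Prod.smul_snd, smul_eq_mul,
      inner_add_left, inner_add_right, real_inner_smul_left, real_inner_smul_right,
      real_inner_comm w.2 z.2]
    ring
  rw [hexp, hww]
  field_simp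
  ring

theorem swapLin_swapLin (p : HyperbolicSpace n) (y : MinkowskiSpace n) :
    swapLin p (swapLin p y) = y := by
  have hp : 1 + p.1.1 ≠ 0 := by have := p.2.1; positivity
  have hww := minkowski_add_hypOrigin p
  conv_lhs => rw [swapLin]
  have h : minkowski (swapLin p y) (p.1 + (hypOrigin n).1)
      = minkowski y (p.1 + (hypOrigin n).1) := by
    rw [swapLin, minkowski_add_left, minkowski_smul_left, minkowski_smul_left, hww]
    field_simp
    ring
  rw [h, swapLin]
  module

theorem swapLin_hypOrigin (p : HyperbolicSpace n) : swapLin p (hypOrigin n).1 = p.1 := by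
  have hp : 1 + p.1.1 ≠ 0 := by have := p.2.1; positivity
  have e : minkowski (hypOrigin n).1 (p.1 + (hypOrigin n).1) = 1 + p.1.1 := by
    rw [minkowski_hypOrigin, hypOrigin_val, Prod.fst_add]; ring
  rw [swapLin, e, div_self hp]
  module

theorem swapLin_fst_pos (p y : HyperbolicSpace n) : 0 < (swapLin p y.1).1 := by
  have h := minkowski_pos p y
  rw [← swapLin_hypOrigin p] at h
  rw [← swapLin_swapLin p y.1, minkowski_swapLin, minkowski_hypOrigin] at h
  exact h

/-- The isometric involution of hyperbolic space that exchanges `p` with the origin. -/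
noncomputable def hypSwap (p : HyperbolicSpace n) : HyperbolicSpace n ≃ HyperbolicSpace n where
  toFun y := ⟨swapLin p y.1, swapLin_fst_pos p y, by rw [minkowski_swapLin]; exact y.2.2⟩
  invFun y := ⟨swapLin p y.1, swapLin_fst_pos p y, by rw [minkowski_swapLin]; exact y.2.2⟩
  left_inv y := Subtype.ext (swapLin_swapLin p y.1)
  right_inv y := Subtype.ext (swapLin_swapLin p y.1)

theorem isHypIsometry_hypSwap (p : HyperbolicSpace n) : IsHypIsometry (hypSwap p) :=
  isHypIsometry_of_minkowski fun y z => minkowski_swapLin p y.1 z.1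

theorem hypSwap_self (p : HyperbolicSpace n) : hypSwap p p = hypOrigin n := by
  apply Subtype.ext
  change swapLin p p.1 = _
  conv_lhs => rw [← swapLin_hypOrigin p]
  exact swapLin_swapLin p _

end

/-! ### The reproducing kernel of the plane waves -/

theorem hasDerivAt_cpow_mul_cpow {A B : ℝ → ℝ} {A' B' t : ℝ} (hA : HasDerivAt A A' t)
    (hB : HasDerivAt B B' t) (hA0 : 0 < A t) (hB0 : 0 < B t) (μ ν : ℂ) :
    HasDerivAt (fun s => (A s : ℂ) ^ μ * (B s : ℂ) ^ ν)
      (μ * (A t : ℂ) ^ (μ - 1) * A' * (B t : ℂ) ^ ν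
        + (A t : ℂ) ^ μ * (ν * (B t : ℂ) ^ (ν - 1) * B')) t := by
  have key : ∀ {C : ℝ → ℝ} {C' : ℝ} (_ : HasDerivAt C C' t) (_ : 0 < C t) (z : ℂ),
      HasDerivAt (fun s => (C s : ℂ) ^ z) (z * (C t : ℂ) ^ (z - 1) * C') t := by
    intro C C' hC hC0 z
    have := (hasDerivAt_ofReal_cpow hC0 z).scomp t hC
    simpa [Function.comp_def, mul_comm] using this
  exact (key hA hA0 μ).fun_mul (key hB hB0 ν)

theorem Complex.ofReal_cpow_sub_one_mul {A : ℝ} (hA : 0 < A) (μ : ℂ) :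
    (A : ℂ) ^ (μ - 1) * A = (A : ℂ) ^ μ := by
  have hA' : (A : ℂ) ≠ 0 := by exact_mod_cast hA.ne'
  rw [Complex.cpow_sub _ _ hA', Complex.cpow_one, div_mul_cancel₀ _ hA']

section

variable {n : ℕ}

/-- The Lorentz boost with rapidity `t` in the direction `a`. -/
noncomputable def boostLin (a : EuclideanSpace ℝ (Fin n)) (t : ℝ) (z : MinkowskiSpace n) :
    MinkowskiSpace n :=
  (Real.cosh t * z.1 + Real.sinh t * ⟪a, z.2⟫,
    z.2 + ((Real.cosh t - 1) * ⟪a, z.2⟫ + Real.sinh t * z.1) • a)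

/-- Boosts preserve the Minkowski form. -/
theorem minkowski_boostLin {a : EuclideanSpace ℝ (Fin n)} (ha : ‖a‖ = 1) (t : ℝ)
    (z w : MinkowskiSpace n) : minkowski (boostLin a t z) (boostLin a t w) = minkowski z w := by
  have haa : ⟪a, a⟫ = (1 : ℝ) := by rw [real_inner_self_eq_norm_sq, ha, one_pow]
  simp only [minkowski, boostLin, inner_add_left, inner_add_right, real_inner_smul_left,
    real_inner_smul_right, haa, real_inner_comm a z.2]
  linear_combination (z.1 * w.1 - ⟪a, z.2⟫ * ⟪a, w.2⟫) * Real.cosh_sq_sub_sinh_sq t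

theorem boostLin_fst_pos {a : EuclideanSpace ℝ (Fin n)} (ha : ‖a‖ = 1) (t : ℝ)
    (x : HyperbolicSpace n) : 0 < (boostLin a t x.1).1 := by
  have h1 : |⟪a, x.1.2⟫| < x.1.1 := by
    refine (abs_real_inner_le_norm _ _).trans_lt ?_
    rw [ha, one_mul]; exact x.norm_lt
  have h2 : |Real.sinh t| ≤ Real.cosh t := abs_le.2
    ⟨by linarith [Real.exp_pos t, Real.cosh_add_sinh t], (Real.sinh_lt_cosh t).le⟩
  have h3 : |Real.sinh t * ⟪a, x.1.2⟫| < Real.cosh t * x.1.1 := by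
    rw [abs_mul]
    nlinarith [abs_nonneg (Real.sinh t), abs_nonneg ⟪a, x.1.2⟫, Real.cosh_pos t]
  have h4 := (abs_lt.1 h3).1
  simp only [boostLin]
  linarith

/-- The Lorentz boost as a map of hyperbolic space, a translation along a geodesic through the
origin. -/
noncomputable def hypBoost {a : EuclideanSpace ℝ (Fin n)} (ha : ‖a‖ = 1) (t : ℝ)
    (x : HyperbolicSpace n) : HyperbolicSpace n :=
  ⟨boostLin a t x.1, boostLin_fst_pos ha t x, by rw [minkowski_boostLin ha]; exact x.2.2⟩

theorem hypDist_hypBoost {a : EuclideanSpace ℝ (Fin n)} (ha : ‖a‖ = 1) (t : ℝ)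
    (x y : HyperbolicSpace n) : hypDist (hypBoost ha t x) (hypBoost ha t y) = hypDist x y := by
  unfold hypDist hypBoost
  rw [minkowski_boostLin ha]

theorem hypBoost_zero {a : EuclideanSpace ℝ (Fin n)} (ha : ‖a‖ = 1) (x : HyperbolicSpace n) :
    hypBoost ha 0 x = x :=
  Subtype.ext (Prod.ext (by simp [hypBoost, boostLin]) (by simp [hypBoost, boostLin]))

theorem hypBoost_neg_hypPolar (u : Metric.sphere (0 : EuclideanSpace ℝ (Fin n)) 1) (r : ℝ) :
    hypBoost (norm_eq_of_mem_sphere u) (-r) (hypPolar r u) = hypOrigin n := by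
  have huu : ⟪u.1, u.1⟫ = (1 : ℝ) := by
    rw [real_inner_self_eq_norm_sq, norm_eq_of_mem_sphere, one_pow]
  have h := Real.cosh_sq_sub_sinh_sq r
  apply Subtype.ext
  rw [hypOrigin_val]
  simp only [hypBoost, boostLin, hypPolar, real_inner_smul_right, huu, Real.cosh_neg,
    Real.sinh_neg, mul_one]
  refine Prod.ext ?_ ?_
  · linear_combination h
  · rw [← add_smul, show Real.sinh r + ((Real.cosh r - 1) * Real.sinh r
      + -Real.sinh r * Real.cosh r) = 0 by ring, zero_smul]

/-- The derivative in `t` of `[B_t z, (1, u)]` for the boosts `B_t` in the direction `a`, expressed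
at the point `B_t z`. -/
theorem hasDerivAt_minkowski_boostLin {a : EuclideanSpace ℝ (Fin n)} (ha : ‖a‖ = 1)
    (z : MinkowskiSpace n) (u : EuclideanSpace ℝ (Fin n)) (t : ℝ) :
    HasDerivAt (fun s => minkowski (boostLin a s z) (1, u))
      (⟪a, (boostLin a t z).2⟫ - (boostLin a t z).1 * ⟪a, u⟫) t := by
  have haa : ⟪a, a⟫ = (1 : ℝ) := by rw [real_inner_self_eq_norm_sq, ha, one_pow]
  simp only [minkowski, boostLin, inner_add_left, inner_add_right, real_inner_smul_left,
    real_inner_smul_right, haa, mul_one]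
  have hc := Real.hasDerivAt_cosh t
  have hs := Real.hasDerivAt_sinh t
  have h1 := (hc.mul_const z.1).fun_add (hs.mul_const ⟪a, z.2⟫)
  have h2 := (((((hc.sub_const 1).mul_const ⟪a, z.2⟫).fun_add (hs.mul_const z.1)).mul_const
    ⟪a, u⟫).const_add ⟪z.2, u⟫)
  refine (h1.fun_sub h2).congr_deriv ?_
  ring

theorem continuous_boostLin (a : EuclideanSpace ℝ (Fin n)) (z : MinkowskiSpace n) :
    Continuous fun t => boostLin a t z := by
  unfold boostLin
  fun_prop

/-- Along the boosts in the direction `a`, the product `h` of two powers whose exponents add up to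
`-(n - 1)` changes by `-V h + (n - 1) ⟪a, ·⟫ h`, where `V` is the conformal field
`a - ⟪a, u⟫ u`; the integral of this over the sphere vanishes by the divergence theorem. -/
theorem hasDerivAt_integral_boost {a : EuclideanSpace ℝ (Fin n)} (ha : ‖a‖ = 1) {μ ν : ℂ}
    (hμν : μ + ν = -((n : ℝ) - 1 : ℝ)) (x y : HyperbolicSpace n) (t : ℝ) :
    HasDerivAt (fun s => ∫ u, ((minkowski (boostLin a s x.1) (1, u.1) : ℝ) : ℂ) ^ μ *
      ((minkowski (boostLin a s y.1) (1, u.1) : ℝ) : ℂ) ^ ν ∂uniformSphere n) 0 t := by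
  let S := Metric.sphere (0 : EuclideanSpace ℝ (Fin n)) 1
  let A : HyperbolicSpace n → ℝ → S → ℝ := fun x s u => minkowski (boostLin a s x.1) (1, u.1)
  let A' : HyperbolicSpace n → ℝ → S → ℝ := fun x s u =>
    ⟪a, (boostLin a s x.1).2⟫ - (boostLin a s x.1).1 * ⟪a, u.1⟫
  have hApos : ∀ x s u, 0 < A x s u := fun x s u => minkowski_lightlike_pos (hypBoost ha s x) u
  have hAd : ∀ x s u, HasDerivAt (fun s => A x s u) (A' x s u) s := fun x s u =>
    hasDerivAt_minkowski_boostLin ha x.1 u.1 s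
  have hAc : ∀ x, Continuous fun p : ℝ × S => A x p.1 p.2 := fun x => by
    have := (continuous_boostLin a x.1).comp (continuous_fst (X := ℝ) (Y := S))
    simp only [A, minkowski]
    fun_prop
  have hA'c : ∀ x, Continuous fun p : ℝ × S => A' x p.1 p.2 := fun x => by
    have := (continuous_boostLin a x.1).comp (continuous_fst (X := ℝ) (Y := S))
    simp only [A']
    fun_prop
  have hpow : ∀ x (z : ℂ), Continuous fun p : ℝ × S => (A x p.1 p.2 : ℂ) ^ z := fun x z =>
    (Complex.continuous_ofReal.comp (hAc x)).cpow continuous_const fun p =>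
      Or.inl (by simpa using hApos x p.1 p.2)
  let G : ℝ → S → ℂ := fun s u => (A x s u : ℂ) ^ μ * (A y s u : ℂ) ^ ν
  let G' : ℝ → S → ℂ := fun s u => μ * (A x s u : ℂ) ^ (μ - 1) * A' x s u * (A y s u : ℂ) ^ ν
        + (A x s u : ℂ) ^ μ * (ν * (A y s u : ℂ) ^ (ν - 1) * A' y s u)
  have hGc : Continuous fun p : ℝ × S => G p.1 p.2 := (hpow x μ).mul (hpow y ν)
  have hG'c : Continuous fun p : ℝ × S => G' p.1 p.2 :=
    (((continuous_const.mul (hpow x (μ - 1))).mul (Complex.continuous_ofReal.comp (hA'c x))).mul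
      (hpow y ν)).add ((hpow x μ).mul ((continuous_const.mul (hpow y (ν - 1))).mul
        (Complex.continuous_ofReal.comp (hA'c y))))
  have hslice : ∀ F : ℝ → S → ℂ, Continuous (fun p : ℝ × S => F p.1 p.2) →
      ∀ s, Continuous (F s) := fun F hF s =>
    hF.comp (by fun_prop : Continuous fun u : S => ((s, u) : ℝ × S))
  have hmain := hasDerivAt_integral_of_continuousOn (μ := uniformSphere n) isOpen_univ (mem_univ t)
    (G := G) (G' := G')
    (fun s _ u => hasDerivAt_cpow_mul_cpow (hAd x s u) (hAd y s u) (hApos x s u) (hApos y s u) μ ν)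
    (fun s _ => hslice G hGc s) hG'c.continuousOn
  -- it remains to see that the integral of the derivative vanishes; `h` extends the integrand from
  -- the sphere to a neighbourhood
  refine hmain.congr_deriv ?_
  set z := boostLin a t x.1 with hz
  set w := boostLin a t y.1 with hw
  let lin : MinkowskiSpace n → EuclideanSpace ℝ (Fin n) → ℝ := fun z v => z.1 - ⟪z.2, v⟫
  have hlin : ∀ z, ContDiff ℝ 1 (lin z) := fun z => by
    exact contDiff_const.sub (innerSL ℝ z.2).contDiff
  let h : EuclideanSpace ℝ (Fin n) → ℂ := fun v => (lin z v : ℂ) ^ μ * (lin w v : ℂ) ^ ν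
  let U : Set (EuclideanSpace ℝ (Fin n)) := {v | 0 < lin z v} ∩ {v | 0 < lin w v}
  have hU : IsOpen U := (isOpen_lt continuous_const (hlin z).continuous).inter
    (isOpen_lt continuous_const (hlin w).continuous)
  have hval : ∀ u : S, lin z u.1 = A x t u ∧ lin w u.1 = A y t u := fun u => by
    simp [lin, A, minkowski, hz, hw]
  have hSU : Metric.sphere (0 : EuclideanSpace ℝ (Fin n)) 1 ⊆ U := fun v hv =>
    ⟨((hval ⟨v, hv⟩).1 ▸ hApos x t ⟨v, hv⟩ : 0 < lin z v),
      ((hval ⟨v, hv⟩).2 ▸ hApos y t ⟨v, hv⟩ : 0 < lin w v)⟩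
  have hpowd : ∀ (z : MinkowskiSpace n) (ζ : ℂ), ContDiffOn ℝ 1 (fun v => (lin z v : ℂ) ^ ζ)
      {v | 0 < lin z v} := by
    intro z ζ
    refine ContDiffOn.congr (f := fun v => Complex.exp (Real.log (lin z v) * ζ)) ?_ ?_
    · refine ContDiffOn.cexp (ContDiffOn.mul ?_ contDiffOn_const)
      exact Complex.ofRealCLM.contDiff.comp_contDiffOn
        ((hlin z).contDiffOn.log fun v hv => (ne_of_gt hv))
    · intro v hv
      have hv : 0 < lin z v := hv
      rw [Complex.cpow_def_of_ne_zero (by exact_mod_cast hv.ne'), Complex.ofReal_log hv.le]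
  have hh : ContDiffOn ℝ 1 h U :=
    ((hpowd z μ).mono inter_subset_left).mul ((hpowd w ν).mono inter_subset_right)
  have hdiv := integral_fderiv_tangent hU hSU hh a
  have hfd : ∀ u : S, fderiv ℝ h u.1 (a - ⟪a, u.1⟫ • u.1)
      = -G' t u + ((n : ℝ) - 1) • (⟪a, u.1⟫ • G t u) := by
    intro u
    set e := a - ⟪a, u.1⟫ • u.1 with he
    have hline : HasDerivAt (fun s : ℝ => u.1 + s • e) e 0 := by
      simpa using ((hasDerivAt_id (0 : ℝ)).smul_const e).const_add u.1
    have hfh : HasFDerivAt h (fderiv ℝ h u.1) (u.1 + (0 : ℝ) • e) := by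
      rw [zero_smul, add_zero]
      exact ((hh.contDiffAt (hU.mem_nhds (hSU u.2))).differentiableAt one_ne_zero).hasFDerivAt
    have hcomp : ∀ {H : EuclideanSpace ℝ (Fin n) → ℂ} {L : EuclideanSpace ℝ (Fin n) →L[ℝ] ℂ},
        HasFDerivAt H L (u.1 + (0 : ℝ) • e) → HasDerivAt (fun s : ℝ => H (u.1 + s • e)) (L e) 0 :=
      fun hH => hH.comp_hasDerivAt (0 : ℝ) hline
    have h1 : HasDerivAt (fun s : ℝ => h (u.1 + s • e)) (fderiv ℝ h u.1 e) 0 := hcomp hfh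
    have hld : ∀ z : MinkowskiSpace n, HasDerivAt (fun s : ℝ => lin z (u.1 + s • e))
        (-⟪z.2, e⟫) 0 := by
      intro z
      have : (fun s : ℝ => lin z (u.1 + s • e)) = fun s => lin z u.1 - s * ⟪z.2, e⟫ := by
        ext s
        simp only [lin, inner_add_right, real_inner_smul_right]; ring
      rw [this]
      simpa using ((hasDerivAt_id (0 : ℝ)).mul_const ⟪z.2, e⟫).const_sub (lin z u.1)
    have h0 : u.1 + (0 : ℝ) • e = u.1 := by simp
    have h2 := hasDerivAt_cpow_mul_cpow (hld z) (hld w)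
      (by rw [h0, (hval u).1]; exact hApos x t u) (by rw [h0, (hval u).2]; exact hApos y t u) μ ν
    rw [h1.unique h2, h0, (hval u).1, (hval u).2]
    -- the derivative of `[z, (1, ·)]` along the conformal field, in terms of the derivative along
    -- the boost
    have hv1 : -⟪z.2, e⟫ = -A' x t u - ⟪a, u.1⟫ * A x t u := by
      simp only [A', A, minkowski, ← hz, he, inner_sub_right, real_inner_smul_right,
        real_inner_comm a z.2]
      ring
    have hv2 : -⟪w.2, e⟫ = -A' y t u - ⟪a, u.1⟫ * A y t u := by
      simp only [A', A, minkowski, ← hw, he, inner_sub_right, real_inner_smul_right,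
        real_inner_comm a w.2]
      ring
    rw [hv1, hv2]
    have p1 := Complex.ofReal_cpow_sub_one_mul (hApos x t u) μ
    have p2 := Complex.ofReal_cpow_sub_one_mul (hApos y t u) ν
    simp only [G, G', Complex.real_smul]
    push_cast at hμν ⊢
    linear_combination (-μ * ⟪a, u.1⟫ * (A y t u : ℂ) ^ ν) * p1
      - (ν * ⟪a, u.1⟫ * (A x t u : ℂ) ^ μ) * p2
      - (⟪a, u.1⟫ * (A x t u : ℂ) ^ μ * (A y t u : ℂ) ^ ν) * hμν
  have hGu : Continuous (G t) := hslice G hGc t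
  have hG'u : Continuous (G' t) := hslice G' hG'c t
  have hau : Continuous fun u : S => ⟪a, u.1⟫ := by fun_prop
  simp only [hfd] at hdiv
  have hhG : ∀ u : S, h u.1 = G t u := fun u => by
    simp only [h, G, (hval u).1, (hval u).2]
  simp only [hhG] at hdiv
  have i1 : Integrable (fun u => -G' t u) (uniformSphere n) := integrable_uniformSphere hG'u.neg
  have i2 : Integrable (fun u => ((n : ℝ) - 1) • ⟪a, u.1⟫ • G t u) (uniformSphere n) :=
    (integrable_uniformSphere (hau.smul hGu)).smul ((n : ℝ) - 1)
  rw [integral_add i1 i2, integral_neg, integral_smul] at hdiv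
  exact neg_eq_zero.1 (add_eq_right.1 hdiv)

/-- The reproducing kernel of the plane waves is the spherical function of the distance. -/
theorem integral_planeWave_mul_conj (hn : 2 ≤ n) (α : ℝ) (x y : HyperbolicSpace n) :
    ∫ u, planeWave x α u * (starRingEnd ℂ) (planeWave y α u) ∂uniformSphere n
      = sphericalFunction n α (hypDist x y) := by
  have hn1 : 1 ≤ n := by omega
  set μ : ℂ := -(hypSigma n : ℂ) + Complex.I * (α : ℂ) with hμ
  have hconj : ∀ (y : HyperbolicSpace n) u, (starRingEnd ℂ) (planeWave y α u)
      = ((minkowski y.1 (1, u.1) : ℝ) : ℂ) ^ (starRingEnd ℂ) μ := by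
    intro y u
    rw [planeWave, ← hμ, Complex.cpow_conj, Complex.conj_ofReal]
    rw [Complex.arg_ofReal_of_nonneg (minkowski_lightlike_pos y u).le]
    exact Real.pi_pos.ne
  have hμν : μ + (starRingEnd ℂ) μ = -((n : ℝ) - 1 : ℝ) := by
    rw [Complex.add_conj, hμ, waveExponent_re, hypSigma]
    push_cast; ring
  -- the boost by `-r` in the direction `v` takes `y` to the origin, where the plane waves are `1`
  obtain ⟨r, hr, v, rfl⟩ := exists_hypPolar_eq hn1 y
  have hv := norm_eq_of_mem_sphere v
  let K : ℝ → ℂ := fun s => ∫ u, ((minkowski (boostLin v.1 s x.1) (1, u.1) : ℝ) : ℂ) ^ μ *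
      ((minkowski (boostLin v.1 s (hypPolar r v).1) (1, u.1) : ℝ) : ℂ) ^ (starRingEnd ℂ) μ
        ∂uniformSphere n
  have hK : ∀ s, K s = ∫ u, planeWave (hypBoost hv s x) α u *
      (starRingEnd ℂ) (planeWave (hypBoost hv s (hypPolar r v)) α u) ∂uniformSphere n := by
    intro s
    simp only [hconj]
    rfl
  have hconst : K 0 = K (-r) := is_const_of_deriv_eq_zero
    (fun s => (hasDerivAt_integral_boost hv hμν x _ s).differentiableAt)
    (fun s => (hasDerivAt_integral_boost hv hμν x _ s).deriv) 0 (-r)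
  have h0 := hK 0
  have h1 := hK (-r)
  rw [hypBoost_zero, hypBoost_zero] at h0
  rw [hypBoost_neg_hypPolar] at h1
  simp only [planeWave_hypOrigin, map_one, mul_one] at h1
  rw [← h0, hconst, h1, ← hypDist_hypBoost hv (-r) x, hypBoost_neg_hypPolar]
  obtain ⟨q, hq, e, he⟩ := exists_hypPolar_eq hn1 (hypBoost hv (-r) x)
  rw [← he, hypDist_comm, hypDist_hypOrigin_hypPolar hq,
    sphericalFunction_eq_integral hn (norm_eq_of_mem_sphere e)]
  refine integral_congr_ae (Eventually.of_forall fun u => ?_)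
  simp only [planeWave, minkowski, hypPolar, mul_one, real_inner_smul_left]

end

/-! ### Laws of Gaussian fields -/

section

variable {T E Ω Ω' : Type*} [MeasurableSpace E] [MeasurableSpace Ω] [MeasurableSpace Ω']
  {P : Measure Ω} {P' : Measure Ω'}

theorem SameLaw.symm {u : T → Ω → E} {v : T → Ω' → E} (h : SameLaw P u P' v) :
    SameLaw P' v P u := IdentDistrib.symm h

theorem SameLaw.trans {Ω'' : Type*} [MeasurableSpace Ω''] {P'' : Measure Ω''} {u : T → Ω → E}
    {v : T → Ω' → E} {w : T → Ω'' → E} (h : SameLaw P u P' v) (h' : SameLaw P' v P'' w) :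
    SameLaw P u P'' w := IdentDistrib.trans h h'

theorem SameLaw.integral_comp {u : T → Ω → E} {v : T → Ω' → E} (h : SameLaw P u P' v)
    {φ : (T → E) → ℝ} (hφ : Measurable φ) :
    ∫ ω, φ (fun x => u x ω) ∂P = ∫ ω, φ (fun x => v x ω) ∂P' :=
  (IdentDistrib.comp h hφ).integral_eq

variable [NormedAddCommGroup E] [NormedSpace ℝ E] [BorelSpace E]

open Classical in
/-- The second moment of a linear functional of finitely many values of a Gaussian field. -/
theorem ProbabilityTheory.IsGaussianProcess.integral_dual_pi {u : T → Ω → E}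
    (hu : IsGaussianProcess u P)
    (I : Finset T) (L : StrongDual ℝ (I → E)) :
    (∫ ω, L (I.restrict (u · ω)) ∂P
        = ∑ i, ∫ ω, (L.comp (.single ℝ (fun _ : I => E) i)) (u i.1 ω) ∂P) ∧
      ∫ ω, L (I.restrict (u · ω)) ^ 2 ∂P = ∑ i, ∑ j,
        ∫ ω, (L.comp (.single ℝ (fun _ : I => E) i)) (u i.1 ω)
          * (L.comp (.single ℝ (fun _ : I => E) j)) (u j.1 ω) ∂P := by
  have hL : ∀ ω, L (I.restrict (u · ω))
      = ∑ i, (L.comp (.single ℝ (fun _ : I => E) i)) (u i.1 ω) := by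
    intro ω
    conv_lhs => rw [← L.sum_comp_single]
    simp
  have h2 : ∀ i : I, MemLp (fun ω => (L.comp (.single ℝ (fun _ : I => E) i)) (u i.1 ω)) 2 P :=
    fun i => ((hu.hasGaussianLaw_eval i.1).map_fun _).memLp_two
  have h1 : ∀ i : I, Integrable (fun ω => (L.comp (.single ℝ (fun _ : I => E) i)) (u i.1 ω)) P :=
    fun i => ((hu.hasGaussianLaw_eval i.1).map_fun _).integrable
  simp only [hL]
  refine ⟨integral_finsetSum _ fun i _ => h1 i, ?_⟩
  simp only [pow_two, Finset.sum_mul_sum]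
  have h3 : ∀ i j : I, Integrable (fun ω => (L.comp (.single ℝ (fun _ : I => E) i)) (u i.1 ω)
      * (L.comp (.single ℝ (fun _ : I => E) j)) (u j.1 ω)) P :=
    fun i j => (h2 i).integrable_mul (h2 j)
  rw [integral_finsetSum _ fun i _ => integrable_finsetSum _ fun j _ => h3 i j]
  exact Finset.sum_congr rfl fun i _ => integral_finsetSum _ fun j _ => h3 i j

variable [CompleteSpace E] [SecondCountableTopology E]

/-- The law of a Gaussian field is determined by its means and covariances. -/
theorem ProbabilityTheory.IsGaussianProcess.sameLaw {u : T → Ω → E} {v : T → Ω' → E}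
    (hu : IsGaussianProcess u P) (hv : IsGaussianProcess v P')
    (mu : ∀ t, Measurable (u t)) (mv : ∀ t, Measurable (v t))
    (hmean : ∀ t (L : StrongDual ℝ E), ∫ ω, L (u t ω) ∂P = ∫ ω, L (v t ω) ∂P')
    (hcov : ∀ s t (L L' : StrongDual ℝ E),
      ∫ ω, L (u s ω) * L' (u t ω) ∂P = ∫ ω, L (v s ω) * L' (v t ω) ∂P') :
    SameLaw P u P' v := by
  have := hu.isProbabilityMeasure
  have := hv.isProbabilityMeasure
  have mu' : Measurable fun ω t => u t ω := measurable_pi_lambda _ mu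
  have mv' : Measurable fun ω t => v t ω := measurable_pi_lambda _ mv
  refine ⟨mu'.aemeasurable, mv'.aemeasurable, ?_⟩
  have h1 := isProjectiveLimit_map (P := P) (X := u) mu'.aemeasurable
  have h2 := isProjectiveLimit_map (P := P') (X := v) mv'.aemeasurable
  have hI : ∀ I : Finset T, P.map (fun ω => I.restrict (u · ω))
      = P'.map (fun ω => I.restrict (v · ω)) := by
    intro I
    have hgu := hu.hasGaussianLaw I
    have hgv := hv.hasGaussianLaw I
    have := hgu.isGaussian_map
    have := hgv.isGaussian_map
    refine Measure.ext_of_charFunDual (funext fun L => ?_)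
    obtain ⟨u1, u2⟩ := hu.integral_dual_pi I L
    obtain ⟨v1, v2⟩ := hv.integral_dual_pi I L
    have e1 : ∫ ω, L (I.restrict (u · ω)) ∂P = ∫ ω, L (I.restrict (v · ω)) ∂P' := by
      rw [u1, v1]; exact Finset.sum_congr rfl fun i _ => hmean _ _
    have e2 : ∫ ω, L (I.restrict (u · ω)) ^ 2 ∂P = ∫ ω, L (I.restrict (v · ω)) ^ 2 ∂P' := by
      rw [u2, v2]
      exact Finset.sum_congr rfl fun i _ => Finset.sum_congr rfl fun j _ => hcov _ _ _ _
    rw [hgu.charFunDual_map_eq_fun, hgv.charFunDual_map_eq_fun,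
      variance_eq_sub (hgu.map_fun L).memLp_two, variance_eq_sub (hgv.map_fun L).memLp_two]
    simp only [Pi.pow_apply]
    rw [e1, e2]
  have : ∀ I : Finset T, IsFiniteMeasure (P.map (fun ω => I.restrict (u · ω))) := fun I =>
    by
    have := (hu.hasGaussianLaw I).isGaussian_map
    infer_instance
  exact h1.unique (by simp_rw [hI]; exact h2)

end

/-! ### Moments of Gaussian waves -/

theorem isHypEigenfunction_zero {n : ℕ} {E : Type*} [NormedAddCommGroup E] [NormedSpace ℝ E]
    (lam : ℝ) : IsHypEigenfunction (n := n) lam fun _ => (0 : E) := by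
  have h : radialExt (n := n) (fun _ => (0 : E)) = fun _ => 0 := by
    ext x; simp [radialExt]
  refine ⟨?_, fun x => ?_⟩
  · rw [HypSmooth, h]; exact contDiffOn_const
  · rw [hypLaplacian, h]; simp [dAlembert]

theorem HypSmooth.continuous_comp {n : ℕ} {E Y : Type*} [NormedAddCommGroup E] [NormedSpace ℝ E]
    [TopologicalSpace Y] {f : HyperbolicSpace n → E} (hf : HypSmooth f) {φ : Y → HyperbolicSpace n}
    (hφ : Continuous fun y => (φ y).1) : Continuous fun y => f (φ y) := by
  have h := (ContDiffOn.continuousOn hf).comp_continuous hφ fun y => (φ y).mem_futureCone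
  exact h.congr fun y => radialExt_coe f (φ y)

theorem continuous_hypPolar_coe {n : ℕ} (r : ℝ) :
    Continuous fun u : Metric.sphere (0 : EuclideanSpace ℝ (Fin n)) 1 => (hypPolar r u).1 := by
  unfold hypPolar
  fun_prop

theorem continuous_hypPoint_coe (n : ℕ) :
    Continuous fun v : EuclideanSpace ℝ (Fin n) => (hypPoint v).1 := by
  unfold hypPoint
  fun_prop

section

variable {E : Type*} [NormedAddCommGroup E] [NormedSpace ℝ E] [MeasurableSpace E]
  {ν : Measure E} {n : ℕ} {lam α : ℝ} {Ω : Type*} [MeasurableSpace Ω] {P : Measure Ω}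
  {u : HyperbolicSpace n → Ω → E}

/-- A version of a wave all of whose samples are eigenfunctions. -/
theorem IsHypGaussianWave.exists_modification (hu : IsHypGaussianWave ν n lam P u) :
    ∃ w : HyperbolicSpace n → Ω → E, (∀ x, Measurable (w x)) ∧
      (∀ ω, IsHypEigenfunction lam fun x => w x ω) ∧ ∀ᵐ ω ∂P, ∀ x, u x ω = w x ω := by
  classical
  let A : Set Ω := (toMeasurable P {ω | ¬ IsHypEigenfunction lam fun x => u x ω})ᶜ
  have hA : MeasurableSet A := (measurableSet_toMeasurable _ _).compl
  have hA0 : ∀ᵐ ω ∂P, ω ∈ A := by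
    rw [ae_iff]
    have h := hu.eigen
    rw [ae_iff] at h
    simp only [A, mem_compl_iff, not_not, ofPred_mem_eq]
    rw [measure_toMeasurable]; exact h
  have hAe : ∀ ω ∈ A, IsHypEigenfunction lam fun x => u x ω := by
    intro ω hω
    by_contra h
    exact hω (subset_toMeasurable _ _ h)
  refine ⟨fun x => A.indicator (u x), fun x => (hu.measurable x).indicator hA, fun ω => ?_, ?_⟩
  · by_cases hω : ω ∈ A
    · simp only [indicator_of_mem hω]; exact hAe ω hω
    · simp only [indicator_of_notMem hω]; exact isHypEigenfunction_zero lam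
  · filter_upwards [hA0] with ω hω x
    rw [indicator_of_mem hω]

variable [BorelSpace E]

theorem IsHypGaussianWave.memLp_dual (hu : IsHypGaussianWave ν n lam P u) (L : StrongDual ℝ E)
    (x : HyperbolicSpace n) : MemLp (fun ω => L (u x ω)) 2 P :=
  ((hu.gaussian.hasGaussianLaw_eval x).map_fun L).memLp_two

theorem IsHypGaussianWave.integral_marginal (hu : IsHypGaussianWave ν n lam P u)
    (x : HyperbolicSpace n) {φ : E → ℝ} (hφ : Continuous φ) :
    ∫ ω, φ (u x ω) ∂P = ∫ z, φ z ∂ν := by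
  rw [← hu.marginal x, integral_map (hu.measurable x).aemeasurable hφ.aestronglyMeasurable]

theorem IsHypGaussianWave.integral_mul_isometry (hu : IsHypGaussianWave ν n lam P u)
    {g : HyperbolicSpace n ≃ HyperbolicSpace n} (hg : IsHypIsometry g) (L L' : StrongDual ℝ E)
    (x y : HyperbolicSpace n) :
    ∫ ω, L (u (g x) ω) * L' (u (g y) ω) ∂P = ∫ ω, L (u x ω) * L' (u y ω) ∂P :=
  (hu.invariant g hg).integral_comp (φ := fun f => L (f x) * L' (f y))
    ((L.measurable.comp (measurable_pi_apply x)).mul (L'.measurable.comp (measurable_pi_apply y)))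

/-- The covariance with the value at the origin. By rotation invariance the covariance at a point
can be averaged over the geodesic sphere through this point, and the mean value property applies to
the samples. -/
theorem IsHypGaussianWave.integral_mul_hypOrigin (hn : 2 ≤ n)
    (hlam : lam = hypSigma n ^ 2 + α ^ 2) (hu : IsHypGaussianWave ν n lam P u)
    (L L' : StrongDual ℝ E) {r : ℝ} (hr : 0 ≤ r)
    (v : Metric.sphere (0 : EuclideanSpace ℝ (Fin n)) 1) :
    ∫ ω, L (u (hypOrigin n) ω) * L' (u (hypPolar r v) ω) ∂P
      = (∫ z, L z * L' z ∂ν) * (sphericalFunction n α r).re := by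
  have := hu.gaussian.isProbabilityMeasure
  have := isProbabilityMeasure_uniformSphere (n := n) (by omega)
  obtain ⟨w, hwm, hwe, hwu⟩ := hu.exists_modification
  have hK : ∀ e, ∫ ω, L (w (hypOrigin n) ω) * L' (w (hypPolar r e) ω) ∂P
      = ∫ ω, L (u (hypOrigin n) ω) * L' (u (hypPolar r v) ω) ∂P := by
    intro e
    obtain ⟨R, hR⟩ := exists_hypRotation_hypPolar v e
    rw [← hu.integral_mul_isometry (isHypIsometry_hypRotation R), hypRotation_hypOrigin, hR]
    refine integral_congr_ae ?_
    filter_upwards [hwu] with ω hω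
    rw [hω, hω]
  have hwL : ∀ (L : StrongDual ℝ E) x, MemLp (fun ω => L (w x ω)) 2 P := fun L x =>
    (hu.memLp_dual L x).ae_eq (by filter_upwards [hwu] with ω hω; rw [hω])
  have hsq : ∀ (L : StrongDual ℝ E) x, ∫ ω, L (w x ω) ^ 2 ∂P = ∫ z, L z ^ 2 ∂ν := by
    intro L x
    rw [← hu.integral_marginal x (φ := fun z => L z ^ 2) (by fun_prop)]
    refine integral_congr_ae ?_
    filter_upwards [hwu] with ω hω
    rw [hω]
  let f : Metric.sphere (0 : EuclideanSpace ℝ (Fin n)) 1 → Ω → ℝ := fun e ω =>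
    L (w (hypOrigin n) ω) * L' (w (hypPolar r e) ω)
  have hfm : Measurable (Function.uncurry f) := by
    refine measurable_uncurry_of_continuous_of_measurable (fun ω => ?_) fun e => ?_
    · exact continuous_const.mul
        (L'.continuous.comp ((hwe ω).smooth.continuous_comp (continuous_hypPolar_coe r)))
    · exact (L.measurable.comp (hwm _)).mul (L'.measurable.comp (hwm _))
  have hfi : Integrable (Function.uncurry f) ((uniformSphere n).prod P) := by
    rw [integrable_prod_iff hfm.aestronglyMeasurable]
    refine ⟨Eventually.of_forall fun e => (hwL L (hypOrigin n)).integrable_mul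
      (hwL L' (hypPolar r e)), ?_⟩
    refine Integrable.of_bound (C := (∫ z, L z ^ 2 ∂ν) + ∫ z, L' z ^ 2 ∂ν)
      hfm.stronglyMeasurable.norm.integral_prod_right.aestronglyMeasurable
      (Eventually.of_forall fun e => ?_)
    rw [Real.norm_of_nonneg (integral_nonneg fun ω => norm_nonneg _), ← hsq L (hypOrigin n),
      ← hsq L' (hypPolar r e), ← integral_add (hwL L _).integrable_sq (hwL L' _).integrable_sq]
    refine integral_mono ((hwL L (hypOrigin n)).integrable_mul (hwL L' (hypPolar r e))).norm
      ((hwL L _).integrable_sq.add (hwL L' _).integrable_sq) fun ω => ?_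
    simp only [Function.uncurry, f, norm_mul, Real.norm_eq_abs]
    nlinarith [sq_abs (L (w (hypOrigin n) ω)), sq_abs (L' (w (hypPolar r e) ω)),
      sq_nonneg (|L (w (hypOrigin n) ω)| - |L' (w (hypPolar r e) ω)|),
      sq_nonneg (|L (w (hypOrigin n) ω)|), sq_nonneg (|L' (w (hypPolar r e) ω)|)]
  have hmean : ∀ ω, ∫ e, f e ω ∂uniformSphere n
      = L (w (hypOrigin n) ω) * L' (w (hypOrigin n) ω) * (sphericalFunction n α r).re := by
    intro ω
    have h := sphericalMean_eq_mul hn hlam ((hwe ω).clm_comp L') hr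
    simp only [f]
    rw [integral_const_mul, mul_assoc, ← h]
    rfl
  calc ∫ ω, L (u (hypOrigin n) ω) * L' (u (hypPolar r v) ω) ∂P
      = ∫ e, ∫ ω, f e ω ∂P ∂uniformSphere n := by simp [f, hK]
    _ = ∫ ω, ∫ e, f e ω ∂uniformSphere n ∂P := integral_integral_swap hfi
    _ = (∫ ω, L (w (hypOrigin n) ω) * L' (w (hypOrigin n) ω) ∂P)
          * (sphericalFunction n α r).re := by
        simp only [hmean]; exact integral_mul_const _ _
    _ = _ := by
        rw [← hu.integral_marginal (hypOrigin n) (φ := fun z => L z * L' z) (by fun_prop)]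
        congr 1
        refine integral_congr_ae ?_
        filter_upwards [hwu] with ω hω
        rw [hω]

/-- The covariance of an invariant wave, by moving `x` to the origin. It is stated for pairs of
real linear functionals of the values, which covers the real and the complex wave. -/
theorem IsHypGaussianWave.integral_mul (hn : 2 ≤ n) (hlam : lam = hypSigma n ^ 2 + α ^ 2)
    (hu : IsHypGaussianWave ν n lam P u) (L L' : StrongDual ℝ E) (x y : HyperbolicSpace n) :
    ∫ ω, L (u x ω) * L' (u y ω) ∂P
      = (∫ z, L z * L' z ∂ν) * (sphericalFunction n α (hypDist x y)).re := by
  have hg := isHypIsometry_hypSwap x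
  obtain ⟨r, hr, v, hv⟩ := exists_hypPolar_eq (by omega) (hypSwap x y)
  rw [← hg x y, ← hu.integral_mul_isometry hg, hypSwap_self, ← hv, hypDist_hypOrigin_hypPolar hr]
  exact hu.integral_mul_hypOrigin hn hlam L L' hr v

/-- Hyperbolic space has infinite volume, in the chart `v ↦ (√(1 + ‖v‖²), v)`: for `R ≥ 1` the
density is at least `1 / (2R)` on the ball of radius `R`, whose Euclidean volume is of order `R ^ n`. -/
theorem hypVolume_chart_eq_top (hn : 2 ≤ n) :
    ((volume : Measure (EuclideanSpace ℝ (Fin n))).withDensity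
      (fun v => ENNReal.ofReal (1 / √(1 + ‖v‖ ^ 2)))) univ = ⊤ := by
  have : Nontrivial (EuclideanSpace ℝ (Fin n)) := by
    have : Nonempty (Fin n) := ⟨⟨0, by omega⟩⟩
    infer_instance
  rw [withDensity_apply _ MeasurableSet.univ, Measure.restrict_univ]
  refine ENNReal.eq_top_of_forall_nnreal_le fun c => ?_
  set β := (volume : Measure (EuclideanSpace ℝ (Fin n))) (Metric.ball 0 1) with hβ
  have hβ0 : β ≠ 0 := (Metric.measure_ball_pos _ _ one_pos).ne'
  have hβt : β ≠ ⊤ := measure_ball_lt_top.ne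
  -- on the ball of radius `R ≥ 1` the density is at least `1 / (2 R)`
  obtain ⟨R, hR1, hR⟩ : ∃ R : ℝ, 1 ≤ R ∧ (c : ENNReal) ≤ ENNReal.ofReal (R / 2) * β := by
    have hb : 0 < β.toReal := ENNReal.toReal_pos hβ0 hβt
    refine ⟨max 1 (2 * c / β.toReal), le_max_left _ _, ?_⟩
    generalize hS : max 1 (2 * c / β.toReal) = S
    have h1 : 1 ≤ S := hS ▸ le_max_left _ _
    have h2 : 2 * c / β.toReal ≤ S := hS ▸ le_max_right _ _
    rw [div_le_iff₀ hb] at h2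
    rw [← ENNReal.ofReal_toReal hβt, ← ENNReal.ofReal_mul (by positivity),
      ← ENNReal.ofReal_coe_nnreal]
    exact ENNReal.ofReal_le_ofReal (by linarith)
  refine hR.trans ?_
  calc ENNReal.ofReal (R / 2) * β
      ≤ ENNReal.ofReal (1 / (2 * R)) * volume (Metric.ball (0 : EuclideanSpace ℝ (Fin n)) R) := by
        rw [Measure.addHaar_ball _ _ (zero_le_one.trans hR1), finrank_euclideanSpace_fin,
          ← mul_assoc, ← ENNReal.ofReal_mul (by positivity)]
        gcongr
        have h2 : R ^ 2 ≤ R ^ n := pow_le_pow_right₀ hR1 hn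
        have hR0 : 0 < R := by linarith
        calc R / 2 = 1 / (2 * R) * R ^ 2 := by field_simp
          _ ≤ _ := by gcongr
    _ = ∫⁻ v in Metric.ball (0 : EuclideanSpace ℝ (Fin n)) R, ENNReal.ofReal (1 / (2 * R)) := by
        rw [setLIntegral_const]
    _ ≤ ∫⁻ v in Metric.ball (0 : EuclideanSpace ℝ (Fin n)) R,
          ENNReal.ofReal (1 / √(1 + ‖v‖ ^ 2)) := by
        refine setLIntegral_mono' measurableSet_ball fun v hv => ENNReal.ofReal_le_ofReal ?_
        have hv' : ‖v‖ < R := by simpa using hv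
        refine one_div_le_one_div_of_le (Real.sqrt_pos.2 (by positivity)) ?_
        rw [Real.sqrt_le_left (by linarith)]
        nlinarith [norm_nonneg v]
    _ ≤ ∫⁻ v, ENNReal.ofReal (1 / √(1 + ‖v‖ ^ 2)) := setLIntegral_le_lintegral _ _

/-- Almost no sample is square integrable: the squared norm of the wave, restricted to an event of
positive probability, has an expectation bounded below at all points, because the one-point law has
no atom at `0`; and the volume is infinite. -/
theorem IsHypGaussianWave.ae_not_memLp (hn : 2 ≤ n) (hu : IsHypGaussianWave ν n lam P u)
    (hν : ν {0} = 0) : ∀ᵐ ω ∂P, ¬ MemLp (fun x => u x ω) 2 (hypVolume n) := by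
  have := hu.gaussian.isProbabilityMeasure
  have hνp : IsProbabilityMeasure ν := by
    rw [← hu.marginal (hypOrigin n)]
    exact Measure.isProbabilityMeasure_map (hu.measurable _).aemeasurable
  obtain ⟨w, hwm, hwe, hwu⟩ := hu.exists_modification
  set m := ((volume : Measure (EuclideanSpace ℝ (Fin n))).withDensity
      (fun v => ENNReal.ofReal (1 / √(1 + ‖v‖ ^ 2)))) with hm
  let f : EuclideanSpace ℝ (Fin n) → Ω → ENNReal := fun v ω => ‖w (hypPoint v) ω‖ₑ ^ 2
  have hfm : Measurable (Function.uncurry f) := by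
    have h : Measurable (Function.uncurry fun v ω => w (hypPoint v) ω) :=
      measurable_uncurry_of_continuous_of_measurable
        (fun ω => (hwe ω).smooth.continuous_comp (continuous_hypPoint_coe n)) fun v => hwm _
    exact h.enorm.pow_const 2
  have hN : Measurable fun ω => ∫⁻ v, f v ω ∂m := hfm.lintegral_prod_left
  have hpoint : Measurable (hypPoint (n := n)) :=
    (continuous_hypPoint_coe n).measurable.subtype_mk
  -- square integrability is tested in the chart, for the jointly measurable version `w`
  suffices hmain : ∀ᵐ ω ∂P, ∫⁻ v, f v ω ∂m = ⊤ by
    filter_upwards [hmain, hwu] with ω h1 h2 h3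
    have h4 : MemLp (fun v => w (hypPoint v) ω) 2 m := by
      have h5 : MemLp ((fun x => u x ω) ∘ hypPoint) 2 m :=
        h3.comp_measurePreserving ⟨hpoint, rfl⟩
      refine h5.ae_eq (Eventually.of_forall fun v => h2 _)
    have h6 := (eLpNorm_lt_top_iff_lintegral_rpow_enorm_lt_top two_ne_zero
      ENNReal.ofNat_ne_top).1 h4.2
    have h7 : ∫⁻ v, f v ω ∂m < ⊤ := by simpa [f] using h6
    exact h7.ne h1
  have hM : ∀ M : ℕ, P {ω | ∫⁻ v, f v ω ∂m ≤ M} = 0 := by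
    intro M
    by_contra hpos
    set A := {ω | ∫⁻ v, f v ω ∂m ≤ M} with hA
    have hAm : MeasurableSet A := measurableSet_le hN measurable_const
    -- the law at a point gives a small ball less mass than `A` has
    obtain ⟨k, hk⟩ : ∃ k : ℕ, ν (Metric.closedBall 0 (1 / ((k : ℝ) + 1))) < P A := by
      have hlim : Tendsto (fun k : ℕ => ν (Metric.closedBall 0 (1 / ((k : ℝ) + 1)))) atTop
          (𝓝 (ν (⋂ k : ℕ, Metric.closedBall 0 (1 / ((k : ℝ) + 1))))) := by
        refine tendsto_measure_iInter_atTop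
          (fun k => Metric.isClosed_closedBall.measurableSet.nullMeasurableSet) ?_
          ⟨0, measure_ne_top _ _⟩
        intro i j hij
        exact Metric.closedBall_subset_closedBall (Nat.one_div_le_one_div hij)
      have hint : (⋂ k : ℕ, Metric.closedBall (0 : E) (1 / ((k : ℝ) + 1))) = {0} := by
        ext z
        simp only [mem_iInter, Metric.mem_closedBall, dist_zero_right, mem_singleton_iff]
        constructor
        · intro h
          refine norm_le_zero_iff.1 (ge_of_tendsto' tendsto_one_div_add_atTop_nhds_zero_nat h)
        · rintro rfl k; simp; positivity
      rw [hint, hν] at hlim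
      exact (hlim.eventually (gt_mem_nhds (pos_iff_ne_zero.2 hpos))).exists
    set ε := 1 / ((k : ℝ) + 1) with hε
    have hε0 : 0 < ε := by positivity
    set δ := ENNReal.ofReal ε ^ 2 * (P A - ν (Metric.closedBall 0 ε)) with hδ
    have hδ0 : δ ≠ 0 := by
      refine mul_ne_zero (pow_ne_zero _ ?_) (tsub_pos_of_lt hk).ne'
      exact (ENNReal.ofReal_pos.2 hε0).ne'
    have hlow : ∀ v, δ ≤ ∫⁻ ω in A, f v ω ∂P := by
      intro v
      have hB : P {ω | w (hypPoint v) ω ∈ Metric.closedBall 0 ε} = ν (Metric.closedBall 0 ε) := by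
        rw [← hu.marginal (hypPoint v), Measure.map_apply (hu.measurable _)
          Metric.isClosed_closedBall.measurableSet]
        refine measure_congr ?_
        filter_upwards [hwu] with ω hω
        exact congrArg (· ∈ Metric.closedBall (0 : E) ε) (hω (hypPoint v)).symm
      have hBm : MeasurableSet {ω | w (hypPoint v) ω ∈ Metric.closedBall 0 ε} :=
        hwm _ Metric.isClosed_closedBall.measurableSet
      calc δ ≤ ENNReal.ofReal ε ^ 2 * P (A \ {ω | w (hypPoint v) ω ∈ Metric.closedBall 0 ε}) := by
            rw [hδ, ← hB]
            gcongr
            exact le_measure_sdiff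
        _ = ∫⁻ _ in A \ {ω | w (hypPoint v) ω ∈ Metric.closedBall 0 ε},
              ENNReal.ofReal ε ^ 2 ∂P := by rw [setLIntegral_const]
        _ ≤ ∫⁻ ω in A \ {ω | w (hypPoint v) ω ∈ Metric.closedBall 0 ε}, f v ω ∂P := by
            refine setLIntegral_mono' (hAm.diff hBm) fun ω hω => ?_
            have h1 : ε < ‖w (hypPoint v) ω‖ := by
              have := hω.2
              simpa using this
            simp only [f]
            gcongr
            rw [← ofReal_norm]
            exact ENNReal.ofReal_le_ofReal h1.le
        _ ≤ ∫⁻ ω in A, f v ω ∂P := lintegral_mono_set sdiff_subset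
    -- on `A` the squared norm is at most `M`, so Fubini gives a contradiction
    have htop : ∫⁻ v, ∫⁻ ω in A, f v ω ∂P ∂m = ⊤ := by
      refine top_le_iff.1 (le_trans (le_of_eq ?_) (lintegral_mono hlow))
      rw [lintegral_const, hypVolume_chart_eq_top hn, ENNReal.mul_top hδ0]
    have hswap : ∫⁻ v, ∫⁻ ω in A, f v ω ∂P ∂m = ∫⁻ ω in A, ∫⁻ v, f v ω ∂m ∂P :=
      lintegral_lintegral_swap hfm.aemeasurable
    have hle : ∫⁻ ω in A, ∫⁻ v, f v ω ∂m ∂P ≤ M := by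
      calc ∫⁻ ω in A, ∫⁻ v, f v ω ∂m ∂P ≤ ∫⁻ _ in A, (M : ENNReal) ∂P :=
            setLIntegral_mono' hAm fun ω hω => hω
        _ = M * P A := by rw [setLIntegral_const]
        _ ≤ M * 1 := by gcongr; exact prob_le_one
        _ = M := mul_one _
    rw [← hswap, htop] at hle
    exact absurd hle (by simp)
  rw [ae_iff]
  refine measure_mono_null (t := ⋃ M : ℕ, {ω | ∫⁻ v, f v ω ∂m ≤ M}) (fun ω hω => ?_)
    (measure_iUnion_null hM)
  obtain ⟨M, hM'⟩ := ENNReal.exists_nat_gt hω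
  exact mem_iUnion.2 ⟨M, hM'.le⟩

end

/-! ### The isonormal Gaussian process -/

/-- The characteristic function at `1` is a Lipschitz function of the variable in `L²`. -/
theorem norm_integral_cexp_sub_le {Ω : Type*} [MeasurableSpace Ω] {P : Measure Ω}
    [IsProbabilityMeasure P] (f g : Lp ℝ 2 P) :
    ‖(∫ ω, Complex.exp (Complex.I * f ω) ∂P) - ∫ ω, Complex.exp (Complex.I * g ω) ∂P‖
      ≤ ‖f - g‖ := by
  have hint : ∀ f : Lp ℝ 2 P, Integrable (fun ω => Complex.exp (Complex.I * f ω)) P := by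
    intro f
    refine Integrable.of_bound (C := 1) ?_ (Eventually.of_forall fun ω => ?_)
    · have hf := (Lp.aestronglyMeasurable f).aemeasurable
      exact (Complex.measurable_exp.comp_aemeasurable
        ((Complex.measurable_ofReal.comp_aemeasurable hf).const_mul _)).aestronglyMeasurable
    · rw [mul_comm, Complex.norm_exp_ofReal_mul_I]
  have hpt : ∀ x y : ℝ, ‖Complex.exp (Complex.I * x) - Complex.exp (Complex.I * y)‖ ≤ ‖x - y‖ := by
    intro x y
    have e : Complex.exp (Complex.I * x) - Complex.exp (Complex.I * y)
        = Complex.exp (y * Complex.I) * (Complex.exp (Complex.I * (x - y : ℝ)) - 1) := by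
      rw [mul_sub, ← Complex.exp_add, mul_one, mul_comm (y : ℂ)]
      congr 2
      push_cast; ring
    rw [e, norm_mul, Complex.norm_exp_ofReal_mul_I, one_mul]
    exact Real.norm_exp_I_mul_ofReal_sub_one_le
  rw [← integral_sub (hint f) (hint g)]
  refine (norm_integral_le_integral_norm _).trans ?_
  have h1 : ∫ ω, ‖Complex.exp (Complex.I * f ω) - Complex.exp (Complex.I * g ω)‖ ∂P
      ≤ ∫ ω, ‖(f - g : Lp ℝ 2 P) ω‖ ∂P := by
    refine integral_mono_ae ((hint f).sub (hint g)).norm ((Lp.memLp (f - g)).integrable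
      one_le_two).norm ?_
    filter_upwards [Lp.coeFn_sub f g] with ω hω
    rw [hω]
    exact hpt _ _
  refine h1.trans ?_
  rw [integral_norm_eq_lintegral_enorm (Lp.aestronglyMeasurable _), Lp.norm_def,
    ← eLpNorm_one_eq_lintegral_enorm]
  exact ENNReal.toReal_mono (Lp.eLpNorm_ne_top _)
    (eLpNorm_le_eLpNorm_of_exponent_le one_le_two (Lp.aestronglyMeasurable _))

section

variable (ι : Type*)

/-- A family of independent standard normal variables. -/
noncomputable def iidGaussian : Measure (ι → ℝ) := Measure.infinitePi fun _ => gaussianReal 0 1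

instance : IsProbabilityMeasure (iidGaussian ι) := by
  unfold iidGaussian; infer_instance

variable {ι}

theorem map_eval_iidGaussian (i : ι) :
    (iidGaussian ι).map (fun ω => ω i) = gaussianReal 0 1 :=
  (measurePreserving_eval_infinitePi (fun _ : ι => gaussianReal 0 1) i).map_eq

theorem iIndepFun_iidGaussian : iIndepFun (fun i (ω : ι → ℝ) => ω i) (iidGaussian ι) :=
  iIndepFun_infinitePi (P := fun _ : ι => gaussianReal 0 1) (X := fun _ x => x)
    fun _ => measurable_id

theorem hasGaussianLaw_eval_iidGaussian (i : ι) :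
    HasGaussianLaw (fun ω : ι → ℝ => ω i) (iidGaussian ι) := by
  constructor
  rw [map_eval_iidGaussian]
  infer_instance

theorem integral_eval_iidGaussian (i : ι) : ∫ ω, ω i ∂iidGaussian ι = 0 := by
  have h := integral_map (μ := iidGaussian ι) (φ := fun ω : ι → ℝ => ω i)
    (measurable_pi_apply i).aemeasurable (f := fun x : ℝ => x) (by fun_prop)
  rw [map_eval_iidGaussian, integral_id_gaussianReal] at h
  exact h.symm

theorem memLp_eval_iidGaussian (i : ι) : MemLp (fun ω : ι → ℝ => ω i) 2 (iidGaussian ι) :=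
  (hasGaussianLaw_eval_iidGaussian i).memLp_two

theorem integral_eval_mul_eval_iidGaussian [DecidableEq ι] (i j : ι) :
    ∫ ω, ω i * ω j ∂iidGaussian ι = if i = j then 1 else 0 := by
  split_ifs with h
  · subst h
    have h1 := variance_eq_sub (memLp_eval_iidGaussian i)
    have h2 : Var[fun ω : ι → ℝ => ω i; iidGaussian ι] = 1 := by
      have := variance_map (μ := iidGaussian ι) (Y := fun ω : ι → ℝ => ω i) (X := fun x : ℝ => x)
        (by fun_prop) (measurable_pi_apply i).aemeasurable
      rw [map_eval_iidGaussian, variance_fun_id_gaussianReal] at this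
      simpa [Function.comp_def] using this.symm
    rw [h2, integral_eval_iidGaussian] at h1
    simpa [pow_two] using h1.symm
  · have := (iIndepFun_iidGaussian.indepFun h).integral_fun_mul_eq_mul_integral
      (measurable_pi_apply i).aestronglyMeasurable (measurable_pi_apply j).aestronglyMeasurable
    rw [this, integral_eval_iidGaussian, zero_mul]

/-- The coordinates of `iidGaussian` as square integrable variables. -/
noncomputable def iidCoord (i : ι) : Lp ℝ 2 (iidGaussian ι) := (memLp_eval_iidGaussian i).toLp _

theorem iidCoord_ae (i : ι) : iidCoord i =ᵐ[iidGaussian ι] fun ω => ω i := MemLp.coeFn_toLp _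

theorem orthonormal_iidCoord : Orthonormal ℝ (iidCoord (ι := ι)) := by
  classical
  rw [orthonormal_iff_ite]
  intro i j
  rw [L2.inner_def, ← integral_eval_mul_eval_iidGaussian i j]
  refine integral_congr_ae ?_
  filter_upwards [iidCoord_ae i, iidCoord_ae j] with ω h1 h2
  rw [h1, h2]
  simp [mul_comm]

/-- Finite linear combinations of the coordinates have Gaussian characteristic functions. -/
theorem integral_cexp_sum_iidCoord (c : ι →₀ ℝ) :
    ∫ ω, Complex.exp (Complex.I * (c.sum fun i t => t • iidCoord i : Lp ℝ 2 (iidGaussian ι)) ω)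
        ∂iidGaussian ι
      = Complex.exp
          (-(‖(c.sum fun i t => t • iidCoord i : Lp ℝ 2 (iidGaussian ι))‖ ^ 2 / 2 : ℝ)) := by
  classical
  set f : Lp ℝ 2 (iidGaussian ι) := c.sum fun i t => t • iidCoord i with hf
  have hae : f =ᵐ[iidGaussian ι] fun ω => ∑ i : c.support, c i * ω i := by
    have h1 : f = ∑ i ∈ c.support, c i • iidCoord i := rfl
    rw [h1]
    refine (Lp.coeFn_finsetSum _ _).trans ?_
    have h2 : ∀ᵐ ω ∂iidGaussian ι, ∀ i ∈ c.support,
        (c i • iidCoord i : Lp ℝ 2 (iidGaussian ι)) ω = c i * ω i := by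
      rw [Filter.eventually_all_finset]
      intro i _
      filter_upwards [Lp.coeFn_smul (c i) (iidCoord i), iidCoord_ae i] with ω h3 h4
      rw [h3, Pi.smul_apply, h4, smul_eq_mul]
    filter_upwards [h2] with ω hω
    rw [Finset.sum_apply, Finset.sum_congr rfl hω]
    exact (Finset.sum_coe_sort c.support fun i => c i * ω i).symm
  have hg : HasGaussianLaw (fun ω : ι → ℝ => ∑ i : c.support, c i * ω i) (iidGaussian ι) := by
    have h1 : HasGaussianLaw (fun (ω : ι → ℝ) (i : c.support) => ω i) (iidGaussian ι) :=
      iIndepFun.hasGaussianLaw (fun i => hasGaussianLaw_eval_iidGaussian i.1)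
        (iIndepFun_iidGaussian.precomp Subtype.val_injective)
    have h2 := h1.map_fun (∑ i : c.support, c i • ContinuousLinearMap.proj (R := ℝ) i)
    simpa [sum_apply] using h2
  have hgf : HasGaussianLaw f (iidGaussian ι) := hg.congr hae.symm
  have hmean : ∫ ω, f ω ∂iidGaussian ι = 0 := by
    rw [integral_congr_ae hae, integral_finsetSum]
    · simp [integral_const_mul, integral_eval_iidGaussian]
    · intro i _
      exact ((memLp_eval_iidGaussian i.1).integrable one_le_two).const_mul _
  have hvar : Var[f; iidGaussian ι] = ‖f‖ ^ 2 := by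
    rw [variance_eq_sub (Lp.memLp f), hmean, ← real_inner_self_eq_norm_sq, L2.inner_def]
    simp [pow_two]
  have h := hgf.charFun_map_eq 1
  rw [charFun_apply, integral_map hgf.aemeasurable (by fun_prop)] at h
  simp only [conj_trivial, mul_one, RCLike.inner_apply, one_mul] at h
  rw [show (fun ω => f ω) = (f : (ι → ℝ) → ℝ) from rfl, hmean, hvar] at h
  simp only [mul_comm Complex.I]
  rw [h]
  congr 1
  push_cast
  ring

/-- The isonormal process: a Hilbert space is embedded isometrically into `L²` of a probability
space as a space of centred Gaussian variables. -/
theorem exists_isonormal (H : Type a) [NormedAddCommGroup H] [InnerProductSpace ℝ H]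
    [CompleteSpace H] :
    ∃ (Ω : Type a) (_ : MeasurableSpace Ω) (P : Measure Ω) (_ : IsProbabilityMeasure P)
      (Φ : H →ₗᵢ[ℝ] Lp ℝ 2 P), ∀ h, P.map (Φ h) = gaussianReal 0 (‖h‖₊ ^ 2) := by
  classical
  obtain ⟨w, b, -⟩ := exists_hilbertBasis ℝ H
  let X : w → Lp ℝ 2 (iidGaussian w) := iidCoord
  have hX : Orthonormal ℝ X := orthonormal_iidCoord
  let Φ : H →ₗᵢ[ℝ] Lp ℝ 2 (iidGaussian w) :=
    hX.orthogonalFamily.linearIsometry.comp b.repr.toLinearIsometry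
  have hΦb : ∀ i, Φ (b i) = X i := by
    intro i
    change hX.orthogonalFamily.linearIsometry (b.repr (b i)) = X i
    rw [b.repr_self, OrthogonalFamily.linearIsometry_apply_single]
    simp
  refine ⟨w → ℝ, inferInstance, iidGaussian w, inferInstance, Φ, ?_⟩
  -- a condition that is closed in `h`, and that holds on the dense span of the basis
  have hclosed : IsClosed {h : H | ∫ ω, Complex.exp (Complex.I * Φ h ω) ∂iidGaussian w
      = Complex.exp (-(‖h‖ ^ 2 / 2 : ℝ))} := by
    refine isClosed_eq ?_ (by fun_prop)
    refine LipschitzWith.continuous (K := 1) (LipschitzWith.of_dist_le_mul fun h k => ?_)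
    rw [dist_eq_norm, dist_eq_norm, NNReal.coe_one, one_mul, ← Φ.norm_map (h - k), map_sub]
    exact norm_integral_cexp_sub_le _ _
  have hall : ∀ h : H, ∫ ω, Complex.exp (Complex.I * Φ h ω) ∂iidGaussian w
      = Complex.exp (-(‖h‖ ^ 2 / 2 : ℝ)) := by
    intro h
    have hsub : (Submodule.span ℝ (range b) : Set H) ⊆
        {h : H | ∫ ω, Complex.exp (Complex.I * Φ h ω) ∂iidGaussian w
          = Complex.exp (-(‖h‖ ^ 2 / 2 : ℝ))} := by
      intro k hk
      obtain ⟨c, rfl⟩ := (Finsupp.mem_span_range_iff_exists_finsupp).1 hk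
      have e : Φ (c.sum fun i t => t • b i) = c.sum fun i t => t • X i := by
        simp only [Finsupp.sum, map_sum, map_smul, hΦb]
      rw [Set.mem_ofPred_eq, ← Φ.norm_map, e]
      exact integral_cexp_sum_iidCoord c
    have hd : h ∈ closure (Submodule.span ℝ (range b) : Set H) := by
      have := b.dense_span
      rw [← Submodule.topologicalClosure_coe, this]
      trivial
    exact closure_minimal hsub hclosed hd
  intro h
  have hm := (Lp.aestronglyMeasurable (Φ h)).aemeasurable
  have := Measure.isProbabilityMeasure_map hm
  refine Measure.ext_of_charFun (funext fun t => ?_)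
  rw [charFun_gaussianReal, charFun_apply, integral_map hm (by fun_prop)]
  have h1 := hall (t • h)
  have h2 : ∫ ω, Complex.exp (Complex.I * Φ (t • h) ω) ∂iidGaussian w
      = ∫ ω, Complex.exp ((⟪Φ h ω, t⟫ : ℝ) * Complex.I) ∂iidGaussian w := by
    refine integral_congr_ae ?_
    rw [map_smul]
    filter_upwards [Lp.coeFn_smul t (Φ h)] with ω hω
    rw [hω]
    simp [mul_comm]
  rw [← h2, h1, norm_smul]
  congr 1
  push_cast
  rw [mul_pow, ← Complex.ofReal_pow, Real.norm_eq_abs, sq_abs]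
  push_cast
  ring

end

/-! ### Circularly symmetric complex Gaussian fields -/

section

variable {T Ω Ω' : Type*} [MeasurableSpace Ω] [MeasurableSpace Ω'] {P : Measure Ω} {P' : Measure Ω'}
  {K : T → T → ℂ} {u : T → Ω → ℂ} {v : T → Ω' → ℂ}

/-- A centred complex Gaussian field with `E[u(s) conj u(t)] = K(s, t)` and `E[u(s) u(t)] = 0`.
The two relations are encoded by the covariances of the real and imaginary parts. -/
structure IsCircularField (K : T → T → ℂ) (P : Measure Ω) (u : T → Ω → ℂ) : Prop where
  measurable : ∀ t, Measurable (u t)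
  gaussian : IsGaussianProcess u P
  mean_re : ∀ t, ∫ ω, (u t ω).re ∂P = 0
  mean_im : ∀ t, ∫ ω, (u t ω).im ∂P = 0
  re_re : ∀ s t, ∫ ω, (u s ω).re * (u t ω).re ∂P = (K s t).re / 2
  im_im : ∀ s t, ∫ ω, (u s ω).im * (u t ω).im ∂P = (K s t).re / 2
  im_re : ∀ s t, ∫ ω, (u s ω).im * (u t ω).re ∂P = (K s t).im / 2

theorem StrongDual.apply_complex (L : StrongDual ℝ ℂ) (z : ℂ) :
    L z = L 1 * z.re + L Complex.I * z.im := by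
  conv_lhs => rw [← Complex.re_add_im z]
  have h : (z.re : ℂ) + z.im * Complex.I = z.re • (1 : ℂ) + z.im • Complex.I := by simp
  rw [h, map_add, map_smul, map_smul, smul_eq_mul, smul_eq_mul, mul_comm, mul_comm z.im]

namespace IsCircularField

theorem re_im (hu : IsCircularField K P u) (s t : T) :
    ∫ ω, (u s ω).re * (u t ω).im ∂P = (K t s).im / 2 := by
  rw [← hu.im_re]; simp only [mul_comm]

theorem memLp_re (hu : IsCircularField K P u) (t : T) : MemLp (fun ω => (u t ω).re) 2 P :=
  ((hu.gaussian.hasGaussianLaw_eval t).map_fun Complex.reCLM).memLp_two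

theorem memLp_im (hu : IsCircularField K P u) (t : T) : MemLp (fun ω => (u t ω).im) 2 P :=
  ((hu.gaussian.hasGaussianLaw_eval t).map_fun Complex.imCLM).memLp_two

theorem integral_dual (hu : IsCircularField K P u) (t : T) (L : StrongDual ℝ ℂ) :
    ∫ ω, L (u t ω) ∂P = 0 := by
  have := hu.gaussian.isProbabilityMeasure
  have e : ∀ ω, L (u t ω) = L 1 * (u t ω).re + L Complex.I * (u t ω).im :=
    fun ω => StrongDual.apply_complex L _
  simp only [e]
  rw [integral_add (((hu.memLp_re t).integrable one_le_two).const_mul _)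
    (((hu.memLp_im t).integrable one_le_two).const_mul _), integral_const_mul, integral_const_mul,
    hu.mean_re, hu.mean_im]
  simp

theorem integral_dual_mul (hu : IsCircularField K P u) (s t : T) (L L' : StrongDual ℝ ℂ) :
    ∫ ω, L (u s ω) * L' (u t ω) ∂P
      = (L 1 * L' 1 + L Complex.I * L' Complex.I) * (K s t).re / 2
        + (L 1 * L' Complex.I * (K t s).im + L Complex.I * L' 1 * (K s t).im) / 2 := by
  have h1 : Integrable (fun ω => L 1 * L' 1 * ((u s ω).re * (u t ω).re)) P :=
    ((hu.memLp_re s).integrable_mul (hu.memLp_re t)).const_mul _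
  have h2 : Integrable (fun ω => L 1 * L' Complex.I * ((u s ω).re * (u t ω).im)) P :=
    ((hu.memLp_re s).integrable_mul (hu.memLp_im t)).const_mul _
  have h3 : Integrable (fun ω => L Complex.I * L' 1 * ((u s ω).im * (u t ω).re)) P :=
    ((hu.memLp_im s).integrable_mul (hu.memLp_re t)).const_mul _
  have h4 : Integrable (fun ω => L Complex.I * L' Complex.I * ((u s ω).im * (u t ω).im)) P :=
    ((hu.memLp_im s).integrable_mul (hu.memLp_im t)).const_mul _
  have h12 : Integrable (fun ω => L 1 * L' 1 * ((u s ω).re * (u t ω).re)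
    + L 1 * L' Complex.I * ((u s ω).re * (u t ω).im)) P := h1.add h2
  have h34 : Integrable (fun ω => L Complex.I * L' 1 * ((u s ω).im * (u t ω).re)
    + L Complex.I * L' Complex.I * ((u s ω).im * (u t ω).im)) P := h3.add h4
  have e : ∀ ω, L (u s ω) * L' (u t ω)
      = (L 1 * L' 1 * ((u s ω).re * (u t ω).re) + L 1 * L' Complex.I * ((u s ω).re * (u t ω).im))
        + (L Complex.I * L' 1 * ((u s ω).im * (u t ω).re)
          + L Complex.I * L' Complex.I * ((u s ω).im * (u t ω).im)) := fun ω => by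
    rw [StrongDual.apply_complex L (u s ω), StrongDual.apply_complex L' (u t ω)]; ring
  simp only [e]
  rw [integral_add h12 h34, integral_add h1 h2, integral_add h3 h4, integral_const_mul,
    integral_const_mul, integral_const_mul, integral_const_mul, hu.re_re, hu.im_im, hu.im_re,
    hu.re_im]
  ring

/-- The law of a circularly symmetric Gaussian field is determined by its covariance. -/
theorem sameLaw (hu : IsCircularField K P u) (hv : IsCircularField K P' v) : SameLaw P u P' v :=
  hu.gaussian.sameLaw hv.gaussian hu.measurable hv.measurable
    (fun t L => by rw [hu.integral_dual, hv.integral_dual])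
    (fun s t L L' => by rw [hu.integral_dual_mul, hv.integral_dual_mul])

theorem comp_right {S : Type*} (hu : IsCircularField K P u) (f : S → T) :
    IsCircularField (fun s t => K (f s) (f t)) P (fun s => u (f s)) where
  measurable _ := hu.measurable _
  gaussian := hu.gaussian.comp_right f
  mean_re _ := hu.mean_re _
  mean_im _ := hu.mean_im _
  re_re _ _ := hu.re_re _ _
  im_im _ _ := hu.im_im _ _
  im_re _ _ := hu.im_re _ _

theorem congr (hu : IsCircularField K P u) {w : T → Ω → ℂ} (hw : ∀ t, Measurable (w t))
    (h : ∀ t, u t =ᵐ[P] w t) : IsCircularField K P w where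
  measurable := hw
  gaussian := hu.gaussian.congr h
  mean_re t := by
    rw [← hu.mean_re t]
    exact integral_congr_ae (by filter_upwards [h t] with ω h1; rw [h1])
  mean_im t := by
    rw [← hu.mean_im t]
    exact integral_congr_ae (by filter_upwards [h t] with ω h1; rw [h1])
  re_re s t := by
    rw [← hu.re_re s t]
    exact integral_congr_ae (by filter_upwards [h s, h t] with ω h1 h2; rw [h1, h2])
  im_im s t := by
    rw [← hu.im_im s t]
    exact integral_congr_ae (by filter_upwards [h s, h t] with ω h1 h2; rw [h1, h2])
  im_re s t := by
    rw [← hu.im_re s t]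
    exact integral_congr_ae (by filter_upwards [h s, h t] with ω h1 h2; rw [h1, h2])

end IsCircularField

/-- `N_ℂ(0, 1)` is the law of a circularly symmetric Gaussian variable of variance `1`. -/
theorem isCircularField_stdComplexGaussian :
    IsCircularField (T := Unit) (fun _ _ => 1) stdComplexGaussian fun _ z => z := by
  let γ := gaussianReal 0 (1 / 2)
  have hm : Measurable fun p : ℝ × ℝ => (⟨p.1, p.2⟩ : ℂ) := by
    have : (fun p : ℝ × ℝ => (⟨p.1, p.2⟩ : ℂ)) = Complex.equivRealProdCLM.symm := rfl
    rw [this]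
    exact Complex.equivRealProdCLM.symm.continuous.measurable
  have hint : ∀ f : ℂ → ℝ, Continuous f →
      ∫ z, f z ∂stdComplexGaussian = ∫ p : ℝ × ℝ, f ⟨p.1, p.2⟩ ∂γ.prod γ := fun f hf =>
    integral_map hm.aemeasurable hf.aestronglyMeasurable
  have hind : IndepFun (fun p : ℝ × ℝ => p.1) (fun p : ℝ × ℝ => p.2) (γ.prod γ) :=
    indepFun_prod (X := id) (Y := id) measurable_id measurable_id
  have g1 : HasGaussianLaw (fun p : ℝ × ℝ => p.1) (γ.prod γ) := by
    constructor; rw [Measure.map_fst_prod]; simpa using (inferInstance : IsGaussian γ)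
  have g2 : HasGaussianLaw (fun p : ℝ × ℝ => p.2) (γ.prod γ) := by
    constructor; rw [Measure.map_snd_prod]; simpa using (inferInstance : IsGaussian γ)
  have m1 : ∫ x, x ∂γ = 0 := integral_id_gaussianReal
  have v1 : ∫ x, x * x ∂γ = 1 / 2 := by
    have h1 := variance_eq_sub (X := fun x : ℝ => x) (μ := γ) (memLp_id_gaussianReal 2)
    rw [variance_fun_id_gaussianReal, m1] at h1
    simpa [pow_two] using h1.symm
  have p1 : ∀ f : ℝ → ℝ, ∫ p : ℝ × ℝ, f p.1 ∂γ.prod γ = ∫ x, f x ∂γ := fun f => by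
    rw [integral_fun_fst]; simp
  have p2 : ∀ f : ℝ → ℝ, ∫ p : ℝ × ℝ, f p.2 ∂γ.prod γ = ∫ x, f x ∂γ := fun f => by
    rw [integral_fun_snd]; simp
  have hg : HasGaussianLaw (fun z : ℂ => z) stdComplexGaussian := by
    constructor
    have h1 : HasGaussianLaw (fun p : ℝ × ℝ => (p.1, p.2)) (γ.prod γ) :=
      hind.hasGaussianLaw g1 g2
    have h2 := h1.map_fun (Complex.equivRealProdCLM.symm : ℝ × ℝ →L[ℝ] ℂ)
    have h3 := h2.isGaussian_map
    rw [Measure.map_id']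
    exact h3
  refine ⟨fun _ => measurable_id, ⟨fun I => ?_⟩, fun _ => ?_, fun _ => ?_, fun _ _ => ?_,
    fun _ _ => ?_, fun _ _ => ?_⟩
  · exact hg.map_fun (ContinuousLinearMap.pi fun _ : I => ContinuousLinearMap.id ℝ ℂ)
  · rw [hint _ Complex.continuous_re]; exact (p1 fun x => x).trans m1
  · rw [hint _ Complex.continuous_im]; exact (p2 fun x => x).trans m1
  · rw [hint _ (by fun_prop)]
    refine (p1 fun x => x * x).trans ?_
    simp [v1]
  · rw [hint _ (by fun_prop)]
    refine (p2 fun x => x * x).trans ?_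
    simp [v1]
  · rw [hint _ (by fun_prop)]
    have := integral_prod_mul (μ := γ) (ν := γ) (fun x : ℝ => x) (fun x : ℝ => x)
    rw [m1] at this
    simp only [mul_comm] at this ⊢
    simp [this]

theorem IsCircularField.map_eq (hu : IsCircularField K P u) {t : T} (ht : K t t = 1) :
    P.map (u t) = stdComplexGaussian := by
  have h := hu.comp_right fun _ : Unit => t
  simp only [ht] at h
  have h2 := (IdentDistrib.comp (h.sameLaw isCircularField_stdComplexGaussian)
    (measurable_pi_apply ())).map_eq
  simpa [Function.comp_def] using h2

end

/-! ### The complex isonormal process -/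

section

/-- A linear family of Gaussian variables is a Gaussian process, since a linear functional of
finitely many members is a member. -/
theorem isGaussianProcess_of_linear {H Ω : Type*} [AddCommGroup H] [Module ℝ H]
    [MeasurableSpace Ω] {P : Measure Ω} [IsProbabilityMeasure P] (Φ : H →ₗ[ℝ] Lp ℝ 2 P)
    (hΦ : ∀ h, IsGaussian (P.map (Φ h))) : IsGaussianProcess (fun h => ⇑(Φ h)) P where
  hasGaussianLaw I := by
    classical
    have hm : Measurable fun ω => I.restrict (fun h => Φ h ω) :=
      measurable_pi_lambda _ fun h => (Lp.stronglyMeasurable _).measurable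
    refine ⟨isGaussian_of_isGaussian_map fun L => ?_⟩
    rw [Measure.map_map (by fun_prop) hm]
    let c : I → ℝ := fun i => L (Pi.single i 1)
    have h : (L ∘ fun ω => I.restrict (fun h => Φ h ω)) =ᵐ[P] Φ (∑ i, c i • i.1) := by
      rw [map_sum]
      have h2 : ∀ᵐ ω ∂P, ∀ i ∈ (Finset.univ : Finset I), (Φ (c i • i.1)) ω = c i * Φ i.1 ω := by
        rw [Filter.eventually_all_finset]
        intro i _
        rw [map_smul]
        filter_upwards [Lp.coeFn_smul (c i) (Φ i.1)] with ω h3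
        rw [h3, Pi.smul_apply, smul_eq_mul]
      filter_upwards [h2, Lp.coeFn_finsetSum Finset.univ fun i : I => Φ (c i • i.1)] with ω h3 h4
      rw [h4, Finset.sum_apply, Finset.sum_congr rfl h3, Function.comp_apply]
      have h5 : I.restrict (fun h => Φ h ω)
          = ∑ i, (Φ (i : I).1 ω) • (Pi.single i 1 : I → ℝ) := by
        ext j
        simp [Finset.sum_apply, Pi.single_apply]
      rw [h5, map_sum]
      exact Finset.sum_congr rfl fun i _ => by rw [map_smul, smul_eq_mul, mul_comm]
    rw [Measure.map_congr h]
    exact hΦ _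

/-- The complex isonormal process: a complex Hilbert space is embedded isometrically into `L²` of a
probability space as a circularly symmetric Gaussian field. -/
theorem exists_complex_isonormal (H : Type a) [NormedAddCommGroup H] [InnerProductSpace ℂ H]
    [CompleteSpace H] :
    ∃ (Ω : Type a) (_ : MeasurableSpace Ω) (P : Measure Ω) (_ : IsProbabilityMeasure P)
      (Z : H →ₗᵢ[ℂ] Lp ℂ 2 P), IsCircularField (fun f g => inner ℂ g f) P fun h => ⇑(Z h) := by
  let : InnerProductSpace ℝ H := InnerProductSpace.rclikeToReal ℂ H
  have hin : ∀ f g : H, (inner ℝ f g : ℝ) = (inner ℂ f g : ℂ).re := fun f g => rfl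
  have hsm : ∀ (r : ℝ) (f : H), r • f = (r : ℂ) • f := fun r f => rfl
  obtain ⟨Ω, mΩ, P, hP, Φ, hΦ⟩ := exists_isonormal H
  have hmean : ∀ f, ∫ ω, Φ f ω ∂P = 0 := by
    intro f
    have h := integral_map (μ := P) (Lp.aestronglyMeasurable (Φ f)).aemeasurable
      (f := fun x : ℝ => x) (by fun_prop)
    rw [hΦ, integral_id_gaussianReal] at h
    exact h.symm
  have hcov : ∀ f g, ∫ ω, Φ f ω * Φ g ω ∂P = (inner ℂ g f : ℂ).re := by
    intro f g
    have h := Φ.inner_map_map g f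
    rw [L2.inner_def, hin] at h
    simpa using h
  have hgp : IsGaussianProcess (fun h => ⇑(Φ h)) P :=
    isGaussianProcess_of_linear Φ.toLinearMap fun h => by
      change IsGaussian (P.map (Φ h)); rw [hΦ]; infer_instance
  -- with `Φ` the real isonormal process of the underlying real space, `Z h` is `(Φ h + i Φ(-i h)) /
  -- √2`
  let J : Lp ℝ 2 P →L[ℝ] Lp ℂ 2 P := Complex.ofRealCLM.compLpL 2 P
  obtain ⟨r, hc2⟩ : ∃ r : ℝ, r * r = 1 / 2 :=
    ⟨√(1 / 2), Real.mul_self_sqrt (by norm_num)⟩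
  let c : ℂ := r
  let z : H → Lp ℂ 2 P := fun h => c • (J (Φ h) + Complex.I • J (Φ (-Complex.I • h)))
  have hz : ∀ h, z h =ᵐ[P] fun ω => c * (Φ h ω + Complex.I * Φ (-Complex.I • h) ω) := by
    intro h
    filter_upwards [Lp.coeFn_smul c (J (Φ h) + Complex.I • J (Φ (-Complex.I • h))),
      Lp.coeFn_add (J (Φ h)) (Complex.I • J (Φ (-Complex.I • h))),
      Lp.coeFn_smul Complex.I (J (Φ (-Complex.I • h))),
      Complex.ofRealCLM.coeFn_compLpL (p := 2) (Φ h),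
      Complex.ofRealCLM.coeFn_compLpL (p := 2) (Φ (-Complex.I • h))] with ω h1 h2 h3 h4 h5
    rw [h1, Pi.smul_apply, h2, Pi.add_apply, h3, Pi.smul_apply, h4, h5]
    simp
  let w : H → Ω → ℂ := fun h ω => ⟨r * Φ h ω, r * Φ (-Complex.I • h) ω⟩
  have hzw : ∀ h, w h =ᵐ[P] z h := by
    intro h
    filter_upwards [hz h] with ω hω
    rw [hω]
    apply Complex.ext <;> simp [w, c]
  have hI : ∀ h : H, -Complex.I • h = -(Complex.I • h) := fun h => neg_smul _ _
  have hw : IsCircularField (fun f g => inner ℂ g f) P w := by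
    have e : ∀ f g, ∫ ω, r * Φ f ω * (r * Φ g ω) ∂P = (inner ℂ g f : ℂ).re / 2 := by
      intro f g
      have e1 : ∀ ω, r * Φ f ω * (r * Φ g ω) = (1 / 2 : ℝ) * (Φ f ω * Φ g ω) :=
        fun ω => by rw [← hc2]; ring
      simp only [e1]
      rw [integral_const_mul, hcov]
      ring
    refine ⟨fun h => ?_, ?_, fun h => ?_, fun h => ?_, fun f g => e f g, fun f g => ?_,
      fun f g => ?_⟩
    · have h1 : Measurable fun ω => (((r * Φ h ω : ℝ) : ℂ)
          + (r * Φ (-Complex.I • h) ω : ℝ) * Complex.I) := by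
        have := (Lp.stronglyMeasurable (Φ h)).measurable
        have := (Lp.stronglyMeasurable (Φ (-Complex.I • h))).measurable
        fun_prop
      convert h1 using 2 with ω
      apply Complex.ext <;> simp [w]
    · classical
      refine hgp.of_isGaussianProcess fun h => ⟨{h, -Complex.I • h},
        r • ((ContinuousLinearMap.proj ⟨h, by simp⟩).smulRight (1 : ℂ)
          + (ContinuousLinearMap.proj ⟨-Complex.I • h, by simp⟩).smulRight Complex.I),
        fun ω => ?_⟩
      apply Complex.ext <;> simp [w]
    · simp only [w]; rw [integral_const_mul, hmean, mul_zero]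
    · simp only [w]; rw [integral_const_mul, hmean, mul_zero]
    · refine (e _ _).trans ?_
      simp only [hI, inner_neg_neg, inner_smul_left, inner_smul_right]
      rw [← mul_assoc]; simp
    · refine (e _ _).trans ?_
      simp only [hI, inner_neg_right, inner_smul_right]
      simp
  have hzc := hw.congr (fun h => (Lp.stronglyMeasurable (z h)).measurable) hzw
  have hadd : ∀ f g, z (f + g) = z f + z g := by
    intro f g
    simp only [z, smul_add, map_add]
    abel
  have hsmul : ∀ (t : ℂ) f, z (t • f) = t • z f := by
    intro t f
    have h1 : t • f = t.re • f + (-t.im) • (-Complex.I • f) := by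
      rw [hsm, hsm, smul_smul, ← add_smul]
      congr 1
      apply Complex.ext <;> simp
    have h2 : -Complex.I • (t • f) = t.re • (-Complex.I • f) + t.im • f := by
      rw [hsm, hsm, smul_smul, smul_smul, ← add_smul]
      congr 1
      apply Complex.ext <;> simp
    simp only [z]
    rw [h2, h1]
    simp only [map_add, map_smul]
    match_scalars
    · apply Complex.ext <;> simp <;> ring
    · apply Complex.ext <;> simp <;> ring
  let Z : H →ₗ[ℂ] Lp ℂ 2 P := { toFun := z, map_add' := hadd, map_smul' := hsmul }
  refine ⟨Ω, mΩ, P, hP, ⟨Z, fun h => ?_⟩, hzc⟩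
  have h1 : ‖Z h‖ ^ 2 = ‖h‖ ^ 2 := by
    rw [← inner_self_eq_norm_sq (𝕜 := ℂ), ← inner_self_eq_norm_sq (𝕜 := ℂ) h, L2.inner_def,
      ← integral_re (L2.integrable_inner _ _)]
    have h2 : ∀ ω, RCLike.re (inner ℂ (Z h ω) (Z h ω) : ℂ)
        = (z h ω).re * (z h ω).re + (z h ω).im * (z h ω).im := fun ω => by
      change (z h ω * (starRingEnd ℂ) (z h ω)).re = _
      rw [Complex.mul_conj, Complex.ofReal_re, Complex.normSq_apply]
    have h3 : Integrable (fun ω => (z h ω).re * (z h ω).re) P :=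
      (hzc.memLp_re h).integrable_mul (hzc.memLp_re h)
    have h4 : Integrable (fun ω => (z h ω).im * (z h ω).im) P :=
      (hzc.memLp_im h).integrable_mul (hzc.memLp_im h)
    simp only [h2]
    rw [integral_add h3 h4, hzc.re_re h h, hzc.im_im h h]
    exact add_halves _
  exact (sq_eq_sq₀ (norm_nonneg _) (norm_nonneg _)).1 h1

end

/-! ### Sample paths of random moment functionals -/

section

variable {n : ℕ} {Ω : Type*} [MeasurableSpace Ω] {P : Measure Ω}

/-- A random moment functional, i.e. a linear map `A` into the classes of random variables, is
realised by an honest linear form at each `ω`, by prescribing its values on monomials. -/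
noncomputable def sampleMoment (A : MvPolynomial (Fin n) ℂ →ₗ[ℂ] Lp ℂ 2 P) (ω : Ω) :
    MvPolynomial (Fin n) ℂ →ₗ[ℂ] ℂ :=
  (MvPolynomial.basisMonomials (Fin n) ℂ).constr ℂ fun s => A (MvPolynomial.monomial s 1) ω

variable (A : MvPolynomial (Fin n) ℂ →ₗ[ℂ] Lp ℂ 2 P)

theorem sampleMoment_apply (ω : Ω) (p : MvPolynomial (Fin n) ℂ) :
    sampleMoment A ω p = ∑ s ∈ p.support, p.coeff s * A (MvPolynomial.monomial s 1) ω := by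
  rw [sampleMoment, Module.Basis.constr_apply]
  rfl

theorem measurable_sampleMoment (p : MvPolynomial (Fin n) ℂ) :
    Measurable fun ω => sampleMoment A ω p := by
  simp only [sampleMoment_apply]
  exact Finset.measurable_fun_sum _ fun s _ =>
    (Lp.stronglyMeasurable (A (MvPolynomial.monomial s 1))).measurable.const_mul _

/-- The realisation agrees with `A` almost surely, for each polynomial separately. -/
theorem sampleMoment_ae (p : MvPolynomial (Fin n) ℂ) :
    (fun ω => sampleMoment A ω p) =ᵐ[P] A p := by
  have hp : A p = ∑ s ∈ p.support, p.coeff s • A (MvPolynomial.monomial s 1) := by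
    conv_lhs => rw [p.as_sum]
    rw [map_sum]
    refine Finset.sum_congr rfl fun s _ => ?_
    rw [← map_smul, MvPolynomial.smul_monomial, smul_eq_mul, mul_one]
  have h1 : ∀ᵐ ω ∂P, ∀ s ∈ p.support, (p.coeff s • A (MvPolynomial.monomial s 1) : Lp ℂ 2 P) ω
      = p.coeff s * A (MvPolynomial.monomial s 1) ω := by
    rw [Filter.eventually_all_finset]
    intro s _
    filter_upwards [Lp.coeFn_smul (p.coeff s) (A (MvPolynomial.monomial s 1))] with ω h
    rw [h, Pi.smul_apply, smul_eq_mul]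
  rw [hp]
  filter_upwards [h1, Lp.coeFn_finsetSum p.support
    fun s => (p.coeff s • A (MvPolynomial.monomial s 1) : Lp ℂ 2 P)] with ω h2 h3
  rw [h3, Finset.sum_apply, Finset.sum_congr rfl h2, sampleMoment_apply]

/-- The relation holds for all polynomials at once outside one null set, because it suffices to
have it on the countably many monomials. -/
theorem ae_sampleMoment_trace {r : MvPolynomial (Fin n) ℂ} (hA : ∀ p, A (p * r) = A p) :
    ∀ᵐ ω ∂P, ∀ p, sampleMoment A ω (p * r) = sampleMoment A ω p := by
  have h : ∀ᵐ ω ∂P, ∀ s : Fin n →₀ ℕ, sampleMoment A ω (MvPolynomial.monomial s 1 * r)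
      = sampleMoment A ω (MvPolynomial.monomial s 1) := by
    rw [ae_all_iff]
    intro s
    filter_upwards [sampleMoment_ae A (MvPolynomial.monomial s 1 * r),
      sampleMoment_ae A (MvPolynomial.monomial s 1)] with ω h1 h2
    rw [h1, h2, hA]
  filter_upwards [h] with ω hω p
  have e : (sampleMoment A ω).comp (LinearMap.mulRight ℂ r) = sampleMoment A ω :=
    (MvPolynomial.basisMonomials (Fin n) ℂ).ext fun s => by simpa using hω s
  exact LinearMap.congr_fun e p

theorem integral_norm_sq_Lp (f : Lp ℂ 2 P) : ∫ ω, ‖f ω‖ ^ 2 ∂P = ‖f‖ ^ 2 := by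
  rw [← inner_self_eq_norm_sq (𝕜 := ℂ), L2.inner_def, ← integral_re (L2.integrable_inner _ _)]
  simp only [inner_self_eq_norm_sq]

/-- If the moments of each degree are bounded in mean square, then almost surely they grow at most
linearly in the degree, since `∑ (m + 1)⁻² < ∞`. -/
theorem ae_exists_sampleMoment_bound
    (hA : ∀ m : ℕ, ∑ i : Fin m → Fin n, ‖A (∏ k, MvPolynomial.X (i k))‖ ^ 2 ≤ 1) :
    ∀ᵐ ω ∂P, ∃ C : ℝ, 0 ≤ C ∧ ∀ m : ℕ,
      ∑ i : Fin m → Fin n, ‖sampleMoment A ω (∏ k, MvPolynomial.X (i k))‖ ^ 2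
        ≤ (C * ((m : ℝ) + 1)) ^ 2 := by
  let S : ℕ → Ω → ℝ := fun m ω =>
    ∑ i : Fin m → Fin n, ‖sampleMoment A ω (∏ k, MvPolynomial.X (i k))‖ ^ 2
  have hS0 : ∀ m ω, 0 ≤ S m ω := fun m ω => by positivity
  have hSm : ∀ m, Measurable (S m) := fun m => Finset.measurable_fun_sum _ fun i _ =>
    ((measurable_sampleMoment A _).norm.pow_const 2)
  have hSi : ∀ (m : ℕ) (i : Fin m → Fin n),
      Integrable (fun ω => ‖sampleMoment A ω (∏ k, MvPolynomial.X (i k))‖ ^ 2) P := fun m i => by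
    refine ((Lp.memLp (A (∏ k, MvPolynomial.X (i k)))).integrable_norm_pow two_ne_zero).congr ?_
    filter_upwards [sampleMoment_ae A (∏ k, MvPolynomial.X (i k))] with ω hω
    rw [hω]
  have hSint : ∀ m, ∫ ω, S m ω ∂P ≤ 1 := by
    intro m
    rw [integral_finsetSum _ fun i _ => hSi m i]
    refine le_trans (le_of_eq (Finset.sum_congr rfl fun i _ => ?_)) (hA m)
    rw [← integral_norm_sq_Lp]
    refine integral_congr_ae ?_
    filter_upwards [sampleMoment_ae A (∏ k, MvPolynomial.X (i k))] with ω hω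
    rw [hω]
  let w : ℕ → ℝ := fun m => (((m : ℝ) + 1) ^ 2)⁻¹
  have hw0 : ∀ m, 0 < w m := fun m => by positivity
  have hw : Summable w := by
    have := (summable_nat_add_iff 1).2 (Real.summable_nat_pow_inv.2 one_lt_two)
    simpa [w] using this
  have hfin : ∫⁻ ω, ∑' m, ENNReal.ofReal (w m * S m ω) ∂P ≠ ⊤ := by
    rw [lintegral_tsum fun m => ((hSm m).const_mul _).ennreal_ofReal.aemeasurable]
    refine ne_top_of_le_ne_top hw.tsum_ofReal_ne_top (ENNReal.tsum_le_tsum fun m => ?_)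
    rw [← ofReal_integral_eq_lintegral_ofReal
      ((integrable_finsetSum _ fun i _ => hSi m i).const_mul _)
      (Eventually.of_forall fun ω => mul_nonneg (hw0 m).le (hS0 m ω))]
    refine ENNReal.ofReal_le_ofReal ?_
    rw [integral_const_mul]
    exact (mul_le_mul_of_nonneg_left (hSint m) (hw0 m).le).trans_eq (mul_one _)
  filter_upwards [ae_lt_top
    (Measurable.tsum fun m => ((hSm m).const_mul _).ennreal_ofReal) hfin] with ω hω
  set D := (∑' m, ENNReal.ofReal (w m * S m ω)).toReal with hD
  refine ⟨√D, Real.sqrt_nonneg _, fun m => ?_⟩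
  have h1 : w m * S m ω ≤ D := by
    rw [hD, ← ENNReal.ofReal_le_iff_le_toReal hω.ne]
    exact ENNReal.le_tsum m
  rw [mul_pow, Real.sq_sqrt ENNReal.toReal_nonneg]
  have h2 : S m ω = (w m * S m ω) * ((m : ℝ) + 1) ^ 2 := by
    have : ((m : ℝ) + 1) ≠ 0 := by positivity
    simp only [w]; field_simp
  change S m ω ≤ _
  rw [h2]
  gcongr

end

/-! ### The random wave attached to an isonormal process on the sphere -/

section

variable {n : ℕ}

/-- The restriction of polynomials to the sphere. -/
noncomputable def polySphere (n : ℕ) :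
    MvPolynomial (Fin n) ℂ →ₐ[ℂ] C(Metric.sphere (0 : EuclideanSpace ℝ (Fin n)) 1, ℂ) :=
  MvPolynomial.aeval fun j => ⟨fun u => (u.1 j : ℂ), by fun_prop⟩

theorem polySphere_apply (p : MvPolynomial (Fin n) ℂ)
    (u : Metric.sphere (0 : EuclideanSpace ℝ (Fin n)) 1) :
    polySphere n p u = evalSphere u p := by
  have h : (ContinuousMap.evalAlgHom ℂ ℂ u).comp (polySphere n) = evalSphere u :=
    MvPolynomial.algHom_ext fun j => by simp [polySphere, evalSphere]
  exact DFunLike.congr_fun h p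

/-- Polynomials as square integrable functions on the sphere. -/
noncomputable def polySphereLp (n : ℕ) : MvPolynomial (Fin n) ℂ →ₗ[ℂ] Lp ℂ 2 (uniformSphere n) :=
  (ContinuousMap.toLp 2 (uniformSphere n) ℂ).toLinearMap ∘ₗ (polySphere n).toLinearMap

theorem polySphereLp_mul_trace (p : MvPolynomial (Fin n) ℂ) :
    polySphereLp n (p * ∑ j, MvPolynomial.X j * MvPolynomial.X j) = polySphereLp n p := by
  have : polySphere n (p * ∑ j, MvPolynomial.X j * MvPolynomial.X j) = polySphere n p := by
    ext u
    rw [polySphere_apply, polySphere_apply, evalSphere_trace]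
  simp [polySphereLp, this]

theorem sum_norm_sq_polySphereLp (hn : 1 ≤ n) (m : ℕ) :
    ∑ i : Fin m → Fin n, ‖polySphereLp n (∏ k, MvPolynomial.X (i k))‖ ^ 2 = 1 := by
  have := isProbabilityMeasure_uniformSphere hn
  have h : ∀ i : Fin m → Fin n, ‖polySphereLp n (∏ k, MvPolynomial.X (i k))‖ ^ 2
      = ∫ u, ‖polySphere n (∏ k, MvPolynomial.X (i k)) u‖ ^ 2 ∂uniformSphere n := fun i => by
    rw [← integral_norm_sq_Lp]
    refine integral_congr_ae ?_
    filter_upwards [ContinuousMap.coeFn_toLp (p := 2) (𝕜 := ℂ) (uniformSphere n)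
      (polySphere n (∏ k, MvPolynomial.X (i k)))] with u hu
    exact congrArg (fun z : ℂ => ‖z‖ ^ 2) hu
  simp only [h]
  rw [← integral_finsetSum _ fun i _ => integrable_uniformSphere (by fun_prop)]
  simp only [polySphere_apply, sum_norm_sq_evalSphere_prod_X]
  simp

/-- The expansion of plane waves converges in `L²` of the sphere. -/
theorem hasSum_planeWaveLp (hn : 2 ≤ n) (x : HyperbolicSpace n) (α : ℝ) {μ : ℂ}
    (hμ : μ = -(hypSigma n : ℂ) + Complex.I * (α : ℂ)) :
    HasSum (fun m : ℕ => (waveCoeff μ m * (x.1.1 : ℂ) ^ (μ - m - (0 : ℕ))) •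
      polySphereLp n (linForm x.1.2 ^ m * 1)) (planeWaveLp x α) := by
  have hμ0 : μ.re ≤ 0 := by rw [hμ, waveExponent_re]; linarith [hypSigma_pos hn]
  let g : ℕ → C(Metric.sphere (0 : EuclideanSpace ℝ (Fin n)) 1, ℂ) := fun m =>
    (waveCoeff μ m * (x.1.1 : ℂ) ^ (μ - m - (0 : ℕ))) • polySphere n (linForm x.1.2 ^ m * 1)
  have hs : 0 < x.1.1 := x.2.1
  have hsum : Summable g := by
    refine Summable.of_norm_bounded ((isUnitDiscSeq_waveCoeff μ 1 (‖x.1.2‖ / x.1.1)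
      (by positivity) ((div_lt_one hs).2 x.norm_lt)).mul_left
      (x.1.1 ^ (μ.re - (0 : ℕ)) * 1)) fun m => ?_
    refine (ContinuousMap.norm_le _ (by positivity)).2 fun u => ?_
    have h := norm_waveTerm_le (ℓ := (evalSphere u).toLinearMap) (Y := 1) hμ0 (waveCoeff μ) 0
      zero_le_one (fun m v => ?_) hs le_rfl (by positivity)
      (by rw [div_mul_cancel₀ _ hs.ne'] : ‖x.1.2‖ ≤ (‖x.1.2‖ / x.1.1) * x.1.1) m
    · simpa [g, polySphere_apply, mul_assoc] using h
    · have h1 : |⟪v, u.1⟫| ≤ ‖v‖ := by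
        simpa using abs_real_inner_le_norm v u.1
      have h2 : (1 : ℝ) ≤ (m : ℝ) + 1 := by linarith [(Nat.cast_nonneg m : (0 : ℝ) ≤ m)]
      rw [mul_one, AlgHom.toLinearMap_apply, map_pow, evalSphere_linForm, norm_pow,
        Complex.norm_real, Real.norm_eq_abs, one_mul]
      calc |⟪v, u.1⟫| ^ m ≤ ‖v‖ ^ m := by gcongr
        _ ≤ ((m : ℝ) + 1) * ‖v‖ ^ m := le_mul_of_one_le_left (by positivity) h2
  obtain ⟨f, hf⟩ := hsum
  have hfu : ∀ u, f u = planeWave x α u := fun u => by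
    have h1 := ((ContinuousMap.evalCLM ℂ u).hasSum hf)
    have h2 := hasSum_planeWave x α u hμ
    refine h1.unique ?_
    simpa [g, polySphere_apply] using h2
  have h := (ContinuousMap.toLp 2 (uniformSphere n) ℂ).hasSum hf
  have e : ContinuousMap.toLp 2 (uniformSphere n) ℂ f = planeWaveLp x α := by
    refine Lp.ext ?_
    filter_upwards [ContinuousMap.coeFn_toLp (p := 2) (𝕜 := ℂ) (uniformSphere n) f,
      (memLp_planeWave x α).coeFn_toLp] with u h1 h2
    rw [h1, hfu, planeWaveLp, h2]
  rw [e] at h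
  refine h.congr_fun fun m => ?_
  simp [g, polySphereLp]

/-- The kernel of the complex white noise evaluated on plane waves. -/
theorem inner_planeWaveLp (hn : 2 ≤ n) (x y : HyperbolicSpace n) (α : ℝ) :
    inner ℂ (planeWaveLp y α) (planeWaveLp x α) = sphericalFunction n α (hypDist x y) := by
  rw [L2.inner_def, ← integral_planeWave_mul_conj hn]
  refine integral_congr_ae ?_
  filter_upwards [(memLp_planeWave x α).coeFn_toLp, (memLp_planeWave y α).coeFn_toLp] with u h1 h2
  rw [planeWaveLp, planeWaveLp, h1, h2]
  rfl

/-- A circularly symmetric field with covariance `F(d(x, y))` all of whose samples are smooth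
eigenfunctions. -/
theorem exists_circularField (hn : 2 ≤ n) (α : ℝ) :
    ∃ (Ω : Type) (_ : MeasurableSpace Ω) (P : Measure Ω) (_ : IsProbabilityMeasure P)
      (u : HyperbolicSpace n → Ω → ℂ),
      IsCircularField (fun x y => sphericalFunction n α (hypDist x y)) P u ∧
      ∀ ω, IsHypEigenfunction (hypSigma n ^ 2 + α ^ 2) fun x => u x ω := by
  classical
  obtain ⟨Ω, mΩ, P, hP, Z, hZ⟩ := exists_complex_isonormal (Lp ℂ 2 (uniformSphere n))
  set μ : ℂ := -(hypSigma n : ℂ) + Complex.I * (α : ℂ) with hμ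
  have hμ0 : μ.re ≤ 0 := by rw [hμ, waveExponent_re]; linarith [hypSigma_pos hn]
  let A : MvPolynomial (Fin n) ℂ →ₗ[ℂ] Lp ℂ 2 P := Z.toLinearMap ∘ₗ polySphereLp n
  have hgood : ∀ᵐ ω ∂P, ∃ C, IsSphericalMoment (sampleMoment A ω) C := by
    have h1 := ae_sampleMoment_trace A (r := ∑ j, MvPolynomial.X j * MvPolynomial.X j)
      fun p => by simp only [A, LinearMap.comp_apply, polySphereLp_mul_trace]
    have h2 := ae_exists_sampleMoment_bound A fun m => by
      rw [← sum_norm_sq_polySphereLp (by omega : 1 ≤ n) m]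
      exact le_of_eq (Finset.sum_congr rfl fun i _ => by simp [A])
    filter_upwards [h1, h2] with ω ht ⟨C, hC, hb⟩
    exact ⟨C, ht, hb, hC⟩
  -- outside a measurable set `B` of full measure the moment functional is replaced by `0`, so that
  -- every sample is an eigenfunction
  obtain ⟨B, hB, hBm, hB0⟩ : ∃ B : Set Ω, (∀ ω ∈ B, ∃ C, IsSphericalMoment (sampleMoment A ω) C) ∧
      MeasurableSet B ∧ ∀ᵐ ω ∂P, ω ∈ B := by
    obtain ⟨B, h1, h2, h3⟩ := Filter.Eventually.exists_measurable_mem hgood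
    exact ⟨B, h3, h2, h1⟩
  let ℓ : Ω → MvPolynomial (Fin n) ℂ →ₗ[ℂ] ℂ := fun ω => if ω ∈ B then sampleMoment A ω else 0
  have hℓ : ∀ ω, ∃ C, IsSphericalMoment (ℓ ω) C := by
    intro ω
    by_cases hω : ω ∈ B
    · simpa [ℓ, hω] using hB ω hω
    · exact ⟨0, by simp [ℓ, hω], by simp [ℓ, hω], le_rfl⟩
  have hℓm : ∀ p, Measurable fun ω => ℓ ω p := by
    intro p
    have : (fun ω => ℓ ω p) = B.indicator fun ω => sampleMoment A ω p := by
      ext ω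
      by_cases hω : ω ∈ B <;> simp [ℓ, hω]
    rw [this]
    exact (measurable_sampleMoment A p).indicator hBm
  have hℓA : ∀ p, (fun ω => ℓ ω p) =ᵐ[P] A p := by
    intro p
    filter_upwards [hB0, sampleMoment_ae A p] with ω h1 h2
    simp [ℓ, h1, h2]
  let u : HyperbolicSpace n → Ω → ℂ := fun x ω => waveSum μ (ℓ ω) (waveCoeff μ) 0 1 x.1.1 x.1.2
  have hu : ∀ x ω, Tendsto (fun N => ∑ m ∈ Finset.range N,
      waveCoeff μ m * (x.1.1 : ℂ) ^ (μ - m - (0 : ℕ)) * ℓ ω (linForm x.1.2 ^ m * 1))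
      atTop (𝓝 (u x ω)) := by
    intro x ω
    obtain ⟨C, hC⟩ := hℓ ω
    exact (summable_waveTerm hμ0 (isUnitDiscSeq_waveCoeff μ) 0 hC.isTame_one
      x.norm_lt).hasSum.tendsto_sum_nat
  have hpm : ∀ (x : HyperbolicSpace n) (N : ℕ), Measurable fun ω => ∑ m ∈ Finset.range N,
      waveCoeff μ m * (x.1.1 : ℂ) ^ (μ - m - (0 : ℕ)) * ℓ ω (linForm x.1.2 ^ m * 1) :=
    fun x N => Finset.measurable_fun_sum _ fun m _ => (hℓm _).const_mul _
  have hum : ∀ x, Measurable (u x) := fun x =>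
    measurable_of_tendsto_metrizable (hpm x) (tendsto_pi_nhds.2 fun ω => hu x ω)
  -- the partial sums converge to `u x` pointwise and to `Z (planeWaveLp x α)` in `L²`, so the two
  -- limits agree almost surely
  have huZ : ∀ x, Z (planeWaveLp x α) =ᵐ[P] u x := by
    intro x
    have h1 := (Z.toContinuousLinearMap.hasSum (hasSum_planeWaveLp hn x α hμ)).tendsto_sum_nat
    have h2 := tendstoInMeasure_of_tendsto_Lp h1
    have h3 := tendstoInMeasure_of_tendsto_ae (μ := P)
      (fun N => (hpm x N).aestronglyMeasurable) (Eventually.of_forall fun ω => hu x ω)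
    refine tendstoInMeasure_ae_unique h2 (h3.congr (fun N => ?_) EventuallyEq.rfl)
    let c : ℕ → ℂ := fun m => waveCoeff μ m * (x.1.1 : ℂ) ^ (μ - m - (0 : ℕ))
    have e1 : ∑ m ∈ Finset.range N, Z.toContinuousLinearMap
        (c m • polySphereLp n (linForm x.1.2 ^ m * 1))
        = A (∑ m ∈ Finset.range N, c m • (linForm x.1.2 ^ m * 1)) := by
      simp [A, map_sum]
    change _ =ᵐ[P] ⇑(∑ m ∈ Finset.range N, Z.toContinuousLinearMap
        (c m • polySphereLp n (linForm x.1.2 ^ m * 1)))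
    rw [e1]
    refine EventuallyEq.trans ?_ (hℓA _)
    refine Eventually.of_forall fun ω => ?_
    simp [c]
  refine ⟨Ω, mΩ, P, hP, u, ?_, fun ω => ?_⟩
  · have h := (hZ.comp_right fun x => planeWaveLp x α).congr hum huZ
    simpa only [inner_planeWaveLp hn] using h
  · obtain ⟨C, hC⟩ := hℓ ω
    exact isHypEigenfunction_waveSum hC hμ0 (waveExponent_mul n α)

end

/-! ### Real and complex waves in terms of their covariances -/

section

variable {T Ω Ω' : Type*} [MeasurableSpace Ω] [MeasurableSpace Ω'] {P : Measure Ω} {P' : Measure Ω'}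

theorem StrongDual.apply_real (L : StrongDual ℝ ℝ) (x : ℝ) : L x = L 1 * x := by
  conv_lhs => rw [← mul_one x, ← smul_eq_mul, map_smul, smul_eq_mul, mul_comm]

/-- The law of a centred real Gaussian field is determined by its covariance. -/
theorem sameLaw_of_centered_real {u : T → Ω → ℝ} {v : T → Ω' → ℝ}
    (hu : IsGaussianProcess u P) (hv : IsGaussianProcess v P')
    (mu : ∀ t, Measurable (u t)) (mv : ∀ t, Measurable (v t))
    (hu0 : ∀ t, ∫ ω, u t ω ∂P = 0) (hv0 : ∀ t, ∫ ω, v t ω ∂P' = 0)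
    (hcov : ∀ s t, ∫ ω, u s ω * u t ω ∂P = ∫ ω, v s ω * v t ω ∂P') : SameLaw P u P' v := by
  have e : ∀ (L L' : StrongDual ℝ ℝ) (x y : ℝ), L x * L' y = L 1 * L' 1 * (x * y) :=
    fun L L' x y => by rw [StrongDual.apply_real L x, StrongDual.apply_real L' y]; ring
  refine hu.sameLaw hv mu mv (fun t L => ?_) fun s t L L' => ?_
  · have e1 : ∀ x, L x = L 1 * x := StrongDual.apply_real L
    rw [integral_congr_ae (Eventually.of_forall fun ω => e1 (u t ω)),
      integral_congr_ae (Eventually.of_forall fun ω => e1 (v t ω)),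
      integral_const_mul, integral_const_mul, hu0, hv0]
  · rw [integral_congr_ae (Eventually.of_forall fun ω => e L L' (u s ω) (u t ω)),
      integral_congr_ae (Eventually.of_forall fun ω => e L L' (v s ω) (v t ω)),
      integral_const_mul, integral_const_mul, hcov]

variable {n : ℕ} {lam α : ℝ}

theorem hypDist_nonneg (x y : HyperbolicSpace n) : 0 ≤ hypDist x y := by
  refine Real.arcosh_nonneg ?_
  have hsq : ∀ z : HyperbolicSpace n, z.1.1 ^ 2 = 1 + ‖z.1.2‖ ^ 2 := fun z => by
    have := z.2.2
    rw [minkowski, real_inner_self_eq_norm_sq] at this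
    linarith
  have h := real_inner_le_norm x.1.2 y.1.2
  have h1 : 1 + ‖x.1.2‖ * ‖y.1.2‖ ≤ x.1.1 * y.1.1 := by
    refine (pow_le_pow_iff_left₀ (by positivity) (mul_nonneg x.2.1.le y.2.1.le) two_ne_zero).1 ?_
    rw [mul_pow, hsq, hsq]
    linarith [sq_nonneg (‖x.1.2‖ - ‖y.1.2‖)]
  rw [minkowski]
  linarith

theorem hypDist_self (x : HyperbolicSpace n) : hypDist x x = 0 := by
  rw [hypDist, x.2.2, Real.arcosh_zero]

theorem sphericalFunction_hypDist_im (hn : 2 ≤ n) (x y : HyperbolicSpace n) :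
    (sphericalFunction n α (hypDist x y)).im = 0 :=
  sphericalFunction_im hn (hypDist_nonneg x y)

theorem IsRealWave.integral_eq_zero {u : HyperbolicSpace n → Ω → ℝ} (hu : IsRealWave n lam P u)
    (x : HyperbolicSpace n) : ∫ ω, u x ω ∂P = 0 := by
  rw [hu.integral_marginal x (φ := fun z : ℝ => z) continuous_id, integral_id_gaussianReal]

theorem IsRealWave.integral_mul (hn : 2 ≤ n) (hlam : lam = hypSigma n ^ 2 + α ^ 2)
    {u : HyperbolicSpace n → Ω → ℝ} (hu : IsRealWave n lam P u) (x y : HyperbolicSpace n) :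
    ∫ ω, u x ω * u y ω ∂P = (sphericalFunction n α (hypDist x y)).re := by
  have h := IsHypGaussianWave.integral_mul hn hlam hu (.id ℝ ℝ) (.id ℝ ℝ) x y
  have h1 : ∫ z : ℝ, z * z ∂gaussianReal 0 1 = 1 := by
    have h1 := variance_eq_sub (X := fun x : ℝ => x) (μ := gaussianReal 0 1)
      (memLp_id_gaussianReal 2)
    rw [variance_fun_id_gaussianReal, integral_id_gaussianReal] at h1
    simpa [pow_two] using h1.symm
  simpa [h1] using h

/-- A centred Gaussian field with covariance `F(d(x, y))` and smooth eigenfunctions as samples is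
the real wave. -/
theorem isRealWave_of_integral_mul (hn : 2 ≤ n) {u : HyperbolicSpace n → Ω → ℝ}
    (hm : ∀ x, Measurable (u x)) (hg : IsGaussianProcess u P) (h0 : ∀ x, ∫ ω, u x ω ∂P = 0)
    (hcov : ∀ x y, ∫ ω, u x ω * u y ω ∂P = (sphericalFunction n α (hypDist x y)).re)
    (he : ∀ᵐ ω ∂P, IsHypEigenfunction lam fun x => u x ω) : IsRealWave n lam P u where
  measurable := hm
  gaussian := hg
  marginal x := by
    have := hg.isProbabilityMeasure
    rw [(hg.hasGaussianLaw_eval x).map_eq_gaussianReal, h0,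
      variance_eq_sub (hg.hasGaussianLaw_eval x).memLp_two, h0]
    simp [pow_two, hcov, hypDist_self, sphericalFunction_zero hn]
  invariant g hgi := sameLaw_of_centered_real (hg.comp_right g) hg (fun x => hm _) hm
    (fun x => h0 _) h0 fun x y => by
      simp only [hcov]
      rw [hgi]
  eigen := he

/-- The complex counterpart of `isRealWave_of_integral_mul`. -/
theorem IsCircularField.isComplexWave (hn : 2 ≤ n) {u : HyperbolicSpace n → Ω → ℂ}
    (hu : IsCircularField (fun x y => sphericalFunction n α (hypDist x y)) P u)
    (he : ∀ᵐ ω ∂P, IsHypEigenfunction lam fun x => u x ω) : IsComplexWave n lam P u where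
  measurable := hu.measurable
  gaussian := hu.gaussian
  marginal x := hu.map_eq (by rw [hypDist_self, sphericalFunction_zero hn])
  invariant g hgi := by
    have h := hu.comp_right g
    simp only [hgi _ _] at h
    exact h.sameLaw hu
  eigen := he

/-- The covariance structure of the complex wave. -/
theorem IsComplexWave.isCircularField (hn : 2 ≤ n) (hlam : lam = hypSigma n ^ 2 + α ^ 2)
    {u : HyperbolicSpace n → Ω → ℂ} (hu : IsComplexWave n lam P u) :
    IsCircularField (fun x y => sphericalFunction n α (hypDist x y)) P u where
  measurable := hu.measurable
  gaussian := hu.gaussian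
  mean_re x := (hu.integral_marginal x Complex.continuous_re).trans
    (isCircularField_stdComplexGaussian.mean_re ())
  mean_im x := (hu.integral_marginal x Complex.continuous_im).trans
    (isCircularField_stdComplexGaussian.mean_im ())
  re_re x y := by
    have h := IsHypGaussianWave.integral_mul hn hlam hu Complex.reCLM Complex.reCLM x y
    have h1 := isCircularField_stdComplexGaussian.re_re () ()
    simp only [Complex.reCLM_apply] at h
    rw [h, h1, Complex.one_re]; ring
  im_im x y := by
    have h := IsHypGaussianWave.integral_mul hn hlam hu Complex.imCLM Complex.imCLM x y
    have h1 := isCircularField_stdComplexGaussian.im_im () ()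
    simp only [Complex.imCLM_apply] at h
    rw [h, h1, Complex.one_re]; ring
  im_re x y := by
    have h := IsHypGaussianWave.integral_mul hn hlam hu Complex.imCLM Complex.reCLM x y
    have h1 := isCircularField_stdComplexGaussian.im_re () ()
    simp only [Complex.imCLM_apply, Complex.reCLM_apply] at h
    rw [h, h1, Complex.one_im, sphericalFunction_hypDist_im hn]; ring

/-- The law `N_ℂ(0, 1)` has no atom at `0`. -/
theorem stdComplexGaussian_singleton_zero : stdComplexGaussian {0} = 0 := by
  have hm : Measurable fun p : ℝ × ℝ => (⟨p.1, p.2⟩ : ℂ) :=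
    Complex.equivRealProdCLM.symm.continuous.measurable
  have := nullSingletonClass_gaussianReal (μ := 0) (v := 1 / 2) (by norm_num)
  rw [stdComplexGaussian, Measure.map_apply hm (measurableSet_singleton _)]
  refine measure_mono_null (t := {0} ×ˢ univ) (fun p hp => ?_) ?_
  · exact ⟨congrArg Complex.re hp, trivial⟩
  · rw [Measure.prod_prod, measure_singleton, zero_mul]

end

section

variable {T Ω : Type*} [MeasurableSpace Ω] {P : Measure Ω} {K : T → T → ℂ} {u : T → Ω → ℂ}

namespace IsCircularField

theorem isGaussianProcess_re (hu : IsCircularField K P u) :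
    IsGaussianProcess (fun t ω => √2 * (u t ω).re) P :=
  hu.gaussian.comp_left fun _ => √2 • Complex.reCLM

theorem isGaussianProcess_im (hu : IsCircularField K P u) :
    IsGaussianProcess (fun t ω => √2 * (u t ω).im) P :=
  hu.gaussian.comp_left fun _ => √2 • Complex.imCLM

theorem sqrt_two_mul_mul (x y : ℝ) : √2 * x * (√2 * y) = 2 * (x * y) := by
  rw [mul_mul_mul_comm, Real.mul_self_sqrt zero_le_two]

theorem integral_sqrt_two_re (hu : IsCircularField K P u) (t : T) :
    ∫ ω, √2 * (u t ω).re ∂P = 0 := by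
  rw [integral_const_mul, hu.mean_re, mul_zero]

theorem integral_sqrt_two_im (hu : IsCircularField K P u) (t : T) :
    ∫ ω, √2 * (u t ω).im ∂P = 0 := by
  rw [integral_const_mul, hu.mean_im, mul_zero]

theorem integral_sqrt_two_re_mul (hu : IsCircularField K P u) (s t : T) :
    ∫ ω, √2 * (u s ω).re * (√2 * (u t ω).re) ∂P = (K s t).re := by
  simp only [sqrt_two_mul_mul]
  rw [integral_const_mul, hu.re_re]; ring

theorem integral_sqrt_two_im_mul (hu : IsCircularField K P u) (s t : T) :
    ∫ ω, √2 * (u s ω).im * (√2 * (u t ω).im) ∂P = (K s t).re := by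
  simp only [sqrt_two_mul_mul]
  rw [integral_const_mul, hu.im_im]; ring

theorem measurable_re (hu : IsCircularField K P u) (t : T) :
    Measurable fun ω => √2 * (u t ω).re :=
  (Complex.measurable_re.comp (hu.measurable t)).const_mul _

theorem measurable_im (hu : IsCircularField K P u) (t : T) :
    Measurable fun ω => √2 * (u t ω).im :=
  (Complex.measurable_im.comp (hu.measurable t)).const_mul _

/-- The real and imaginary parts of a circularly symmetric field with real covariance are
independent. -/
theorem indepFun (hu : IsCircularField K P u) (hK : ∀ s t, (K s t).im = 0) :
    IndepFun (fun ω t => √2 * (u t ω).re) (fun ω t => √2 * (u t ω).im) P := by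
  have := hu.gaussian.isProbabilityMeasure
  refine IsGaussianProcess.indepFun_of_covariance_eq_zero
    (X := fun t ω => √2 * (u t ω).re) (Y := fun t ω => √2 * (u t ω).im) ?_
    (fun t => (hu.measurable_re t).aemeasurable) (fun t => (hu.measurable_im t).aemeasurable)
    fun s t => ?_
  · refine hu.gaussian.of_isGaussianProcess fun s => ?_
    rcases s with s | s
    · exact ⟨{s}, (√2 • Complex.reCLM).comp (ContinuousLinearMap.proj ⟨s, by simp⟩),
        fun ω => by simp⟩
    · exact ⟨{s}, (√2 • Complex.imCLM).comp (ContinuousLinearMap.proj ⟨s, by simp⟩),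
        fun ω => by simp⟩
  · rw [covariance_eq_sub ((hu.memLp_re s).const_mul _) ((hu.memLp_im t).const_mul _),
      hu.integral_sqrt_two_re, zero_mul, sub_zero]
    simp only [Pi.mul_apply, sqrt_two_mul_mul]
    rw [integral_const_mul, hu.re_im, hK]
    simp

end IsCircularField

end

/-! ### White noise -/

section

variable {S T Ω : Type*} [MeasurableSpace Ω] {P : Measure Ω}

/-- Independent Gaussian processes are jointly Gaussian. -/
theorem isGaussianProcess_sumElim_of_indepFun {U : S → Ω → ℝ} {V : T → Ω → ℝ}
    (hU : IsGaussianProcess U P) (hV : IsGaussianProcess V P)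
    (h : IndepFun (fun ω s => U s ω) (fun ω t => V t ω) P) :
    IsGaussianProcess (Sum.elim U V) P where
  hasGaussianLaw I := by
    classical
    have h1 : IndepFun (fun ω => I.toLeft.restrict (U · ω))
        (fun ω => I.toRight.restrict (V · ω)) P :=
      h.comp (Finset.measurable_restrict I.toLeft) (Finset.measurable_restrict I.toRight)
    have h2 := h1.hasGaussianLaw (hU.hasGaussianLaw _) (hV.hasGaussianLaw _)
    let L : ((I.toLeft → ℝ) × (I.toRight → ℝ)) →L[ℝ] (I → ℝ) :=
      ContinuousLinearMap.pi fun i => match i with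
        | ⟨Sum.inl s, hs⟩ => (ContinuousLinearMap.proj (R := ℝ) (φ := fun _ : I.toLeft => ℝ)
            ⟨s, by simpa using hs⟩).comp (ContinuousLinearMap.fst ℝ _ _)
        | ⟨Sum.inr s, hs⟩ => (ContinuousLinearMap.proj (R := ℝ) (φ := fun _ : I.toRight => ℝ)
            ⟨s, by simpa using hs⟩).comp (ContinuousLinearMap.snd ℝ _ _)
    have h3 := h2.map_fun L
    have e : (fun ω => I.restrict (Sum.elim U V · ω))
        = fun ω => L (I.toLeft.restrict (U · ω), I.toRight.restrict (V · ω)) := by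
      funext ω i
      rcases i with ⟨s | s, hi⟩ <;> rfl
    rw [e]
    exact h3

variable {X : Type*} [MeasurableSpace X] {μ : Measure X}

/-- The complex inner product in terms of real and imaginary parts. -/
theorem inner_Lp_complex (f g : Lp ℂ 2 μ) :
    (inner ℂ g f : ℂ).re = (∫ x, Complex.reCLM.compLp f x * Complex.reCLM.compLp g x ∂μ)
        + ∫ x, Complex.imCLM.compLp f x * Complex.imCLM.compLp g x ∂μ ∧
      (inner ℂ g f : ℂ).im = (∫ x, Complex.imCLM.compLp f x * Complex.reCLM.compLp g x ∂μ)
        - ∫ x, Complex.reCLM.compLp f x * Complex.imCLM.compLp g x ∂μ := by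
  have hint : ∀ a b : Lp ℝ 2 μ, Integrable (fun x => a x * b x) μ := fun a b =>
    (Lp.memLp a).integrable_mul (Lp.memLp b)
  have hi := L2.integrable_inner (𝕜 := ℂ) g f
  rw [L2.inner_def]
  constructor
  · rw [← integral_add (hint _ _) (hint _ _)]
    refine (integral_re hi).symm.trans (integral_congr_ae ?_)
    filter_upwards [Complex.reCLM.coeFn_compLp f, Complex.reCLM.coeFn_compLp g,
      Complex.imCLM.coeFn_compLp f, Complex.imCLM.coeFn_compLp g] with x h1 h2 h3 h4
    rw [h1, h2, h3, h4]
    change (f x * (starRingEnd ℂ) (g x)).re = _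
    simp
  · rw [← integral_sub (hint _ _) (hint _ _)]
    refine (integral_im hi).symm.trans (integral_congr_ae ?_)
    filter_upwards [Complex.reCLM.coeFn_compLp f, Complex.reCLM.coeFn_compLp g,
      Complex.imCLM.coeFn_compLp f, Complex.imCLM.coeFn_compLp g] with x h1 h2 h3 h4
    rw [h1, h2, h3, h4]
    change (f x * (starRingEnd ℂ) (g x)).im = _
    simp
    ring

/-- Complex white noise is a circularly symmetric field with covariance the inner product. -/
theorem isCircularField_complexWhiteNoise {U V : Lp ℝ 2 μ → Ω → ℝ} (hU : IsRealWhiteNoise μ P U)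
    (hV : IsRealWhiteNoise μ P V) (h : IndepFun (fun ω f => U f ω) (fun ω f => V f ω) P) :
    IsCircularField (fun f g : Lp ℂ 2 μ => inner ℂ g f) P
      (fun f ω => ((√2)⁻¹ : ℝ) * (complexExt U f ω + Complex.I * complexExt V f ω)) := by
  obtain ⟨r, hr, hr2⟩ : ∃ r : ℝ, (√2)⁻¹ = r ∧ r * r = 1 / 2 := ⟨_, rfl, by
    rw [← mul_inv, Real.mul_self_sqrt zero_le_two, one_div]⟩
  rw [hr]
  let R : Lp ℂ 2 μ → Lp ℝ 2 μ := fun f => Complex.reCLM.compLp f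
  let J : Lp ℂ 2 μ → Lp ℝ 2 μ := fun f => Complex.imCLM.compLp f
  have hre : ∀ f ω, ((r : ℂ) * (complexExt U f ω + Complex.I * complexExt V f ω)).re
      = r * (U (R f) ω - V (J f) ω) := fun f ω => by simp [complexExt, R, J, sub_eq_add_neg]
  have him : ∀ f ω, ((r : ℂ) * (complexExt U f ω + Complex.I * complexExt V f ω)).im
      = r * (U (J f) ω + V (R f) ω) := fun f ω => by simp [complexExt, R, J]
  have hUL : ∀ f, MemLp (U f) 2 P := fun f => (hU.gaussian.hasGaussianLaw_eval f).memLp_two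
  have hVL : ∀ f, MemLp (V f) 2 P := fun f => (hV.gaussian.hasGaussianLaw_eval f).memLp_two
  have := hU.gaussian.isProbabilityMeasure
  have hUV : ∀ f g, ∫ ω, U f ω * V g ω ∂P = 0 := fun f g => by
    have h1 : IndepFun (U f) (V g) P :=
      h.comp (measurable_pi_apply f) (measurable_pi_apply g)
    rw [h1.integral_fun_mul_eq_mul_integral (hU.measurable f).aestronglyMeasurable
      (hV.measurable g).aestronglyMeasurable, hU.mean, zero_mul]
  -- all the covariances below are of this form, with signs `s` and `t`
  have hlin : ∀ (s t : ℝ) (a b c d : Lp ℝ 2 μ),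
      ∫ ω, r * (U a ω + s * V b ω) * (r * (U c ω + t * V d ω)) ∂P
        = ((∫ x, a x * c x ∂μ) + s * t * ∫ x, b x * d x ∂μ) / 2 := by
    intro s t a b c d
    have e : ∀ ω, r * (U a ω + s * V b ω) * (r * (U c ω + t * V d ω))
        = (1 / 2) * (U a ω * U c ω + s * t * (V b ω * V d ω))
          + (1 / 2) * (t * (U a ω * V d ω) + s * (U c ω * V b ω)) := fun ω => by
      rw [← hr2]; ring
    have i1 : Integrable (fun ω => U a ω * U c ω) P := (hUL a).integrable_mul (hUL c)
    have i2 : Integrable (fun ω => s * t * (V b ω * V d ω)) P :=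
      ((hVL b).integrable_mul (hVL d)).const_mul _
    have i3 : Integrable (fun ω => t * (U a ω * V d ω)) P :=
      ((hUL a).integrable_mul (hVL d)).const_mul _
    have i12 : Integrable (fun ω => U a ω * U c ω + s * t * (V b ω * V d ω)) P := i1.add i2
    have i4 : Integrable (fun ω => s * (U c ω * V b ω)) P :=
      ((hUL c).integrable_mul (hVL b)).const_mul _
    have i34 : Integrable (fun ω => t * (U a ω * V d ω) + s * (U c ω * V b ω)) P := i3.add i4
    simp only [e]
    rw [integral_add (i12.const_mul _) (i34.const_mul _), integral_const_mul,
      integral_const_mul, integral_add i1 i2, integral_add i3 i4, integral_const_mul,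
      integral_const_mul, integral_const_mul, hUV, hUV, hU.cov, hV.cov]
    ring
  have hre' : ∀ f ω, ((r : ℂ) * (complexExt U f ω + Complex.I * complexExt V f ω)).re
      = r * (U (R f) ω + (-1) * V (J f) ω) := fun f ω => by rw [hre]; ring
  have him' : ∀ f ω, ((r : ℂ) * (complexExt U f ω + Complex.I * complexExt V f ω)).im
      = r * (U (J f) ω + 1 * V (R f) ω) := fun f ω => by rw [him]; ring
  refine ⟨fun f => ?_, ?_, fun f => ?_, fun f => ?_, fun f g => ?_, fun f g => ?_, fun f g => ?_⟩
  · have m1 := hU.measurable (R f)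
    have m2 := hU.measurable (J f)
    have m3 := hV.measurable (R f)
    have m4 := hV.measurable (J f)
    simp only [R, J] at m1 m2 m3 m4
    unfold complexExt
    fun_prop
  · classical
    have hG := isGaussianProcess_sumElim_of_indepFun hU.gaussian hV.gaussian h
    refine hG.of_isGaussianProcess fun f => ?_
    let I : Finset (Lp ℝ 2 μ ⊕ Lp ℝ 2 μ) :=
      {Sum.inl (R f), Sum.inl (J f), Sum.inr (R f), Sum.inr (J f)}
    let p : I → (I → ℝ) →L[ℝ] ℝ := ContinuousLinearMap.proj
    refine ⟨I, r • ((p ⟨Sum.inl (R f), by simp [I]⟩ - p ⟨Sum.inr (J f), by simp [I]⟩).smulRight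
        (1 : ℂ) + (p ⟨Sum.inl (J f), by simp [I]⟩ + p ⟨Sum.inr (R f), by simp [I]⟩).smulRight
        Complex.I), fun ω => ?_⟩
    apply Complex.ext
    · rw [hre]; simp [p]
    · rw [him]; simp [p]
  · simp only [hre]
    rw [integral_const_mul, integral_sub ((hUL _).integrable one_le_two)
      ((hVL _).integrable one_le_two), hU.mean, hV.mean]
    simp
  · simp only [him]
    rw [integral_const_mul, integral_add ((hUL _).integrable one_le_two)
      ((hVL _).integrable one_le_two), hU.mean, hV.mean]
    simp
  · simp only [hre', hlin]
    rw [(inner_Lp_complex f g).1]; ring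
  · simp only [him', hlin]
    rw [(inner_Lp_complex f g).1]; ring
  · simp only [hre', him', hlin]
    rw [(inner_Lp_complex f g).2]; ring

end

/-! ### The characterisation of hyperbolic random waves -/

theorem SameLaw.comp_right {T S E Ω Ω' : Type*} [MeasurableSpace E] [MeasurableSpace Ω]
    [MeasurableSpace Ω'] {P : Measure Ω} {P' : Measure Ω'} {u : T → Ω → E} {v : T → Ω' → E}
    (h : SameLaw P u P' v) (f : S → T) : SameLaw P (fun s => u (f s)) P' (fun s => v (f s)) :=
  IdentDistrib.comp (u := fun (z : T → E) s => z (f s)) h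
    (measurable_pi_lambda _ fun s => measurable_pi_apply (f s))

/-- The rescaled real part of a circularly symmetric field of eigenfunctions is a real wave. -/
theorem IsCircularField.isRealWave_re {n : ℕ} (hn : 2 ≤ n) {α lam : ℝ} {Ω : Type*}
    [MeasurableSpace Ω] {P : Measure Ω} {u : HyperbolicSpace n → Ω → ℂ}
    (hu : IsCircularField (fun x y => sphericalFunction n α (hypDist x y)) P u)
    (he : ∀ᵐ ω ∂P, IsHypEigenfunction lam fun x => u x ω) :
    IsRealWave n lam P fun x ω => √2 * (u x ω).re := by
  refine isRealWave_of_integral_mul hn hu.measurable_re hu.isGaussianProcess_re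
    hu.integral_sqrt_two_re hu.integral_sqrt_two_re_mul ?_
  filter_upwards [he] with ω hω
  exact hω.clm_comp (√2 • Complex.reCLM)

theorem mainTheorem8 (n : ℕ) (hn : 2 ≤ n) (α : ℝ) (hα : 0 ≤ α) (lam : ℝ)
    (hlam : lam = hypSigma n ^ 2 + α ^ 2) :
    -- (1) existence of the real and of the complex wave
    (∃ (Ω : Type) (_ : MeasurableSpace Ω) (P : Measure Ω) (u : HyperbolicSpace n → Ω → ℝ),
      IsProbabilityMeasure P ∧ IsRealWave n lam P u) ∧
    (∃ (Ω : Type) (_ : MeasurableSpace Ω) (P : Measure Ω) (u : HyperbolicSpace n → Ω → ℂ),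
      IsProbabilityMeasure P ∧ IsComplexWave n lam P u) ∧
    -- (1) uniqueness in law
    (∀ (Ω : Type a) (Ω' : Type b) [MeasurableSpace Ω] [MeasurableSpace Ω']
      (P : Measure Ω) (P' : Measure Ω') [IsProbabilityMeasure P] [IsProbabilityMeasure P']
      (u : HyperbolicSpace n → Ω → ℝ) (v : HyperbolicSpace n → Ω' → ℝ),
      IsRealWave n lam P u → IsRealWave n lam P' v → SameLaw P u P' v) ∧
    (∀ (Ω : Type a) (Ω' : Type b) [MeasurableSpace Ω] [MeasurableSpace Ω']
      (P : Measure Ω) (P' : Measure Ω') [IsProbabilityMeasure P] [IsProbabilityMeasure P']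
      (u : HyperbolicSpace n → Ω → ℂ) (v : HyperbolicSpace n → Ω' → ℂ),
      IsComplexWave n lam P u → IsComplexWave n lam P' v → SameLaw P u P' v) ∧
    -- (1) almost no sample is square integrable: the samples are generalized eigenfunctions
    (∀ (Ω : Type a) [MeasurableSpace Ω] (P : Measure Ω) [IsProbabilityMeasure P]
      (u : HyperbolicSpace n → Ω → ℝ), IsRealWave n lam P u →
      ∀ᵐ ω ∂P, ¬ MemLp (fun x => u x ω) 2 (hypVolume n)) ∧
    (∀ (Ω : Type a) [MeasurableSpace Ω] (P : Measure Ω) [IsProbabilityMeasure P]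
      (u : HyperbolicSpace n → Ω → ℂ), IsComplexWave n lam P u →
      ∀ᵐ ω ∂P, ¬ MemLp (fun x => u x ω) 2 (hypVolume n)) ∧
    -- (2) mean and covariance of the real wave
    (∀ (Ω : Type a) [MeasurableSpace Ω] (P : Measure Ω) [IsProbabilityMeasure P]
      (u : HyperbolicSpace n → Ω → ℝ), IsRealWave n lam P u →
      (∀ x, ∫ ω, u x ω ∂P = 0) ∧
      ∀ x y, ((∫ ω, u x ω * u y ω ∂P : ℝ) : ℂ) = sphericalFunction n α (hypDist x y)) ∧
    -- (2) a Gaussian field with this mean and covariance has the law of the real wave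
    (∀ (Ω : Type a) (Ω' : Type b) [MeasurableSpace Ω] [MeasurableSpace Ω']
      (P : Measure Ω) (P' : Measure Ω') [IsProbabilityMeasure P] [IsProbabilityMeasure P']
      (u : HyperbolicSpace n → Ω → ℝ) (v : HyperbolicSpace n → Ω' → ℝ),
      IsRealWave n lam P u → (∀ x, Measurable (v x)) → IsGaussianProcess v P' →
      (∀ x, ∫ ω, v x ω ∂P' = 0) →
      (∀ x y, ((∫ ω, v x ω * v y ω ∂P' : ℝ) : ℂ) = sphericalFunction n α (hypDist x y)) →
      SameLaw P' v P u) ∧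
    -- (2) rescaled real and imaginary parts of the complex wave
    (∀ (Ω : Type a) (Ω' : Type b) [MeasurableSpace Ω] [MeasurableSpace Ω']
      (P : Measure Ω) (P' : Measure Ω') [IsProbabilityMeasure P] [IsProbabilityMeasure P']
      (u : HyperbolicSpace n → Ω → ℝ) (w : HyperbolicSpace n → Ω' → ℂ),
      IsRealWave n lam P u → IsComplexWave n lam P' w →
      IndepFun (fun ω x => √2 * (w x ω).re) (fun ω x => √2 * (w x ω).im) P' ∧
      SameLaw P' (fun x ω => √2 * (w x ω).re) P u ∧
      SameLaw P' (fun x ω => √2 * (w x ω).im) P u) ∧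
    -- (3) the complex wave as a stochastic integral of plane waves
    (∀ (Ω : Type a) (Ω' : Type b) [MeasurableSpace Ω] [MeasurableSpace Ω']
      (P : Measure Ω) (P' : Measure Ω') [IsProbabilityMeasure P] [IsProbabilityMeasure P']
      (w : HyperbolicSpace n → Ω → ℂ) (W : Lp ℂ 2 (uniformSphere n) → Ω' → ℂ),
      IsComplexWave n lam P w → IsComplexWhiteNoise (uniformSphere n) P' W →
      SameLaw P w P' (fun x => W (planeWaveLp x α))) := by
  subst hlam
  obtain ⟨Ω₀, mΩ₀, P₀, hP₀, u₀, hu₀, he₀⟩ := exists_circularField hn α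
  have hF : ∀ x y : HyperbolicSpace n, sphericalFunction n α (hypDist x y)
      = ((sphericalFunction n α (hypDist x y)).re : ℂ) := fun x y =>
    Complex.ext rfl (by rw [sphericalFunction_hypDist_im hn, Complex.ofReal_im])
  refine ⟨⟨Ω₀, mΩ₀, P₀, _, hP₀, hu₀.isRealWave_re hn (Eventually.of_forall he₀)⟩,
    ⟨Ω₀, mΩ₀, P₀, u₀, hP₀, hu₀.isComplexWave hn (Eventually.of_forall he₀)⟩,
    ?_, ?_, ?_, ?_, ?_, ?_, ?_, ?_⟩
  · intro Ω Ω' _ _ P P' _ _ u v hu hv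
    exact sameLaw_of_centered_real hu.gaussian hv.gaussian hu.measurable hv.measurable
      (IsRealWave.integral_eq_zero hu) (IsRealWave.integral_eq_zero hv) fun x y => by
        rw [IsRealWave.integral_mul hn rfl hu, IsRealWave.integral_mul hn rfl hv]
  · intro Ω Ω' _ _ P P' _ _ u v hu hv
    exact (IsComplexWave.isCircularField hn rfl hu).sameLaw
      (IsComplexWave.isCircularField hn rfl hv)
  · intro Ω _ P _ u hu
    have := nullSingletonClass_gaussianReal (μ := 0) (v := 1) one_ne_zero
    exact hu.ae_not_memLp hn (measure_singleton 0)
  · intro Ω _ P _ u hu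
    exact hu.ae_not_memLp hn stdComplexGaussian_singleton_zero
  · intro Ω _ P _ u hu
    refine ⟨IsRealWave.integral_eq_zero hu, fun x y => ?_⟩
    rw [IsRealWave.integral_mul hn rfl hu, ← hF]
  · intro Ω Ω' _ _ P P' _ _ u v hu hv hg h0 hcov
    refine sameLaw_of_centered_real hg hu.gaussian hv hu.measurable h0
      (IsRealWave.integral_eq_zero hu) fun x y => ?_
    rw [IsRealWave.integral_mul hn rfl hu, ← hcov, Complex.ofReal_re]
  · intro Ω Ω' _ _ P P' _ _ u w hu hw
    have hc := IsComplexWave.isCircularField hn rfl hw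
    refine ⟨hc.indepFun fun x y => sphericalFunction_hypDist_im hn x y,
      sameLaw_of_centered_real hc.isGaussianProcess_re hu.gaussian hc.measurable_re hu.measurable
        hc.integral_sqrt_two_re (IsRealWave.integral_eq_zero hu) fun x y => ?_,
      sameLaw_of_centered_real hc.isGaussianProcess_im hu.gaussian hc.measurable_im hu.measurable
        hc.integral_sqrt_two_im (IsRealWave.integral_eq_zero hu) fun x y => ?_⟩
    · rw [hc.integral_sqrt_two_re_mul, IsRealWave.integral_mul hn rfl hu]
    · rw [hc.integral_sqrt_two_im_mul, IsRealWave.integral_mul hn rfl hu]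
  · intro Ω Ω' _ _ P P' _ _ w W hw hW
    obtain ⟨-, Ω'', _, P'', U, V, _, hU, hV, hUV, hlaw⟩ := hW
    have hc := (isCircularField_complexWhiteNoise hU hV hUV).comp_right
      fun x : HyperbolicSpace n => planeWaveLp x α
    simp only [inner_planeWaveLp hn] at hc
    exact ((IsComplexWave.isCircularField hn rfl hw).sameLaw hc).trans
      (hlaw.comp_right fun x => planeWaveLp x α).symm
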